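/- **Setting.** Let $Y_d\searrow X_d$ be the local model of a Type II extremal transition of degree $d=6$ (the contraction to a point of a del Pezzo surface of degree $6$ in a threefold, followed by a smoothing). There are two smoothings: in case $6\mathrm{I}$, $X$ is a smooth divisor of bidegree $(1,1)$ in $\mathbb P^2\times\mathbb P^2$; in case $6\mathrm{II}$, $X=\mathbb P^1\times\mathbb P^1\times\mathbb P^1$. Put $(\kappa,\lambda,\mu)=(7,2,8)$ in case $6\mathrm{I}$ and $(\kappa,\lambda,\mu)=(10,3,-9)$ in case $6\mathrm{II}$. These are the coefficients of the Picard–Fuchs operator of the local model. Write $P=P^\ell$ for the mirror coordinate and $\theta=P\,\frac{d}{dP}$. Let $f(P)=1+\sum_{m\ge1}f_mP^m$ be the unique power series with constant term $1$ satisfying $$(1+\kappa P-\mu P^2)\,\theta^2f+(\kappa P-2\mu P^2)\,\theta f+(\lambda P-\mu P^2)f=0,$$ and let $g(P)=\sum_{m\ge1}\frac{f_m}{m}P^m$, so that $f=1+\theta g$. The quantum variable of the contracted curve class $\ell$ is, near $P=0$, given by the mirror map $$Q^\ell=P\,e^{g(P)} .$$ The $P$-line is identified with the modular curve $X(\Gamma_1(6))$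 by the Hauptmodul ($\eta$ is the Dedekind eta function, $\operatorname{Im}\tau>0$) $$P_{6\mathrm I}(\tau)=-\frac{\eta(\tau)^3\eta(6\tau)^9}{\eta(2\tau)^3\eta(3\tau)^9},\qquad P_{6\mathrm{II}}(\tau)=-\frac{\eta(\tau)^4\eta(6\tau)^8}{\eta(2\tau)^8\eta(3\tau)^4};$$ $P=0$ corresponds to the cusp $i\infty$, and $P=\infty$ to the *transition point*, which is the cusp $[\frac13]=\Gamma_1(6)\cdot\frac13$ in case $6\mathrm{I}$ and $[\frac12]=\Gamma_1(6)\cdot\frac12$ in case $6\mathrm{II}$. For a rational number $r$ representing the transition point, consider paths $\tau:(0,1)\to\mathbb H$ (continuous) from $i\infty$ to $r$, i.e. $\operatorname{Im}\tau(s)\to\infty$ as $s\to0^+$ and $\operatorname{Im}\tau(s)/|\tau(s)-r|^2\to\infty$ as $s\to1^-$ (convergence to the cusp $r$ in the extended upper half plane). These are the lifts of the paths $p(s)=P(\tau(s))$ in the $P$-line from $0$ to $\infty$. We write $Q^\ell_r=L$ if, for every such path, the germ $Q^\ell=Pe^{g(P)}$ at $P=0$ has an analytic continuation along $p$, the values $Q^\ell(s)$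 at $p(s)$ of this continuation tend to $L$ as $s\to1^-$ whenever $\tau$ approaches $r$ nontangentially (that is, $|\operatorname{Re}\tau(s)-r|\le C\operatorname{Im}\tau(s)$ for some constant $C$ and all $s$ close to $1$), and for an arbitrary such path $L$ is the only possible limit of $Q^\ell(s)$. **Theorem 1.4.** 1. In case $6\mathrm{I}$, for every $r\in[\frac13]$ the limit $Q^\ell_r$ exists and is a root of unity. 2. In case $6\mathrm{II}$, the elements of $[\frac12]$ are exactly the rational numbers $r=\frac ac$ with $a,c\in\mathbb Z$, $\gcd(a,c)=1$ and $c\equiv2\pmod 6$ ($c$ may be negative), and for each of these the limit $Q^\ell_r$ exists and $$Q^\ell_r=\omega\cdot e^{-c\,L'(-1,\chi_{3,2})}$$ for some root of unity $\omega$, where $\chi_{3,2}=\left(\frac{-3}{\cdot}\right)$ is the nontrivial Dirichlet character modulo $3$ and $L(s,\chi_{3,2})$ is its (analytically continued) Dirichlet $L$-function. In particular, $Q^\ell_r$ is not a root of unity. -/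

import Mathlib

open Filter Topology

namespace DelPezzo

/-- The two smoothings in degree `d = 6`: the del Pezzo threefold `X` is a divisor of bidegree
`(1, 1)` in `ℙ² × ℙ²` (case `6I`), or `ℙ¹ × ℙ¹ × ℙ¹` (case `6II`). -/
inductive Smoothing where
  | sixI
  | sixII

/-- The coefficient `κ` of the Picard–Fuchs operator
`F̂³ - P^ℓ (κ F̂² + κ z F̂ + λ z²) Ê - μ P^{2ℓ} (F̂ + z) Ê (Ê - z)` of the local model. -/
def kappa : Smoothing → ℚ
  | .sixI => 7
  | .sixII => 10

/-- The coefficient `λ` of the Picard–Fuchs operator. -/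
def lam : Smoothing → ℚ
  | .sixI => 2
  | .sixII => 3

/-- The coefficient `μ` of the Picard–Fuchs operator. -/
def mu : Smoothing → ℚ
  | .sixI => 8
  | .sixII => -9

/-- The coefficients of the power series `f = ∑ f_m P^m` with `f_0 = 1` that satisfy
`(m+1)² f_{m+1} + (κ (m² + m) + λ) f_m - μ m² f_{m-1} = 0`. -/
def fCoeff (d : Smoothing) : ℕ → ℚ
  | 0 => 1
  | 1 => -lam d
  | (m + 2) =>
      (-(kappa d * ((m + 1) ^ 2 + (m + 1)) + lam d) * fCoeff d (m + 1)
        + mu d * (m + 1) ^ 2 * fCoeff d m) / (m + 2) ^ 2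

/-- The formal Euler operator `θ = P d/dP`. -/
noncomputable def theta (φ : PowerSeries ℚ) : PowerSeries ℚ :=
  PowerSeries.X * PowerSeries.derivative ℚ φ

/-- The equation
`(1 + κ P - μ P²) θ²φ + (κ P - 2 μ P²) θφ + (λ P - μ P²) φ = 0` for a formal power series. -/
def SolvesPF (d : Smoothing) (φ : PowerSeries ℚ) : Prop :=
  (1 + PowerSeries.C (kappa d) * PowerSeries.X
      - PowerSeries.C (mu d) * PowerSeries.X ^ 2) * theta (theta φ)
    + (PowerSeries.C (kappa d) * PowerSeries.X
      - PowerSeries.C (2 * mu d) * PowerSeries.X ^ 2) * theta φ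
    + (PowerSeries.C (lam d) * PowerSeries.X
      - PowerSeries.C (mu d) * PowerSeries.X ^ 2) * φ = 0

theorem coeff_theta (φ : PowerSeries ℚ) (n : ℕ) :
    PowerSeries.coeff n (theta φ) = n * PowerSeries.coeff n φ := by
  unfold theta
  cases n with
  | zero => simp
  | succ n =>
    rw [PowerSeries.coeff_succ_X_mul, PowerSeries.coeff_derivative]
    push_cast
    ring

theorem constantCoeff_theta (φ : PowerSeries ℚ) :
    PowerSeries.constantCoeff (theta φ) = 0 := by
  simp [theta]

open PowerSeries in
/-- The series `∑ f_m P^m` is the unique solution of the equation above with constant term `1`. -/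
theorem solvesPF_iff (d : Smoothing) (φ : PowerSeries ℚ) :
    (SolvesPF d φ ∧ PowerSeries.coeff 0 φ = 1) ↔ φ = PowerSeries.mk (fCoeff d) := by
  have key : SolvesPF d φ ↔ ((lam d * coeff 0 φ + coeff 1 φ = 0) ∧ ∀ m : ℕ,
      ((m : ℚ) + 2) ^ 2 * coeff (m + 2) φ
        + (kappa d * (((m : ℚ) + 1) ^ 2 + (m + 1)) + lam d) * coeff (m + 1) φ
        - mu d * ((m : ℚ) + 1) ^ 2 * coeff m φ = 0) := by
    have hX : ∀ ψ : PowerSeries ℚ, coeff 1 (X * ψ) = constantCoeff ψ := fun ψ => by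
      rw [show (1 : ℕ) = 0 + 1 from rfl, coeff_succ_X_mul, coeff_zero_eq_constantCoeff]
    unfold SolvesPF
    rw [PowerSeries.ext_iff]
    have e : ∀ n, coeff n ((1 + C (kappa d) * X - C (mu d) * X ^ 2) * theta (theta φ)
        + (C (kappa d) * X - C (2 * mu d) * X ^ 2) * theta φ
        + (C (lam d) * X - C (mu d) * X ^ 2) * φ)
        = coeff n (theta (theta φ) + X * (C (kappa d) * (theta (theta φ)) + C (kappa d) * theta φ
          + C (lam d) * φ) - X * (X * (C (mu d) * theta (theta φ) + C (2 * mu d) * theta φ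
          + C (mu d) * φ))) := by
      intro n
      congr 1
      ring
    simp only [e]
    constructor
    · intro h
      refine ⟨?_, fun m => ?_⟩
      · have h1 := h 1
        simp only [map_sub, map_add, hX] at h1
        simp [coeff_theta, constantCoeff_theta] at h1
        simp only [coeff_zero_eq_constantCoeff]
        linarith
      · have := h (m + 2)
        simp only [map_sub, map_add, coeff_succ_X_mul, coeff_C_mul, coeff_theta, map_zero] at this
        push_cast at this
        linear_combination this
    · rintro ⟨h1, h2⟩ n
      match n with
      | 0 => simp [constantCoeff_theta]
      | 1 =>
        simp only [map_sub, map_add, hX]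
        simp only [coeff_zero_eq_constantCoeff] at h1
        simp [coeff_theta, constantCoeff_theta]
        linarith
      | m + 2 =>
        simp only [map_sub, map_add, coeff_succ_X_mul, coeff_C_mul, coeff_theta, map_zero]
        push_cast
        linear_combination h2 m
  rw [key]
  constructor
  · rintro ⟨⟨h1, h2⟩, h0⟩
    have : ∀ n, coeff n φ = fCoeff d n ∧ coeff (n + 1) φ = fCoeff d (n + 1) := by
      intro n
      induction n with
      | zero => refine ⟨by simpa [fCoeff] using h0, ?_⟩; simp [fCoeff]; rw [h0] at h1; linarith
      | succ m ih =>
        refine ⟨ih.2, ?_⟩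
        have h := h2 m
        rw [ih.1, ih.2] at h
        rw [fCoeff, eq_div_iff (by positivity)]
        linear_combination h
    ext n
    rw [(this n).1, coeff_mk]
  · rintro rfl
    refine ⟨⟨by simp [fCoeff], fun m => ?_⟩, by simp [fCoeff]⟩
    simp only [coeff_mk]
    rw [fCoeff]
    have : ((m : ℚ) + 2) ^ 2 ≠ 0 := by positivity
    field_simp
    ring

/-- The mirror map correction `g(P) = ∑_{m ≥ 1} (f_m / m) P^m`, so that `f = 1 + θ g` and
`g(0) = 0` (near `P = 0`, where the series converges). -/
noncomputable def g (d : Smoothing) (P : ℂ) : ℂ :=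
  ∑' m : ℕ, ((fCoeff d (m + 1) / (m + 1) : ℚ) : ℂ) * P ^ (m + 1)

/-- The germ at `P = 0` of the quantum variable `Q^ℓ = P exp (g(P))` as a function of the
mirror coordinate `P = P^ℓ`. -/
noncomputable def Q (d : Smoothing) (P : ℂ) : ℂ :=
  P * Complex.exp (g d P)

/-- The Hauptmodul of `Γ₁(6)` through which the line of the mirror coordinate `P^ℓ` is identified
with the modular curve `X(Γ₁(6))`; it has the expansion `-q + O(q²)` at `i∞`. -/
noncomputable def hauptmodul (d : Smoothing) (τ : UpperHalfPlane) : ℂ :=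
  match d with
  | .sixI =>
      -(ModularForm.eta (τ : ℂ) ^ 3 * ModularForm.eta (6 * (τ : ℂ)) ^ 9
        / (ModularForm.eta (2 * (τ : ℂ)) ^ 3 * ModularForm.eta (3 * (τ : ℂ)) ^ 9))
  | .sixII =>
      -(ModularForm.eta (τ : ℂ) ^ 4 * ModularForm.eta (6 * (τ : ℂ)) ^ 8
        / (ModularForm.eta (2 * (τ : ℂ)) ^ 8 * ModularForm.eta (3 * (τ : ℂ)) ^ 4))

/-- The representative `1/3` (case `6I`) or `1/2` (case `6II`) of the transition point. -/
def baseCusp : Smoothing → ℚ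
  | .sixI => 1 / 3
  | .sixII => 1 / 2

/-- The transition point, i.e. the cusp of `Γ₁(6)` that corresponds to `P^ℓ = ∞`, as the set of its
representatives in `ℚ`: the orbit of `1/3` (case `6I`) or `1/2` (case `6II`). -/
def transitionPoint (d : Smoothing) : Set ℚ :=
  {r | ∃ A ∈ CongruenceSubgroup.Gamma1 6,
    (A 1 0 : ℚ) * baseCusp d + (A 1 1 : ℚ) ≠ 0 ∧
    r = ((A 0 0 : ℚ) * baseCusp d + (A 0 1 : ℚ)) / ((A 1 0 : ℚ) * baseCusp d + (A 1 1 : ℚ))}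

/-- A path in the extended upper half plane from `i∞` to the cusp `r`: it lies in the upper half
plane for parameters in `(0, 1)`, and at both ends it converges in the horocycle topology (it
enters every horoball `Im τ > M |τ - r|²` tangent to the real line at `r`). -/
structure IsPathToCusp (r : ℚ) (τ : ℝ → UpperHalfPlane) : Prop where
  continuousOn : ContinuousOn τ (Set.Ioo 0 1)
  start : Tendsto (fun s => (τ s).im) (𝓝[>] 0) atTop
  finish : Tendsto (fun s => (τ s).im / ‖(τ s : ℂ) - (r : ℂ)‖ ^ 2) (𝓝[<] 1) atTop

/-- The path approaches `r` inside a sector `|Re τ - r| ≤ C Im τ`. -/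
def IsNontangential (r : ℚ) (τ : ℝ → UpperHalfPlane) : Prop :=
  ∃ C : ℝ, ∀ᶠ s in 𝓝[<] (1 : ℝ), |(τ s).re - (r : ℝ)| ≤ C * (τ s).im

/-- `F` is an analytic continuation, along the path `p : (0, 1) → ℂ` issuing from `0`, of a
function `φ` given near `0`: each `F s` is analytic at `p s`, the germs of `F s` are locally
consistent along the path, and near the start of the path they are the germs of `φ`. -/
structure IsContinuationAlong (φ : ℂ → ℂ) (p : ℝ → ℂ) (F : ℝ → ℂ → ℂ) : Prop where
  analyticAt : ∀ s ∈ Set.Ioo (0 : ℝ) 1, AnalyticAt ℂ (F s) (p s)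
  consistent : ∀ s ∈ Set.Ioo (0 : ℝ) 1, ∀ᶠ t in 𝓝 s, F t =ᶠ[𝓝 (p t)] F s
  initial : ∀ᶠ s in 𝓝[>] (0 : ℝ), F s =ᶠ[𝓝 (p s)] φ

/-- `L` is the limit `Q_r^ℓ` of the quantum variable `Q^ℓ` as `P^ℓ → ∞` along the paths in the
`P^ℓ`-line whose lift to the extended upper half plane ends at the cusp `r`: for every such path,
`Q^ℓ` can be continued analytically along it, the values of the continuation converge to `L` if the
lift approaches `r` nontangentially, and for an arbitrary lift `L` is the only possible limit. -/
def IsLimitAtCusp (d : Smoothing) (r : ℚ) (L : ℂ) : Prop :=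
  ∀ τ : ℝ → UpperHalfPlane, IsPathToCusp r τ →
    (∃ F, IsContinuationAlong (Q d) (fun s => hauptmodul d (τ s)) F) ∧
    ∀ F, IsContinuationAlong (Q d) (fun s => hauptmodul d (τ s)) F →
      (IsNontangential r τ →
        Tendsto (fun s => F s (hauptmodul d (τ s))) (𝓝[<] 1) (𝓝 L)) ∧
      ∀ L' : ℂ, Tendsto (fun s => F s (hauptmodul d (τ s))) (𝓝[<] 1) (𝓝 L') → L' = L

/-- A complex number some positive power of which is `1`. -/
def IsRootOfUnity (w : ℂ) : Prop :=
  ∃ n : ℕ, 0 < n ∧ w ^ n = 1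

/-- The nontrivial Dirichlet character modulo `3`. -/
noncomputable def chi3 : DirichletCharacter ℂ 3 :=
  (quadraticChar (ZMod 3)).ringHomComp (Int.castRingHom ℂ)

end DelPezzo

namespace DelPezzo

open Complex hiding eta
open Asymptotics ModularForm

/-! ### The nome, the Euler product and the Dedekind eta function -/

/-! Write D for (2πi)⁻¹ d/dτ. Four eta quotients a, b, c, d of weight one on Γ₁(6) (`formA` to
`formD`), each vanishing at exactly one cusp, govern both smoothings. They satisfy D log(b/a) = cd,
D log(b/c) = ad, D log(b/d) = ac, hence c = a + b and d = a - 8b (`formC_eq`, `formD_eq`). In case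
6I one has P = -b/a and f = a, in case 6II P = -b/c and f = c. That these forms solve the
Picard–Fuchs equation comes down to one identity in weight four, for the derivative of D log a
(`defect_eq_zero`); `solF_comp_eq` then identifies the power series f with the modular form.

Since log Q = log P + g and 1 + θg = f, it follows that D log Q = f · D log P = acd in both cases.
So one function `quantum` on the upper half plane describes Q for both smoothings
(`exists_quantum_eq`). The forms giving D log P have no zeros there, so P is a local biholomorphism
and analytic continuation along paths amounts to evaluating `quantum` on the lift
(`continuation_eq`).

The form acd is an Eisenstein series of weight three, 1 - ∑ ψ(l) l² q^(kl), which vanishes at every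
cusp not equivalent to i∞ (`exists_formE_mobius`). In a coordinate w at such a cusp, `quantum` is
therefore L · exp of an Eichler integral, that is, of a linear factor times an exponentially small
series plus another such series. In sectors this integral tends to 0, which gives the nontangential
limit L. Along tangential paths the linear factor may compensate the decay, but then the phase of
the integral turns infinitely often and its exponential has no limit at all
(`eq_one_of_tendsto_exp_eichler`).

To compute L, let V be the limit of the potential ∑ ψ(l) (l/k) q^(kl) down the vertical line over
a/c. Its Mellin transform behaves like V/s at s = 0, and it equals Γ(s) times a finite combination
of products of Hurwitz-type zeta functions at s - 1 and s + 1. Because ψ is odd, only two kinds of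
products occur. The products even × sine have at s = 0 a value in 2πi·ℚ and only contribute a root
of unity. The products odd × cosine combine a zero with a possible pole, which occurs only for
residues divisible by c, and leave derivatives at -1 (`tendsto_zetaSum`, `exists_tendsto_quantum`).
For c ≡ 3 mod 6, ψ kills these residues; for c ≡ 2 mod 6 they add up to c L'(-1, χ).

Finally, the functional equation turns L'(-1, χ) into a positive multiple of ∑ sin(2πn/3)/n², which
is positive by comparison with ζ(2) (`oddDeriv_eq`, `re_sinZeta_pos`). Hence the limit in case 6II
has absolute value different from 1. -/

/-- The nome `e^(2πiz)`. -/
noncomputable def nome (z : ℂ) : ℂ := cexp (2 * Real.pi * I * z)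

/-- The filter of neighbourhoods of `i∞`. -/
def cuspInf : Filter ℂ := comap Complex.im atTop

theorem nome_ne_zero (z : ℂ) : nome z ≠ 0 := exp_ne_zero _

theorem norm_nome (z : ℂ) : ‖nome z‖ = Real.exp (-2 * Real.pi * z.im) := by
  simp [nome, norm_exp]

theorem norm_nome_lt_one {z : ℂ} (hz : 0 < z.im) : ‖nome z‖ < 1 := by
  rw [norm_nome, Real.exp_lt_one_iff]
  have := Real.pi_pos
  nlinarith [mul_pos this hz]

theorem hasDerivAt_nome (z : ℂ) : HasDerivAt nome (2 * Real.pi * I * nome z) z := by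
  have h := ((hasDerivAt_id z).const_mul (2 * Real.pi * I)).cexp
  have e : nome = fun z => cexp (2 * Real.pi * I * id z) := rfl
  rw [e]
  convert! h using 1
  ring

theorem nome_add (z w : ℂ) : nome (z + w) = nome z * nome w := by
  simp [nome, mul_add, exp_add]

theorem nome_nat_mul (n : ℕ) (z : ℂ) : nome (n * z) = nome z ^ n := by
  rw [nome, nome, ← exp_nat_mul]; ring_nf

theorem nome_int (n : ℤ) : nome n = 1 := by
  rw [nome, show 2 * Real.pi * I * n = n * (2 * Real.pi * I) by ring]
  exact exp_int_mul_two_pi_mul_I n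

theorem eventually_cuspInf (M : ℝ) : ∀ᶠ z in cuspInf, M ≤ z.im :=
  (eventually_ge_atTop M).comap _

theorem eventually_cuspInf_pos : ∀ᶠ z in cuspInf, 0 < z.im :=
  (eventually_gt_atTop 0).comap _

instance : cuspInf.NeBot := by
  refine comap_neBot fun s hs => ?_
  obtain ⟨x, hx⟩ := (inferInstance : (atTop : Filter ℝ).NeBot).nonempty_of_mem hs
  exact ⟨x * I, by simpa using hx⟩

theorem tendsto_im_cuspInf : Tendsto Complex.im cuspInf atTop := tendsto_comap

theorem tendsto_nome : Tendsto nome cuspInf (𝓝 0) := by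
  rw [tendsto_zero_iff_norm_tendsto_zero]
  simp only [norm_nome]
  refine Real.tendsto_exp_atBot.comp ?_
  refine Tendsto.const_mul_atTop_of_neg ?_ tendsto_im_cuspInf
  have := Real.pi_pos
  linarith

theorem tendsto_affine_cuspInf {s : ℝ} (hs : 0 < s) (t : ℝ) :
    Tendsto (fun z : ℂ => s * z + t) cuspInf cuspInf := by
  rw [cuspInf, tendsto_comap_iff]
  have : (Complex.im ∘ fun z : ℂ => (s : ℂ) * z + t) = fun z => s * z.im := by
    ext z; simp
  rw [this]
  exact (tendsto_comap : Tendsto Complex.im (comap Complex.im atTop) atTop).const_mul_atTop hs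

theorem im_affine (s t : ℝ) (z : ℂ) : ((s : ℂ) * z + t).im = s * z.im := by simp

/-- The Euler product `∏ (1 - q^n)`. -/
noncomputable def euler (q : ℂ) : ℂ := ∏' n : ℕ, (1 - q ^ (n + 1))

theorem differentiableOn_euler : DifferentiableOn ℂ euler (Metric.ball 0 1) :=
  differentiableOn_tprod_one_sub_pow

theorem differentiableAt_euler {q : ℂ} (hq : ‖q‖ < 1) : DifferentiableAt ℂ euler q :=
  differentiableOn_euler.differentiableAt (Metric.isOpen_ball.mem_nhds (by simpa using hq))

theorem analyticAt_euler {q : ℂ} (hq : ‖q‖ < 1) : AnalyticAt ℂ euler q :=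
  differentiableOn_euler.analyticAt (Metric.isOpen_ball.mem_nhds (by simpa using hq))

theorem summable_norm_pow_succ {q : ℂ} (hq : ‖q‖ < 1) : Summable fun n : ℕ => ‖q ^ (n + 1)‖ := by
  simp only [norm_pow]
  exact (summable_nat_add_iff 1).mpr (summable_geometric_of_lt_one (norm_nonneg _) hq)

theorem euler_ne_zero {q : ℂ} (hq : ‖q‖ < 1) : euler q ≠ 0 := by
  have := tprod_one_add_ne_zero_of_summable (f := fun n : ℕ => -q ^ (n + 1)) (fun n h => ?_)
    (by simpa using summable_norm_pow_succ hq)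
  · simpa [euler, sub_eq_add_neg] using this
  · have h1 : q ^ (n + 1) = 1 := by linear_combination -h
    have h2 : ‖q‖ ^ (n + 1) = 1 := by rw [← norm_pow, h1, norm_one]
    have := pow_lt_one₀ (norm_nonneg q) hq (Nat.succ_ne_zero n)
    exact absurd h2 this.ne

@[simp] theorem euler_zero : euler 0 = 1 := by simp [euler]

theorem exp_sub_one_le {x : ℝ} (hx1 : x ≤ 1) (hx0 : 0 ≤ x) :
    Real.exp x - 1 ≤ Real.exp 1 * x := by
  have h3 := Real.add_one_le_exp (-x)
  have h4 : Real.exp x * Real.exp (-x) = 1 := by rw [← Real.exp_add]; simp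
  have h5 : Real.exp x ≤ Real.exp 1 := Real.exp_le_exp.mpr hx1
  have h6 : Real.exp x * (1 - x) ≤ 1 := by
    rw [← h4]
    exact mul_le_mul_of_nonneg_left (by linarith) (Real.exp_pos x).le
  have h7 := mul_le_mul_of_nonneg_right h5 hx0
  linarith

/-- Finite products satisfy |∏(1 + x) - 1| ≤ exp(∑|x|) - 1, and the bound passes to the limit. Its
purpose is the derivative of the Euler product at 0, from which the q-coefficients of E₂ and of all
eta quotients are read off. -/
theorem norm_tprod_one_sub_pow_sub_one_le {q : ℂ} (hq : ‖q‖ < 1 / 2) :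
    ‖∏' n : ℕ, (1 - q ^ (n + 2)) - 1‖ ≤ Real.exp 1 * (2 * ‖q‖ ^ 2) := by
  have hq1 : ‖q‖ < 1 := by linarith
  have hs : Summable fun n : ℕ => ‖q‖ ^ (n + 2) :=
    (summable_nat_add_iff 2).mpr (summable_geometric_of_lt_one (norm_nonneg _) hq1)
  have hsum : ∑' n : ℕ, ‖q‖ ^ (n + 2) ≤ 2 * ‖q‖ ^ 2 := by
    simp only [pow_add, tsum_mul_right]
    rw [tsum_geometric_of_lt_one (norm_nonneg _) hq1]
    gcongr
    rw [inv_le_comm₀ (by linarith) (by norm_num)]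
    linarith
  have hlim : Tendsto (fun s : Finset ℕ => ‖∏ n ∈ s, (1 + -q ^ (n + 2)) - 1‖) atTop
      (𝓝 ‖∏' n : ℕ, (1 - q ^ (n + 2)) - 1‖) := by
    have := (multipliable_one_add_of_summable (f := fun n : ℕ => -q ^ (n + 2))
      (by simpa using hs)).hasProd
    have h2 := (this.sub (tendsto_const_nhds (x := (1 : ℂ)))).norm
    rw [SummationFilter.unconditional_filter] at h2
    simpa only [sub_eq_add_neg] using h2
  refine le_of_tendsto hlim (Eventually.of_forall fun s => ?_)
  refine (Finset.norm_prod_one_add_sub_one_le s _).trans ?_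
  have h1 : ∑ n ∈ s, ‖-q ^ (n + 2)‖ ≤ 2 * ‖q‖ ^ 2 := by
    refine le_trans ?_ hsum
    simp only [norm_neg, norm_pow]
    exact hs.sum_le_tsum s (fun _ _ => by positivity)
  have hx0 : 0 ≤ ∑ n ∈ s, ‖-q ^ (n + 2)‖ := Finset.sum_nonneg fun _ _ => norm_nonneg _
  have h2 : 2 * ‖q‖ ^ 2 ≤ 1 := by nlinarith [norm_nonneg q]
  exact (exp_sub_one_le (h1.trans h2) hx0).trans
    (mul_le_mul_of_nonneg_left h1 (Real.exp_pos 1).le)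

theorem euler_eq {q : ℂ} (hq : ‖q‖ < 1) : euler q = (1 - q) * ∏' n : ℕ, (1 - q ^ (n + 2)) := by
  have h2 : Multipliable fun n : ℕ => 1 - q ^ (n + 1 + 1) := by
    have := multipliable_one_add_of_summable (f := fun n : ℕ => -q ^ (n + 2)) (by
      simpa using (summable_nat_add_iff 2).mpr (summable_geometric_of_lt_one (norm_nonneg q) hq))
    simpa only [sub_eq_add_neg] using this
  have h3 : ∏' n : ℕ, (1 - q ^ (n + 1)) = (1 - q ^ (0 + 1)) * ∏' n : ℕ, (1 - q ^ (n + 1 + 1)) :=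
    tprod_eq_zero_mul' (f := fun n : ℕ => 1 - q ^ (n + 1)) h2
  rw [euler, h3, zero_add, pow_one]

theorem norm_euler_sub_le {q : ℂ} (hq : ‖q‖ < 1 / 2) :
    ‖euler q - (1 - q)‖ ≤ 2 * (Real.exp 1 * (2 * ‖q‖ ^ 2)) := by
  rw [euler_eq (by linarith), show (1 - q) * ∏' n : ℕ, (1 - q ^ (n + 2)) - (1 - q)
    = (1 - q) * (∏' n : ℕ, (1 - q ^ (n + 2)) - 1) by ring, norm_mul]
  refine mul_le_mul ?_ (norm_tprod_one_sub_pow_sub_one_le hq) (norm_nonneg _) (by norm_num)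
  calc ‖1 - q‖ ≤ ‖(1 : ℂ)‖ + ‖q‖ := norm_sub_le _ _
    _ ≤ 2 := by rw [norm_one]; linarith

theorem hasDerivAt_euler_zero : HasDerivAt euler (-1) 0 := by
  rw [hasDerivAt_iff_isLittleO]
  simp only [euler_zero, sub_zero, smul_eq_mul, mul_neg, mul_one]
  have : (fun q : ℂ => euler q - 1 - -q) =O[𝓝 0] fun q => q ^ 2 := by
    refine IsBigO.of_bound (2 * (Real.exp 1 * 2)) ?_
    filter_upwards [Metric.ball_mem_nhds (0 : ℂ) (show (0 : ℝ) < 1 / 2 by norm_num)] with q hq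
    have := norm_euler_sub_le (q := q) (by simpa using hq)
    rw [show euler q - 1 - -q = euler q - (1 - q) by ring, norm_pow]
    linarith
  exact this.trans_isLittleO (by simpa using isLittleO_pow_pow (𝕜 := ℂ) (show 1 < 2 by norm_num))

theorem eta_eq (z : ℂ) : eta z = nome (z / 24) * euler (nome z) := by
  have h : Function.Periodic.qParam 24 z = nome (z / 24) := by
    simp only [Function.Periodic.qParam, nome]; congr 1; push_cast; ring
  rw [eta, h, euler]
  congr 1
  refine tprod_congr fun n => ?_
  rw [eta_q_eq_pow, nome]

theorem eta_ne_zero' {z : ℂ} (hz : 0 < z.im) : eta z ≠ 0 := eta_ne_zero hz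

/-- The function `1 + 24 q Φ'(q) / Φ(q)` with the Euler product `Φ`: the Eisenstein series `E₂` as a
function of the nome. -/
noncomputable def eisTwoQ (q : ℂ) : ℂ := 1 + 24 * (q * (deriv euler q / euler q))

/-- The Eisenstein series `E₂`. -/
noncomputable def eisTwo (z : ℂ) : ℂ := eisTwoQ (nome z)

theorem analyticAt_eisTwoQ {q : ℂ} (hq : ‖q‖ < 1) : AnalyticAt ℂ eisTwoQ q :=
  analyticAt_const.add (analyticAt_const.mul (analyticAt_id.mul
    ((analyticAt_euler hq).deriv.div (analyticAt_euler hq) (euler_ne_zero hq))))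

@[simp] theorem eisTwoQ_zero : eisTwoQ 0 = 1 := by simp [eisTwoQ]

theorem hasDerivAt_eisTwoQ_zero : HasDerivAt eisTwoQ (-24) 0 := by
  have h0 : ‖(0 : ℂ)‖ < 1 := by simp
  have hA : AnalyticAt ℂ (fun q => deriv euler q / euler q) 0 :=
    (analyticAt_euler h0).deriv.div (analyticAt_euler h0) (euler_ne_zero h0)
  have := (((hasDerivAt_id (0 : ℂ)).mul hA.differentiableAt.hasDerivAt).const_mul 24).const_add 1
  have e : eisTwoQ = fun q => 1 + 24 * (id q * (deriv euler q / euler q)) := rfl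
  rw [e]
  convert! this using 1
  simp [hasDerivAt_euler_zero.deriv]

theorem hasDerivAt_eta {z : ℂ} (hz : 0 < z.im) :
    HasDerivAt eta (2 * Real.pi * I / 24 * eisTwo z * eta z) z := by
  have h1 : HasDerivAt (fun z => nome (z / 24)) (2 * Real.pi * I * nome (z / 24) * (1 / 24)) z :=
    HasDerivAt.comp (h₂ := nome) z (hasDerivAt_nome (z / 24)) ((hasDerivAt_id' z).div_const 24)
  have h2 := ((differentiableAt_euler (norm_nome_lt_one hz)).hasDerivAt).comp z (hasDerivAt_nome z)
  have h3 := h1.mul h2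
  have : eta = fun z => nome (z / 24) * euler (nome z) := funext eta_eq
  rw [this]
  convert! h3 using 1
  simp only [eisTwo, eisTwoQ, Function.comp]
  have := euler_ne_zero (norm_nome_lt_one hz)
  field_simp

theorem im_mobius_pos {a b c d : ℤ} (h : a * d - b * c = 1) {z : ℂ} (hz : 0 < z.im) :
    0 < ((a * z + b) / (c * z + d)).im := by
  let γ : Matrix.SpecialLinearGroup (Fin 2) ℤ :=
    ⟨!![a, b; c, d], by rw [Matrix.det_fin_two_of]; exact h⟩
  have := UpperHalfPlane.im_pos (γ • (⟨z, hz⟩ : UpperHalfPlane))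
  rw [← UpperHalfPlane.coe_im, UpperHalfPlane.coe_specialLinearGroup_apply] at this
  simpa [γ] using this

theorem cocycle_ne_zero {a b c d : ℤ} (h : a * d - b * c = 1) {z : ℂ} (hz : 0 < z.im) :
    (c * z + d : ℂ) ≠ 0 := by
  intro h0
  have := im_mobius_pos h hz
  rw [h0] at this
  simp at this

theorem hasDerivAt_mobius {a b c d : ℤ} (h : a * d - b * c = 1) {z : ℂ} (hz : 0 < z.im) :
    HasDerivAt (fun z : ℂ => (a * z + b) / (c * z + d)) (1 / (c * z + d) ^ 2) z := by
  have hj := cocycle_ne_zero h hz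
  have h1 : HasDerivAt (fun z : ℂ => a * z + b) (a : ℂ) z := by
    simpa using ((hasDerivAt_id z).const_mul (a : ℂ)).add_const (b : ℂ)
  have h2 : HasDerivAt (fun z : ℂ => c * z + d) (c : ℂ) z := by
    simpa using ((hasDerivAt_id z).const_mul (c : ℂ)).add_const (d : ℂ)
  convert! h1.div h2 hj using 1
  congr 1
  have : (a * d - b * c : ℂ) = 1 := by exact_mod_cast h
  linear_combination -this

/-- The 24th power of η is the discriminant form. Working with 24th powers throughout makes it
unnecessary to know the multiplier system of η. -/
theorem eta_pow_mobius {a b c d : ℤ} (h : a * d - b * c = 1) {z : ℂ} (hz : 0 < z.im) :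
    eta ((a * z + b) / (c * z + d)) ^ 24 = (c * z + d) ^ 12 * eta z ^ 24 := by
  let γ : Matrix.SpecialLinearGroup (Fin 2) ℤ :=
    ⟨!![a, b; c, d], by rw [Matrix.det_fin_two_of]; exact h⟩
  have h1 := congrFun (SlashInvariantForm.slash_action_generators_SL2Z discriminant_S_invariant
    discriminant_T_invariant γ) (⟨z, hz⟩ : UpperHalfPlane)
  rw [SL_slash_apply, discriminant, discriminant, UpperHalfPlane.coe_specialLinearGroup_apply] at h1
  have hj := cocycle_ne_zero h hz
  rw [ModularGroup.denom_apply] at h1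
  simp [γ] at h1
  have hj12 := pow_ne_zero 12 hj
  exact ((mul_inv_eq_iff_eq_mul₀ hj12).mp h1).trans (mul_comm _ _)

/-- Logarithmic differentiation of the transformation law of η²⁴; the anomalous term comes from
differentiating (cz + d)¹². -/
theorem eisTwo_mobius {a b c d : ℤ} (h : a * d - b * c = 1) {z : ℂ} (hz : 0 < z.im) :
    eisTwo ((a * z + b) / (c * z + d))
      = (c * z + d) ^ 2 * eisTwo z + 12 / (2 * Real.pi * I) * c * (c * z + d) := by
  have hj := cocycle_ne_zero h hz
  have hM := im_mobius_pos h hz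
  have h1 := ((hasDerivAt_eta hM).comp z (hasDerivAt_mobius h hz)).pow 24
  have hl : HasDerivAt (fun z : ℂ => c * z + d) (c : ℂ) z := by
    simpa using ((hasDerivAt_id z).const_mul (c : ℂ)).add_const (d : ℂ)
  have h2 := (hl.pow 12).mul ((hasDerivAt_eta hz).pow 24)
  have heq : (fun z : ℂ => eta ((a * z + b) / (c * z + d)) ^ 24)
      =ᶠ[𝓝 z] fun z => (c * z + d) ^ 12 * eta z ^ 24 := by
    filter_upwards [(isOpen_lt continuous_const continuous_im).mem_nhds hz] with w hw
    exact eta_pow_mobius h hw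
  have h3 := h1.unique (h2.congr_of_eventuallyEq heq)
  have h4 := eta_pow_mobius h hz
  have e0 := eta_ne_zero' hz
  have e1 := eta_ne_zero' hM
  simp only [Function.comp, Pi.pow_apply] at h3
  set w := (a * z + b) / (c * z + d) with hw
  have hpi : (Real.pi : ℂ) ≠ 0 := by exact_mod_cast Real.pi_ne_zero
  have h5 : eta w ^ 24 * (2 * Real.pi * I * eisTwo w * (1 / (c * z + d) ^ 2))
      = eta w ^ 24 * (12 * c / (c * z + d) + 2 * Real.pi * I * eisTwo z) := by
    have l : eta w ^ 24 * (2 * Real.pi * I * eisTwo w * (1 / (c * z + d) ^ 2))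
      = (24 : ℕ) * eta w ^ (24 - 1) * (2 * Real.pi * I / 24 * eisTwo w * eta w * (1 / (c * z + d) ^ 2)) := by
      norm_num; ring
    rw [l, h3, h4]
    norm_num
    field_simp
  have h6 := mul_left_cancel₀ (pow_ne_zero 24 e1) h5
  field_simp at h6 ⊢
  linear_combination h6

/-! ### Rescaled transformations and the Liouville principle -/

/-- The factorisation diag(k, 1) · (a b; c d) = (a' b'; c' d') · (α β; 0 δ) with the left factor on
the right-hand side in SL₂(ℤ). It reduces η(kτ) at an arbitrary cusp to η at an affine argument. -/
theorem exists_triangular (k : ℕ) (hk : 0 < k) {a b c d : ℤ} (h : a * d - b * c = 1) :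
    ∃ α δ β a' b' c' d' : ℤ, 0 < α ∧ 0 < δ ∧ α * δ = k ∧ α = Int.gcd k c ∧
      a' * d' - b' * c' = 1 ∧ a' * α = k * a ∧ a' * β + b' * δ = k * b ∧ c' * α = c ∧
      c' * β + d' * δ = d := by
  obtain ⟨δ, hδ⟩ : (Int.gcd k c : ℤ) ∣ k := Int.gcd_dvd_left ..
  obtain ⟨c', hc'⟩ : (Int.gcd k c : ℤ) ∣ c := Int.gcd_dvd_right ..
  have hα : 0 < (Int.gcd k c : ℤ) := by
    have := Int.gcd_pos_of_ne_zero_left c (show (k : ℤ) ≠ 0 by exact_mod_cast hk.ne')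
    exact_mod_cast this
  set α : ℤ := ((Int.gcd k c : ℕ) : ℤ) with hαdef
  have hδpos : 0 < δ := by
    have : 0 < α * δ := by rw [← hδ]; exact_mod_cast hk
    exact pos_of_mul_pos_right this hα.le
  have hcop : IsCoprime c' δ := by
    rw [Int.isCoprime_iff_gcd_eq_one]
    have := Int.gcd_div_gcd_div_gcd (i := (k : ℤ)) (j := c)
      (Int.gcd_pos_of_ne_zero_left c (by exact_mod_cast hk.ne'))
    have h1 : (k : ℤ) / ((Int.gcd k c : ℕ) : ℤ) = δ := Int.ediv_eq_of_eq_mul_right hα.ne' hδ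
    have h2 : c / ((Int.gcd k c : ℕ) : ℤ) = c' := Int.ediv_eq_of_eq_mul_right hα.ne' hc'
    rw [h1, h2] at this
    rwa [Int.gcd_comm]
  obtain ⟨u, v, huv⟩ := hcop
  -- With u c' + v δ = 1, the last row equation c'β + d'δ = d is solved by β = du and d' = dv; the
  -- first row is then forced by k = αδ.
  refine ⟨α, δ, d * u, δ * a, α * b - a * (d * u), c', d * v, hα, hδpos, hδ.symm, rfl, ?_, ?_, ?_,
    ?_, ?_⟩
  · have h0 : c = α * c' := hc'
    linear_combination a * d * huv + h + b * h0
  · linear_combination -a * hδ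
  · linear_combination -b * hδ
  · rw [mul_comm]; exact hc'.symm
  · linear_combination d * huv

/-- The exponent `gcd(k, c)² / k` that governs `η(kτ)` at a cusp with denominator `c`. -/
noncomputable def cuspScale (k : ℕ) (c : ℤ) : ℝ := (Int.gcd k c : ℝ) ^ 2 / k

/-- Apply the level one laws to the matrix (a' b'; c' d') at the point (αz + β)/δ. The scale is α/δ
= gcd(k, c)²/k. The integrality of Bδ is recorded because for 6 ∣ c it makes B an integer, hence
invisible to the nome. -/
theorem exists_scaled_transform (k : ℕ) (hk : 0 < k) {a b c d : ℤ} (h : a * d - b * c = 1) :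
    ∃ B : ℝ, ∃ δ : ℝ, 0 < δ ∧ (∃ m : ℤ, B * δ = m) ∧ δ * Int.gcd k c = k ∧
      ∀ z : ℂ, 0 < z.im →
        eta (k * ((a * z + b) / (c * z + d))) ^ 24
          = ((c * z + d) / δ) ^ 12 * eta (cuspScale k c * z + B) ^ 24 ∧
        k * eisTwo (k * ((a * z + b) / (c * z + d)))
          = (c * z + d) ^ 2 * (cuspScale k c * eisTwo (cuspScale k c * z + B))
            + 12 / (2 * Real.pi * I) * c * (c * z + d) := by
  obtain ⟨α, δ, β, a', b', c', d', hα, hδ, hαδ, hαg, hdet, h1, h2, h3, h4⟩ :=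
    exists_triangular k hk h
  have hδ0 : (δ : ℂ) ≠ 0 := by exact_mod_cast hδ.ne'
  have hδ0r : (δ : ℝ) ≠ 0 := by exact_mod_cast hδ.ne'
  have hα0r : (α : ℝ) ≠ 0 := by exact_mod_cast hα.ne'
  have hkr : ((α : ℝ) * δ) = k := by exact_mod_cast hαδ
  have hkc : ((α : ℂ) * δ) = k := by exact_mod_cast hαδ
  have hg : ((Int.gcd k c : ℕ) : ℝ) = α := by rw [hαg]; simp
  have hs : cuspScale k c = α / δ := by
    rw [cuspScale, hg, ← hkr]; field_simp
  refine ⟨β / δ, δ, by exact_mod_cast hδ, ⟨β, by field_simp⟩, by rw [hg, ← hkr]; ring,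
    fun z hz => ?_⟩
  have hj := cocycle_ne_zero h hz
  have hw : 0 < ((cuspScale k c : ℂ) * z + ((β / δ : ℝ) : ℂ)).im := by
    rw [im_affine, hs]
    have : (0 : ℝ) < α := by exact_mod_cast hα
    have : (0 : ℝ) < δ := by exact_mod_cast hδ
    positivity
  set w : ℂ := (cuspScale k c : ℂ) * z + ((β / δ : ℝ) : ℂ) with hwdef
  have hw' : w * δ = α * z + β := by
    rw [hwdef, hs]; push_cast; field_simp
  have c1 : (a' * α : ℂ) = k * a := by exact_mod_cast h1
  have c2 : (a' * β + b' * δ : ℂ) = k * b := by exact_mod_cast h2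
  have c3 : (c' * α : ℂ) = c := by exact_mod_cast h3
  have c4 : (c' * β + d' * δ : ℂ) = d := by exact_mod_cast h4
  have hden : (c' * w + d' : ℂ) = (c * z + d) / δ := by
    rw [eq_div_iff hδ0]
    linear_combination c' * hw' + z * c3 + c4
  have hnum : (a' * w + b' : ℂ) = k * (a * z + b) / δ := by
    rw [eq_div_iff hδ0]
    linear_combination a' * hw' + z * c1 + c2
  have hmob : (k : ℂ) * ((a * z + b) / (c * z + d)) = (a' * w + b') / (c' * w + d') := by
    rw [hden, hnum]; field_simp
  have hdet' : a' * d' - b' * c' = 1 := hdet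
  rw [hmob]
  constructor
  · rw [eta_pow_mobius hdet' hw, hden]; simp
  · rw [eisTwo_mobius hdet' hw, hden, hs, ← hkc, ← c3]
    push_cast
    field_simp

theorem cuspScale_pos {k : ℕ} (hk : 0 < k) (c : ℤ) : 0 < cuspScale k c := by
  have h := Int.gcd_pos_of_ne_zero_left c (show (k : ℤ) ≠ 0 by exact_mod_cast hk.ne')
  rw [cuspScale]
  have : (0 : ℝ) < Int.gcd k c := by exact_mod_cast h
  have : (0 : ℝ) < k := by exact_mod_cast hk
  positivity

/-- A holomorphic function on the upper half plane that is invariant under `Γ(6)` and bounded at all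
cusps is constant. -/
theorem liouville {F : ℂ → ℂ} (hF : DifferentiableOn ℂ F {z | 0 < z.im})
    (hinv : ∀ a b c d : ℤ, a * d - b * c = 1 → (6 : ℤ) ∣ c → (6 : ℤ) ∣ b → ∀ z : ℂ, 0 < z.im →
      F ((a * z + b) / (c * z + d)) = F z)
    (hbd : ∀ a b c d : ℤ, a * d - b * c = 1 →
      (fun z : ℂ => F ((a * z + b) / (c * z + d))) =O[cuspInf] (1 : ℂ → ℝ)) :
    ∃ C, ∀ z : ℂ, 0 < z.im → F z = C := by
  have hact : ∀ (γ : Matrix.SpecialLinearGroup (Fin 2) ℤ) (τ : UpperHalfPlane),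
      ((γ • τ : UpperHalfPlane) : ℂ) = (γ 0 0 * τ + γ 0 1) / (γ 1 0 * τ + γ 1 1) := by
    intro γ τ
    rw [UpperHalfPlane.coe_specialLinearGroup_apply]
    simp
  have hdet : ∀ γ : Matrix.SpecialLinearGroup (Fin 2) ℤ, γ 0 0 * γ 1 1 - γ 0 1 * γ 1 0 = 1 := by
    intro γ
    have := γ.det_coe
    rwa [Matrix.det_fin_two] at this
  -- Packaged as a modular form of weight zero on Γ(6), F is constant by the general theorem for
  -- arithmetic groups.
  let f : ModularForm (Subgroup.map (Matrix.SpecialLinearGroup.mapGL ℝ)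
      (CongruenceSubgroup.Gamma 6)) 0 :=
    { toFun := fun τ => F τ
      slash_action_eq' := by
        rintro _ ⟨γ, hγ, rfl⟩
        change ((fun τ : UpperHalfPlane => F τ) ∣[(0 : ℤ)] γ) = _
        ext τ
        rw [SL_slash_apply, hact]
        have h6 := CongruenceSubgroup.Gamma_mem.mp hγ
        have h1 : (6 : ℤ) ∣ γ 1 0 := (ZMod.intCast_zmod_eq_zero_iff_dvd _ 6).mp h6.2.2.1
        have h2 : (6 : ℤ) ∣ γ 0 1 := (ZMod.intCast_zmod_eq_zero_iff_dvd _ 6).mp h6.2.1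
        rw [hinv _ _ _ _ (hdet γ) h1 h2 τ τ.im_pos]
        simp
      holo' := by
        rw [UpperHalfPlane.mdifferentiable_iff]
        refine hF.congr fun z hz => ?_
        simp [UpperHalfPlane.ofComplex_apply_of_im_pos hz]
      bdd_at_cusps' := by
        intro c hc
        rw [Subgroup.IsArithmetic.isCusp_iff_isCusp_SL2Z] at hc
        rw [OnePoint.isBoundedAt_iff_forall_SL2Z hc]
        intro γ _
        have := hbd _ _ _ _ (hdet γ)
        have h2 : Tendsto (fun τ : UpperHalfPlane => (τ : ℂ)) UpperHalfPlane.atImInfty cuspInf := by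
          rw [cuspInf, tendsto_comap_iff]
          exact tendsto_comap
        have h3 := this.comp_tendsto h2
        rw [UpperHalfPlane.IsBoundedAtImInfty, BoundedAtFilter]
        refine h3.congr_left fun τ => ?_
        rw [SL_slash_apply, hact]
        simp }
  obtain ⟨C, hC⟩ := ModularForm.eq_const_of_weight_zero f
  refine ⟨C, fun z hz => ?_⟩
  exact congrFun hC ⟨z, hz⟩

/-! ### Eta quotients of level 6 -/

/-- The divisors of `6`. -/
def levels : Finset ℕ := {1, 2, 3, 6}

theorem levels_pos {k : ℕ} (hk : k ∈ levels) : 0 < k := by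
  simp only [levels, Finset.mem_insert, Finset.mem_singleton] at hk
  omega

theorem sum_levels {M : Type*} [AddCommMonoid M] (f : ℕ → M) :
    ∑ k ∈ levels, f k = f 1 + (f 2 + (f 3 + f 6)) := by
  simp [levels]

theorem forall_levels {p : ℕ → Prop} : (∀ k ∈ levels, p k) ↔ p 1 ∧ p 2 ∧ p 3 ∧ p 6 := by
  simp [levels]

theorem prod_levels {M : Type*} [CommMonoid M] (f : ℕ → M) :
    ∏ k ∈ levels, f k = f 1 * (f 2 * (f 3 * f 6)) := by
  simp [levels]

/-- The eta quotient `∏ η(kτ)^(n k)` over the divisors `k` of `6`. -/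
noncomputable def etaQuot (n : ℕ → ℤ) (z : ℂ) : ℂ := ∏ k ∈ levels, eta (k * z) ^ n k

/-- The logarithmic derivative of `etaQuot n` with respect to `2πiτ`. -/
noncomputable def logDer (n : ℕ → ℤ) (z : ℂ) : ℂ :=
  1 / 24 * ∑ k ∈ levels, n k * (k * eisTwo (k * z))

/-- The function that describes `logDer n` at a cusp. -/
noncomputable def logDerAt (n : ℕ → ℤ) (s B : ℕ → ℝ) (z : ℂ) : ℂ :=
  1 / 24 * ∑ k ∈ levels, n k * (s k * eisTwo (s k * z + B k))

theorem im_natCast_mul {k : ℕ} (hk : 0 < k) {z : ℂ} (hz : 0 < z.im) : 0 < ((k : ℂ) * z).im := by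
  have : (0 : ℝ) < k := by exact_mod_cast hk
  simpa using mul_pos this hz

theorem etaQuot_ne_zero (n : ℕ → ℤ) {z : ℂ} (hz : 0 < z.im) : etaQuot n z ≠ 0 :=
  Finset.prod_ne_zero_iff.mpr fun _ hk =>
    zpow_ne_zero _ (eta_ne_zero' (im_natCast_mul (levels_pos hk) hz))

theorem etaQuot_add (m n : ℕ → ℤ) {z : ℂ} (hz : 0 < z.im) :
    etaQuot (m + n) z = etaQuot m z * etaQuot n z := by
  rw [etaQuot, etaQuot, etaQuot, ← Finset.prod_mul_distrib]
  exact Finset.prod_congr rfl fun k hk =>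
    zpow_add₀ (eta_ne_zero' (im_natCast_mul (levels_pos hk) hz)) _ _

theorem etaQuot_sub (m n : ℕ → ℤ) {z : ℂ} (hz : 0 < z.im) :
    etaQuot (m - n) z = etaQuot m z / etaQuot n z := by
  rw [eq_div_iff (etaQuot_ne_zero n hz), ← etaQuot_add _ _ hz, sub_add_cancel]

theorem logDer_sub (m n : ℕ → ℤ) (z : ℂ) : logDer (m - n) z = logDer m z - logDer n z := by
  simp only [logDer, Pi.sub_apply, Int.cast_sub, sub_mul, Finset.sum_sub_distrib, mul_sub]

theorem hasDerivAt_etaQuot (n : ℕ → ℤ) {z : ℂ} (hz : 0 < z.im) :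
    HasDerivAt (etaQuot n) (2 * Real.pi * I * logDer n z * etaQuot n z) z := by
  have h : ∀ k ∈ levels, HasDerivAt (fun z : ℂ => eta (k * z) ^ n k)
      (2 * Real.pi * I / 24 * (n k * (k * eisTwo (k * z))) * eta (k * z) ^ n k) z := by
    intro k hk
    have hz' := im_natCast_mul (levels_pos hk) hz
    have h1 : HasDerivAt (fun z : ℂ => eta (k * z)) _ z :=
      (hasDerivAt_eta hz').comp z ((hasDerivAt_id' z).const_mul (k : ℂ))
    have h2 := (hasDerivAt_zpow (n k) (eta (k * z)) (Or.inl (eta_ne_zero' hz'))).comp z h1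
    refine h2.congr_deriv ?_
    rw [zpow_sub_one₀ (eta_ne_zero' hz')]
    have := eta_ne_zero' hz'
    field_simp
  have h3 := HasDerivAt.fun_finsetProd (u := levels) h
  refine h3.congr_deriv ?_
  have h4 : ∀ k ∈ levels, (∏ j ∈ levels.erase k, eta (j * z) ^ n j) •
      (2 * Real.pi * I / 24 * (n k * (k * eisTwo (k * z))) * eta (k * z) ^ n k)
      = 2 * Real.pi * I / 24 * (n k * (k * eisTwo (k * z))) * etaQuot n z := by
    intro k hk
    rw [etaQuot, ← Finset.prod_erase_mul levels _ hk, smul_eq_mul]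
    ring
  rw [Finset.sum_congr rfl h4, ← Finset.sum_mul, ← Finset.mul_sum, logDer]
  ring

theorem zpow_sum₀' {ι : Type*} {x : ℂ} (hx : x ≠ 0) (t : Finset ι) (n : ι → ℤ) :
    x ^ ∑ k ∈ t, n k = ∏ k ∈ t, x ^ n k := by
  classical
  induction t using Finset.induction_on with
  | empty => simp
  | insert i t hi ih => rw [Finset.sum_insert hi, Finset.prod_insert hi, zpow_add₀ hx, ih]

/-- The table of the scaling factors at the four cusps. -/
theorem cuspScale_table (c : ℤ) :
    (cuspScale 1 c = 1 ∧ cuspScale 2 c = 1 / 2 ∧ cuspScale 3 c = 1 / 3 ∧ cuspScale 6 c = 1 / 6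
      ∧ Int.gcd 6 c = 1) ∨
    (cuspScale 1 c = 1 ∧ cuspScale 2 c = 2 ∧ cuspScale 3 c = 1 / 3 ∧ cuspScale 6 c = 2 / 3
      ∧ Int.gcd 6 c = 2) ∨
    (cuspScale 1 c = 1 ∧ cuspScale 2 c = 1 / 2 ∧ cuspScale 3 c = 3 ∧ cuspScale 6 c = 3 / 2
      ∧ Int.gcd 6 c = 3) ∨
    (cuspScale 1 c = 1 ∧ cuspScale 2 c = 2 ∧ cuspScale 3 c = 3 ∧ cuspScale 6 c = 6
      ∧ Int.gcd 6 c = 6) := by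
  have h6 : ∀ k : ℕ, k ∣ 6 → Int.gcd k c = Nat.gcd k (Nat.gcd 6 c.natAbs) := by
    intro k hk
    rw [Int.gcd, Int.natAbs_natCast, ← Nat.gcd_assoc, Nat.gcd_eq_left hk]
  have hg : Nat.gcd 6 c.natAbs ∣ 6 := Nat.gcd_dvd_left _ _
  have hgle := Nat.le_of_dvd (by norm_num) hg
  have e1 := h6 1 (by norm_num)
  have e2 := h6 2 (by norm_num)
  have e3 := h6 3 (by norm_num)
  have e6 := h6 6 (by norm_num)
  have e6' : Int.gcd 6 c = Int.gcd (6 : ℕ) c := rfl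
  simp only [cuspScale, e1, e2, e3, e6, e6']
  -- For k dividing 6, gcd(k, c) depends only on g = gcd(6, c), so the four divisors of 6 exhaust
  -- all cusps.
  generalize Nat.gcd 6 c.natAbs = g at *
  interval_cases g <;> first | omega | norm_num

/-- Simultaneous transformation of all eta quotients and their logarithmic derivatives. -/
theorem exists_etaQuot_transform {a b c d : ℤ} (h : a * d - b * c = 1) :
    ∃ B δ : ℕ → ℝ, (∀ k ∈ levels, 0 < δ k) ∧
      ((6 : ℤ) ∣ c → ∀ k ∈ levels, cuspScale k c = k ∧ δ k = 1 ∧ ∃ m : ℤ, B k = m) ∧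
      ∀ z : ℂ, 0 < z.im → ∀ n : ℕ → ℤ,
        etaQuot n ((a * z + b) / (c * z + d)) ^ 24
          = (c * z + d) ^ (12 * ∑ k ∈ levels, n k) *
            ∏ k ∈ levels, ((δ k : ℂ) ^ (12 * n k))⁻¹ * (eta (cuspScale k c * z + B k) ^ 24) ^ n k ∧
        logDer n ((a * z + b) / (c * z + d))
          = (c * z + d) ^ 2 * logDerAt n (fun k => cuspScale k c) B z
            + (∑ k ∈ levels, n k : ℤ) / 2 * (1 / (2 * Real.pi * I)) * c * (c * z + d) := by
  have H := fun k hk => exists_scaled_transform k (levels_pos hk) h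
  choose! B δ hδ hB hgcd hT using H
  refine ⟨B, δ, hδ, ?_, ?_⟩
  · intro h6 k hk
    have hkd : k ∣ 6 := by
      simp only [levels, Finset.mem_insert, Finset.mem_singleton] at hk
      rcases hk with rfl | rfl | rfl | rfl <;> norm_num
    have hkc : (k : ℤ) ∣ c := dvd_trans (by exact_mod_cast hkd) h6
    have hg : Int.gcd k c = k := by exact_mod_cast Int.gcd_eq_left (by positivity) hkc
    have hk0 : (k : ℝ) ≠ 0 := by exact_mod_cast (levels_pos hk).ne'
    have hδ1 : δ k = 1 := by
      have := hgcd k hk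
      rw [hg] at this
      exact mul_right_cancel₀ hk0 (by rw [this, one_mul])
    refine ⟨by rw [cuspScale, hg]; field_simp, hδ1, ?_⟩
    obtain ⟨m, hm⟩ := hB k hk
    exact ⟨m, by rw [← hm, hδ1, mul_one]⟩
  · intro z hz n
    have hj := cocycle_ne_zero h hz
    constructor
    · rw [etaQuot, ← Finset.prod_pow, Finset.mul_sum, zpow_sum₀' hj,
        ← Finset.prod_mul_distrib]
      refine Finset.prod_congr rfl fun k hk => ?_
      rw [← zpow_natCast, ← zpow_mul, mul_comm (n k), zpow_mul, zpow_natCast, (hT k hk z hz).1,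
        mul_zpow, ← zpow_natCast (_ / _) 12, ← zpow_mul, div_zpow]
      push_cast
      ring
    · have : ∀ k ∈ levels, (n k : ℂ) * (k * eisTwo (k * ((a * z + b) / (c * z + d))))
          = (c * z + d) ^ 2 * (n k * (cuspScale k c * eisTwo (cuspScale k c * z + B k)))
            + n k * (12 / (2 * Real.pi * I) * c * (c * z + d)) := by
        intro k hk
        rw [(hT k hk z hz).2]
        ring
      rw [logDer, Finset.sum_congr rfl this, Finset.sum_add_distrib, ← Finset.mul_sum,
        ← Finset.sum_mul, logDerAt]
      push_cast
      ring

/-! ### Growth at the cusps -/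

/-- The comparison function `exp(-2πν Im z)`. -/
noncomputable def decay (ν : ℝ) (z : ℂ) : ℝ := Real.exp (-2 * Real.pi * ν * z.im)

theorem decay_pos (ν : ℝ) (z : ℂ) : 0 < decay ν z := Real.exp_pos _

theorem decay_isBigO {ν μ : ℝ} (h : ν ≤ μ) : decay μ =O[cuspInf] decay ν := by
  refine IsBigO.of_bound 1 ?_
  filter_upwards [eventually_cuspInf 0] with z hz
  rw [one_mul, Real.norm_of_nonneg (decay_pos _ _).le, Real.norm_of_nonneg (decay_pos _ _).le,
    decay, decay, Real.exp_le_exp]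
  have := mul_nonneg (mul_nonneg Real.pi_pos.le (sub_nonneg.mpr h)) hz
  linarith

theorem decay_zero : decay 0 = fun _ => 1 := by
  funext z; simp [decay]

theorem decay_isBigO_one {μ : ℝ} (h : 0 ≤ μ) : decay μ =O[cuspInf] fun _ : ℂ => (1 : ℝ) := by
  rw [← decay_zero]; exact decay_isBigO h

theorem tendsto_decay {μ : ℝ} (h : 0 < μ) : Tendsto (decay μ) cuspInf (𝓝 0) := by
  refine Real.tendsto_exp_atBot.comp ?_
  refine Tendsto.const_mul_atTop_of_neg ?_ tendsto_im_cuspInf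
  have := mul_pos Real.pi_pos h
  linarith

theorem norm_nome_affine (s t : ℝ) (z : ℂ) : ‖nome (s * z + t)‖ = decay s z := by
  rw [norm_nome, im_affine, decay]; ring_nf

theorem tendsto_nome_affine {s : ℝ} (hs : 0 < s) (t : ℝ) :
    Tendsto (fun z : ℂ => nome (s * z + t)) cuspInf (𝓝 0) :=
  tendsto_nome.comp (tendsto_affine_cuspInf hs t)

/-- A function that is differentiable at the origin, evaluated at the nome of `s z + t`. -/
theorem comp_nome_affine_isBigO {f : ℂ → ℂ} (hf : DifferentiableAt ℂ f 0) {s : ℝ} (hs : 0 < s)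
    (t : ℝ) : (fun z : ℂ => f (nome (s * z + t)) - f 0) =O[cuspInf] decay s := by
  have h := hf.isBigO_sub.comp_tendsto (tendsto_nome_affine hs t)
  refine h.trans (IsBigO.of_bound 1 (Eventually.of_forall fun z => ?_))
  simp [norm_nome_affine, abs_of_pos (decay_pos s z)]

theorem eisTwo_affine_isBigO {s : ℝ} (hs : 0 < s) (t : ℝ) :
    (fun z : ℂ => eisTwo (s * z + t) - 1) =O[cuspInf] decay s := by
  have := comp_nome_affine_isBigO (analyticAt_eisTwoQ (q := 0) (by simp)).differentiableAt hs t
  rw [eisTwoQ_zero] at this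
  exact this

/-- The subtracted constant is the order of the eta quotient at the cusp; the remainder is small
because E₂ = 1 + O(q). -/
theorem logDerAt_sub_isBigO {n : ℕ → ℤ} {s : ℕ → ℝ} (B : ℕ → ℝ) {ν : ℝ}
    (hs : ∀ k ∈ levels, 0 < s k) (hν : ∀ k ∈ levels, ν ≤ s k) :
    (fun z => logDerAt n s B z - (1 / 24 * ∑ k ∈ levels, n k * s k : ℝ)) =O[cuspInf] decay ν := by
  have h : (fun z => 1 / 24 * ∑ k ∈ levels, (n k : ℂ) * (s k * (eisTwo (s k * z + B k) - 1)))
      =O[cuspInf] decay ν := by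
    refine IsBigO.const_mul_left (IsBigO.fun_sum fun k hk => ?_) _
    exact (((eisTwo_affine_isBigO (hs k hk) (B k)).trans (decay_isBigO (hν k hk))).const_mul_left
      _).const_mul_left _
  refine h.congr_left fun z => ?_
  rw [logDerAt]
  push_cast
  rw [← mul_sub, ← Finset.sum_sub_distrib]
  congr 1
  refine Finset.sum_congr rfl fun k _ => ?_
  ring

theorem hasDerivAt_eisTwo {z : ℂ} (hz : 0 < z.im) :
    HasDerivAt eisTwo (2 * Real.pi * I * (nome z * deriv eisTwoQ (nome z))) z := by
  have h := ((analyticAt_eisTwoQ (norm_nome_lt_one hz)).differentiableAt.hasDerivAt).comp z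
    (hasDerivAt_nome z)
  refine h.congr_deriv ?_
  ring

/-- The derivative of `logDerAt` with respect to `2πiτ`. -/
noncomputable def logDerAt' (n : ℕ → ℤ) (s B : ℕ → ℝ) (z : ℂ) : ℂ :=
  1 / 24 * ∑ k ∈ levels, n k * (s k * (s k *
    (nome (s k * z + B k) * deriv eisTwoQ (nome (s k * z + B k)))))

theorem hasDerivAt_logDerAt (n : ℕ → ℤ) {s : ℕ → ℝ} (B : ℕ → ℝ) (hs : ∀ k ∈ levels, 0 < s k)
    {z : ℂ} (hz : 0 < z.im) :
    HasDerivAt (logDerAt n s B) (2 * Real.pi * I * logDerAt' n s B z) z := by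
  have h : ∀ k ∈ levels, HasDerivAt (fun z : ℂ => n k * (s k * eisTwo (s k * z + B k)))
      (2 * Real.pi * I * (n k * (s k * (s k *
        (nome (s k * z + B k) * deriv eisTwoQ (nome (s k * z + B k))))))) z := by
    intro k hk
    have hz' : 0 < ((s k : ℂ) * z + B k).im := by rw [im_affine]; exact mul_pos (hs k hk) hz
    have h1 : HasDerivAt (fun z : ℂ => (s k : ℂ) * z + B k) (s k) z := by
      simpa using ((hasDerivAt_id z).const_mul (s k : ℂ)).add_const (B k : ℂ)
    have h2 : HasDerivAt (fun z : ℂ => eisTwo (s k * z + B k)) _ z :=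
      HasDerivAt.comp (h₂ := eisTwo) z (hasDerivAt_eisTwo hz') h1
    refine ((h2.const_mul (s k : ℂ)).const_mul (n k : ℂ)).congr_deriv ?_
    ring
  refine ((HasDerivAt.fun_sum h).const_mul (1 / 24 : ℂ)).congr_deriv ?_
  rw [logDerAt', ← Finset.mul_sum]
  ring

theorem logDerAt'_isBigO (n : ℕ → ℤ) {s : ℕ → ℝ} (B : ℕ → ℝ) {ν : ℝ}
    (hs : ∀ k ∈ levels, 0 < s k) (hν : ∀ k ∈ levels, ν ≤ s k) :
    logDerAt' n s B =O[cuspInf] decay ν := by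
  refine IsBigO.const_mul_left (IsBigO.fun_sum fun k hk => ?_) _
  refine (IsBigO.const_mul_left (IsBigO.const_mul_left ?_ _) _).const_mul_left _
  have hd : DifferentiableAt ℂ (fun q => q * deriv eisTwoQ q) 0 :=
    differentiableAt_id.mul (analyticAt_eisTwoQ (by simp)).deriv.differentiableAt
  have := comp_nome_affine_isBigO hd (hs k hk) (B k)
  simp only [zero_mul, sub_zero] at this
  exact this.trans (decay_isBigO (hν k hk))

theorem logDerAt_eq_logDer {n : ℕ → ℤ} {s B : ℕ → ℝ} (hs : ∀ k ∈ levels, s k = k)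
    (hB : ∀ k ∈ levels, ∃ m : ℤ, B k = m) : logDerAt n s B = logDer n := by
  funext z
  rw [logDer, logDerAt]
  congr 1
  refine Finset.sum_congr rfl fun k hk => ?_
  obtain ⟨m, hm⟩ := hB k hk
  rw [hs k hk, hm, eisTwo, eisTwo, nome_add]
  simp [nome_int]

theorem eta_pow_eq (z : ℂ) : eta z ^ 24 = nome z * euler (nome z) ^ 24 := by
  rw [eta_eq, mul_pow, ← nome_nat_mul]
  congr 2
  push_cast
  ring

/-- The growth of an eta quotient at a cusp. -/
theorem decay_isBigO_etaQuot {n : ℕ → ℤ} {s B δ : ℕ → ℝ} (hs : ∀ k ∈ levels, 0 < s k)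
    (hδ : ∀ k ∈ levels, 0 < δ k) :
    decay (∑ k ∈ levels, n k * s k) =O[cuspInf] fun z : ℂ =>
      ∏ k ∈ levels, ((δ k : ℂ) ^ (12 * n k))⁻¹ * (eta (s k * z + B k) ^ 24) ^ n k := by
  have h0 : (fun z => ∏ k ∈ levels, decay (n k * s k) z) =O[cuspInf] fun z : ℂ =>
      ∏ k ∈ levels, ((δ k : ℂ) ^ (12 * n k))⁻¹ * (eta (s k * z + B k) ^ 24) ^ n k := by
    refine IsBigO.finsetProd fun k hk => ?_
    have hlim : Tendsto (fun z : ℂ => ‖((δ k : ℂ) ^ (12 * n k))⁻¹ *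
        (euler (nome (s k * z + B k)) ^ 24) ^ n k‖) cuspInf
        (𝓝 ‖((δ k : ℂ) ^ (12 * n k))⁻¹‖) := by
      have h1 : Tendsto (fun z : ℂ => euler (nome (s k * z + B k))) cuspInf (𝓝 1) := by
        have := (analyticAt_euler (q := 0) (by simp)).continuousAt.tendsto.comp
          (tendsto_nome_affine (hs k hk) (B k))
        simpa [Function.comp_def] using this
      have h2 := (((h1.pow 24).zpow₀ (n k) (Or.inl (by simp))).const_mul
        ((δ k : ℂ) ^ (12 * n k))⁻¹).norm
      simpa using h2
    have hpos : 0 < ‖((δ k : ℂ) ^ (12 * n k))⁻¹‖ := by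
      rw [norm_pos_iff]
      exact inv_ne_zero (zpow_ne_zero _ (by exact_mod_cast (hδ k hk).ne'))
    set m := ‖((δ k : ℂ) ^ (12 * n k))⁻¹‖
    -- The unit part of the factor tends to a number of absolute value m > 0, so eventually it
    -- exceeds m / 2.
    refine IsBigO.of_bound (2 / m) ?_
    filter_upwards [hlim.eventually (lt_mem_nhds (half_lt_self hpos))] with z hz
    rw [eta_pow_eq, mul_zpow, mul_left_comm, norm_mul (nome _ ^ n k), norm_zpow, norm_nome_affine,
      Real.norm_of_nonneg (decay_pos _ _).le]
    have : decay (n k * s k) z = decay (s k) z ^ n k := by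
      rw [decay, decay, ← Real.rpow_intCast, ← Real.exp_mul]; ring_nf
    rw [this]
    have h3 : 0 < decay (s k) z ^ n k := zpow_pos (decay_pos _ _) _
    calc decay (s k) z ^ n k = 2 / m * (decay (s k) z ^ n k * (m / 2)) := by field_simp
      _ ≤ _ := by gcongr
  refine h0.congr_left fun z => ?_
  rw [decay, Finset.mul_sum, Finset.sum_mul, Real.exp_sum]
  rfl

/-! ### Modular forms that are proportional to an eta quotient -/

theorem isOpen_upper : IsOpen {z : ℂ | 0 < z.im} := isOpen_lt continuous_const continuous_im

theorem upper_mem_nhds {z : ℂ} (hz : 0 < z.im) : {z : ℂ | 0 < z.im} ∈ 𝓝 z :=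
  isOpen_upper.mem_nhds hz

theorem convex_upper : Convex ℝ {z : ℂ | 0 < z.im} := convex_halfSpace_im_gt 0

theorem differentiableOn_etaQuot (n : ℕ → ℤ) : DifferentiableOn ℂ (etaQuot n) {z | 0 < z.im} :=
  fun _ hz => (hasDerivAt_etaQuot n hz).differentiableAt.differentiableWithinAt

theorem exists_eq_of_hasDerivAt_zero {f : ℂ → ℂ} (h : ∀ z : ℂ, 0 < z.im → HasDerivAt f 0 z) :
    ∃ C, ∀ z : ℂ, 0 < z.im → f z = C :=
  ⟨f I, fun z hz => isOpen_upper.is_const_of_deriv_eq_zero convex_upper.isPreconnected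
    (fun w hw => (h w hw).differentiableAt.differentiableWithinAt) (fun w hw => (h w hw).deriv) hz
    (by simp)⟩

/-- Differentiating fᴺ = C gives N fᴺ⁻¹ f' = 0. This removes the 24th powers introduced to avoid the
multiplier of η. -/
theorem exists_const_of_pow_const {f : ℂ → ℂ} (hf : DifferentiableOn ℂ f {z | 0 < z.im}) {N : ℕ}
    (hN : N ≠ 0) {C : ℂ} (h : ∀ z : ℂ, 0 < z.im → f z ^ N = C) :
    ∃ C, ∀ z : ℂ, 0 < z.im → f z = C := by
  by_cases hC : C = 0
  · exact ⟨0, fun z hz => pow_eq_zero_iff hN |>.mp ((h z hz).trans hC)⟩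
  · refine exists_eq_of_hasDerivAt_zero fun z hz => ?_
    have h1 := (hf.differentiableAt (upper_mem_nhds hz)).hasDerivAt
    have h2 : HasDerivAt (fun z => f z ^ N) 0 z := by
      refine (hasDerivAt_const z C).congr_of_eventuallyEq ?_
      filter_upwards [upper_mem_nhds hz] with w hw using h w hw
    have h3 := (h1.fun_pow N).unique h2
    have h4 : f z ≠ 0 := fun h0 => hC (by rw [← h z hz, h0, zero_pow hN])
    have h5 : deriv f z = 0 := by
      have : (N : ℂ) ≠ 0 := by exact_mod_cast hN
      simpa [this, h4] using h3
    rwa [h5] at h1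

/-- A holomorphic function that transforms like a form of weight `w` and vanishes at all cusps at
least to the same order as an eta quotient is a multiple of the eta quotient. -/
theorem eq_const_mul_etaQuot {F : ℂ → ℂ} {n : ℕ → ℤ} {w : ℕ} (hn : ∑ k ∈ levels, n k = 2 * w)
    (hF : DifferentiableOn ℂ F {z | 0 < z.im})
    (hinv : ∀ a b c d : ℤ, a * d - b * c = 1 → (6 : ℤ) ∣ c → (6 : ℤ) ∣ b → ∀ z : ℂ, 0 < z.im →
      F ((a * z + b) / (c * z + d)) ^ 24 = ((c * z + d) ^ w * F z) ^ 24)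
    (hbd : ∀ a b c d : ℤ, a * d - b * c = 1 → ∃ G : ℂ → ℂ,
      (∀ z : ℂ, 0 < z.im → F ((a * z + b) / (c * z + d)) = (c * z + d) ^ w * G z) ∧
      G =O[cuspInf] decay (1 / 24 * ∑ k ∈ levels, n k * cuspScale k c)) :
    ∃ C, ∀ z : ℂ, 0 < z.im → F z = C * etaQuot n z := by
  have hz24 : ∀ j : ℂ, j ^ (12 * ∑ k ∈ levels, n k) = (j ^ w) ^ 24 := by
    intro j
    rw [hn, ← pow_mul, ← zpow_natCast]
    congr 1
    push_cast
    ring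
  have hdiff : DifferentiableOn ℂ (fun z => F z / etaQuot n z) {z | 0 < z.im} :=
    hF.div (differentiableOn_etaQuot n) fun z hz => etaQuot_ne_zero n hz
  -- The quotient is only known to be invariant up to 24th roots of unity, so the Liouville
  -- principle is applied to its 24th power.
  obtain ⟨C, hC⟩ := liouville (F := fun z => (F z / etaQuot n z) ^ 24) (hdiff.pow 24)
    (fun a b c d h hc hb z hz => by
      obtain ⟨B, δ, hδ, h6, hT⟩ := exists_etaQuot_transform h
      have e := (hT z hz n).1
      have hj := cocycle_ne_zero h hz
      rw [div_pow, div_pow, hinv a b c d h hc hb z hz, e, hz24, mul_pow]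
      have : ∏ k ∈ levels, ((δ k : ℂ) ^ (12 * n k))⁻¹ * (eta (cuspScale k c * z + B k) ^ 24) ^ n k
          = etaQuot n z ^ 24 := by
        rw [etaQuot, ← Finset.prod_pow]
        refine Finset.prod_congr rfl fun k hk => ?_
        obtain ⟨h1, h2, m, hm⟩ := h6 hc k hk
        rw [h1, h2, hm]
        simp only [ofReal_one, one_zpow, inv_one, one_mul, ofReal_natCast, ofReal_intCast]
        rw [eta_pow_eq, nome_add, nome_int, mul_one, ← eta_pow_eq, ← zpow_natCast, ← zpow_natCast,
          zpow_comm]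
      rw [this, mul_div_mul_left _ _ (pow_ne_zero _ (pow_ne_zero _ hj))])
    (fun a b c d h => by
      obtain ⟨B, δ, hδ, h6, hT⟩ := exists_etaQuot_transform h
      obtain ⟨G, hG, hO⟩ := hbd a b c d h
      have hs : ∀ k ∈ levels, 0 < cuspScale k c := fun k hk => cuspScale_pos (levels_pos hk) c
      have h1 := decay_isBigO_etaQuot (n := n) (s := fun k => cuspScale k c) (B := B) hs hδ
      set D := fun z : ℂ =>
        ∏ k ∈ levels, ((δ k : ℂ) ^ (12 * n k))⁻¹ * (eta (cuspScale k c * z + B k) ^ 24) ^ n k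
      have hD : ∀ z : ℂ, 0 < z.im → D z ≠ 0 := by
        intro z hz
        have := (hT z hz n).1
        intro h0
        rw [show (∏ k ∈ levels, ((δ k : ℂ) ^ (12 * n k))⁻¹ *
          (eta (cuspScale k c * z + B k) ^ 24) ^ n k) = D z from rfl, h0, mul_zero] at this
        exact pow_ne_zero 24 (etaQuot_ne_zero n (im_mobius_pos h hz)) this
      have h2 : (fun z => G z ^ 24) =O[cuspInf] D := by
        refine (hO.pow 24).trans (h1.congr_left fun z => ?_)
        rw [decay, decay, ← Real.exp_nat_mul]
        push_cast
        ring_nf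
      have h3 := h2.mul (isBigO_refl (fun z => (D z)⁻¹) cuspInf)
      refine IsBigO.trans (h3.congr' ?_ EventuallyEq.rfl) ?_
      · filter_upwards [eventually_cuspInf_pos] with z hz
        have hj := cocycle_ne_zero h hz
        rw [hG z hz, div_pow, (hT z hz n).1, hz24, mul_pow,
          mul_div_mul_left _ _ (pow_ne_zero _ (pow_ne_zero _ hj))]
        rfl
      · refine IsBigO.of_bound 1 ?_
        filter_upwards [eventually_cuspInf_pos] with z hz
        simp [hD z hz])
  obtain ⟨C', hC'⟩ := exists_const_of_pow_const hdiff (by norm_num) hC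
  refine ⟨C', fun z hz => ?_⟩
  rw [← hC' z hz, div_mul_cancel₀ _ (etaQuot_ne_zero n hz)]

/-! ### Behaviour at `i∞` -/

/-- The power series part of an eta quotient. -/
noncomputable def unitQ (n : ℕ → ℤ) (q : ℂ) : ℂ := ∏ k ∈ levels, euler (q ^ k) ^ n k

theorem norm_pow_lt_one {q : ℂ} (hq : ‖q‖ < 1) {k : ℕ} (hk : 0 < k) : ‖q ^ k‖ < 1 := by
  rw [norm_pow]; exact pow_lt_one₀ (norm_nonneg q) hq hk.ne'

theorem analyticAt_unitQ (n : ℕ → ℤ) {q : ℂ} (hq : ‖q‖ < 1) : AnalyticAt ℂ (unitQ n) q := by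
  refine Finset.analyticAt_fun_prod _ fun k hk => ?_
  have h := norm_pow_lt_one hq (levels_pos hk)
  exact AnalyticAt.fun_zpow (AnalyticAt.fun_comp (f := fun q : ℂ => q ^ k) (analyticAt_euler h)
    (analyticAt_id.fun_pow k)) (euler_ne_zero h)

@[simp] theorem unitQ_zero (n : ℕ → ℤ) : unitQ n 0 = 1 := by
  refine Finset.prod_eq_one fun k hk => ?_
  simp [(levels_pos hk).ne']

/-- The fractional powers q^(k/24) combine to the integral power qᵐ exactly under this condition on
the exponents. -/
theorem etaQuot_eq (n : ℕ → ℤ) {m : ℕ} (hm : ∑ k ∈ levels, k * n k = 24 * m) (z : ℂ) :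
    etaQuot n z = nome z ^ m * unitQ n (nome z) := by
  have : ∏ k ∈ levels, nome (k * z / 24) ^ n k = nome z ^ m := by
    have h1 : ∀ k ∈ levels, nome (k * z / 24) ^ n k = nome (z / 24) ^ (k * n k) := by
      intro k _
      rw [zpow_mul, zpow_natCast, ← nome_nat_mul, mul_div_assoc]
    rw [Finset.prod_congr rfl h1, ← zpow_sum₀' (nome_ne_zero _), hm, zpow_mul, zpow_natCast]
    rw [show nome (z / 24) ^ ((24 : ℤ)) = nome z by
      rw [show (24 : ℤ) = (24 : ℕ) by norm_num, zpow_natCast, ← nome_nat_mul]; congr 1; push_cast; ring]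
  rw [etaQuot, unitQ, ← this, ← Finset.prod_mul_distrib]
  refine Finset.prod_congr rfl fun k _ => ?_
  rw [eta_eq, mul_zpow, nome_nat_mul]

/-- `logDer n` as a function of the nome. -/
noncomputable def logDerQ (n : ℕ → ℤ) (q : ℂ) : ℂ :=
  1 / 24 * ∑ k ∈ levels, n k * (k * eisTwoQ (q ^ k))

theorem logDer_eq (n : ℕ → ℤ) (z : ℂ) : logDer n z = logDerQ n (nome z) := by
  simp only [logDer, logDerQ, eisTwo, nome_nat_mul]

theorem analyticAt_logDerQ (n : ℕ → ℤ) {q : ℂ} (hq : ‖q‖ < 1) : AnalyticAt ℂ (logDerQ n) q := by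
  refine analyticAt_const.mul (Finset.analyticAt_fun_sum _ fun k hk => ?_)
  have h := norm_pow_lt_one hq (levels_pos hk)
  exact analyticAt_const.mul
    (analyticAt_const.mul (AnalyticAt.fun_comp (f := fun q : ℂ => q ^ k) (analyticAt_eisTwoQ h)
      (analyticAt_id.fun_pow k)))

theorem logDerQ_zero (n : ℕ → ℤ) : logDerQ n 0 = 1 / 24 * ∑ k ∈ levels, (n k * k : ℂ) := by
  rw [logDerQ]
  congr 1
  refine Finset.sum_congr rfl fun k hk => ?_
  simp [(levels_pos hk).ne']

theorem hasDerivAt_logDerQ_zero (n : ℕ → ℤ) : HasDerivAt (logDerQ n) (-n 1) 0 := by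
  have h : ∀ k : ℕ, 0 < k → HasDerivAt (fun q : ℂ => n k * (k * eisTwoQ (q ^ k)))
      (n k * (k * (-24 * (k * (0 : ℂ) ^ (k - 1))))) 0 := by
    intro k hk
    have h1 : HasDerivAt eisTwoQ (-24) ((0 : ℂ) ^ k) := by
      rw [zero_pow hk.ne']; exact hasDerivAt_eisTwoQ_zero
    exact ((h1.comp (0 : ℂ) (hasDerivAt_pow k (0 : ℂ))).const_mul (k : ℂ)).const_mul (n k : ℂ)
  have h2 := (HasDerivAt.fun_sum (u := levels) fun k hk => h k (levels_pos hk)).const_mul (1 / 24 : ℂ)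
  refine h2.congr_deriv ?_
  rw [sum_levels]
  norm_num
  ring

theorem hasDerivAt_logDer (n : ℕ → ℤ) {z : ℂ} (hz : 0 < z.im) :
    HasDerivAt (logDer n) (2 * Real.pi * I * (nome z * deriv (logDerQ n) (nome z))) z := by
  have h := ((analyticAt_logDerQ n (norm_nome_lt_one hz)).differentiableAt.hasDerivAt).comp z
    (hasDerivAt_nome z)
  have e : logDer n = logDerQ n ∘ nome := funext (logDer_eq n)
  rw [e]
  exact h.congr_deriv (by ring)

theorem differentiableOn_logDer (n : ℕ → ℤ) : DifferentiableOn ℂ (logDer n) {z | 0 < z.im} :=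
  fun _ hz => (hasDerivAt_logDer n hz).differentiableAt.differentiableWithinAt

/-- If an analytic function of the nome equals `C q^m u(q)` with `u(0) = 1`, then its leading
coefficient is `C`. -/
theorem const_eq_of_nome {f u : ℂ → ℂ} {C L : ℂ} {m : ℕ} (hu : ContinuousAt u 0) (hu0 : u 0 = 1)
    (hf : Tendsto (fun q => f q / q ^ m) (𝓝[≠] 0) (𝓝 L))
    (h : ∀ z : ℂ, 0 < z.im → f (nome z) = C * (nome z ^ m * u (nome z))) : C = L := by
  have h1 : Tendsto nome cuspInf (𝓝[≠] 0) :=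
    tendsto_nhdsWithin_iff.mpr ⟨tendsto_nome, Eventually.of_forall nome_ne_zero⟩
  have h2 : Tendsto (fun z => C * u (nome z)) cuspInf (𝓝 (C * 1)) := by
    rw [← hu0]
    exact (hu.tendsto.comp tendsto_nome).const_mul C
  rw [mul_one] at h2
  refine tendsto_nhds_unique h2 ((hf.comp h1).congr' ?_)
  filter_upwards [eventually_cuspInf_pos] with z hz
  have := pow_ne_zero m (nome_ne_zero z)
  simp only [Function.comp, h z hz]
  field_simp

/-! ### The four forms of weight one -/

/-- The exponents of an eta quotient of level 6. -/
def expo (n₁ n₂ n₃ n₆ : ℤ) : ℕ → ℤ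
  | 1 => n₁
  | 2 => n₂
  | 3 => n₃
  | 6 => n₆
  | _ => 0

/-- Exponents of the weight one form with a zero at the cusp `1/3`. -/
def expA : ℕ → ℤ := expo (-2) 1 6 (-3)
/-- Exponents of the weight one form with a zero at the cusp `i∞`. -/
def expB : ℕ → ℤ := expo 1 (-2) (-3) 6
/-- Exponents of the weight one form with a zero at the cusp `1/2`. -/
def expC : ℕ → ℤ := expo (-3) 6 1 (-2)
/-- Exponents of the weight one form with a zero at the cusp `0`. -/
def expD : ℕ → ℤ := expo 6 (-3) (-2) 1

/-- Total exponent zero removes the anomaly of E₂, so the logarithmic derivative is a form of weight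
two. At a cusp where the eta quotient n has order zero its constant term vanishes and decay remains;
where the comparison quotient m has order at most zero, boundedness is enough. -/
theorem logDer_isBigO {n m : ℕ → ℤ} (hn : ∑ k ∈ levels, n k = 0)
    {a b c d : ℤ} (h : a * d - b * c = 1)
    (hc : (∑ k ∈ levels, (n k : ℝ) * cuspScale k c = 0 ∧
        ∀ k ∈ levels, 1 / 24 * ∑ k ∈ levels, m k * cuspScale k c ≤ cuspScale k c) ∨
      1 / 24 * ∑ k ∈ levels, m k * cuspScale k c ≤ 0) :
    ∃ G : ℂ → ℂ, (∀ z : ℂ, 0 < z.im →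
      logDer n ((a * z + b) / (c * z + d)) = (c * z + d) ^ 2 * G z) ∧
      G =O[cuspInf] decay (1 / 24 * ∑ k ∈ levels, m k * cuspScale k c) := by
  obtain ⟨B, δ, hδ, h6, hT⟩ := exists_etaQuot_transform h
  have hs : ∀ k ∈ levels, 0 < cuspScale k c := fun k hk => cuspScale_pos (levels_pos hk) c
  refine ⟨logDerAt n (fun k => cuspScale k c) B, fun z hz => ?_, ?_⟩
  · rw [(hT z hz n).2, hn]; simp
  · rcases hc with ⟨h0, hν⟩ | h0
    · have := logDerAt_sub_isBigO (n := n) (s := fun k => cuspScale k c) B hs hν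
      simpa [h0] using this
    · have h1 := logDerAt_sub_isBigO (n := n) (s := fun k => cuspScale k c) B (ν := 0) hs
        fun k hk => (hs k hk).le
      have h2 : (fun _ : ℂ => ((1 / 24 * ∑ k ∈ levels, n k * cuspScale k c : ℝ) : ℂ))
          =O[cuspInf] decay 0 := by
        rw [decay_zero]; exact isBigO_const_const _ one_ne_zero _
      refine IsBigO.trans ((h1.add h2).congr_left fun z => ?_) (decay_isBigO h0)
      ring

theorem logDer_mobius_of_dvd {n : ℕ → ℤ} (hn : ∑ k ∈ levels, n k = 0)
    {a b c d : ℤ} (h : a * d - b * c = 1) (hc : (6 : ℤ) ∣ c) {z : ℂ} (hz : 0 < z.im) :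
    logDer n ((a * z + b) / (c * z + d)) = (c * z + d) ^ 2 * logDer n z := by
  obtain ⟨B, δ, hδ, h6, hT⟩ := exists_etaQuot_transform h
  rw [(hT z hz n).2, hn, logDerAt_eq_logDer (fun k hk => (h6 hc k hk).1)
    (fun k hk => (h6 hc k hk).2.2)]
  simp

/-- A form of weight two that vanishes at least as strongly as the eta quotient m at each cusp is
proportional to it. The conditions on ∑ n k · k and ∑ k · m k normalise both constant terms at i∞ to
1. -/
theorem logDer_eq_etaQuot {n m : ℕ → ℤ} (hn : ∑ k ∈ levels, n k = 0)
    (hn1 : ∑ k ∈ levels, (n k * k : ℂ) = 24) (hm : ∑ k ∈ levels, m k = 2 * (2 : ℕ))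
    (hm1 : ∑ k ∈ levels, k * m k = 24 * (0 : ℕ))
    (hc : ∀ c : ℤ, (∑ k ∈ levels, (n k : ℝ) * cuspScale k c = 0 ∧
        ∀ k ∈ levels, 1 / 24 * ∑ k ∈ levels, m k * cuspScale k c ≤ cuspScale k c) ∨
      1 / 24 * ∑ k ∈ levels, m k * cuspScale k c ≤ 0) {z : ℂ} (hz : 0 < z.im) :
    logDer n z = etaQuot m z := by
  obtain ⟨C, hC⟩ := eq_const_mul_etaQuot hm (differentiableOn_logDer n)
    (fun a b c d h h6 _ z hz => congrArg (· ^ 24) (logDer_mobius_of_dvd hn h h6 hz))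
    (fun a b c d h => logDer_isBigO hn h (hc c))
  have h1 : C = 1 := by
    refine const_eq_of_nome (f := logDerQ n) (u := unitQ m) (m := 0)
      (analyticAt_unitQ m (by simp)).continuousAt (unitQ_zero m) ?_ fun z hz => ?_
    · have h2 : ContinuousAt (logDerQ n) 0 := (analyticAt_logDerQ n (by simp)).continuousAt
      have h3 : logDerQ n 0 = 1 := by rw [logDerQ_zero, hn1]; norm_num
      simp only [pow_zero, div_one]
      rw [← h3]
      exact h2.tendsto.mono_left nhdsWithin_le_nhds
    · rw [← logDer_eq, hC z hz, etaQuot_eq m hm1]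
  rw [hC z hz, h1, one_mul]

/-- `D log (b/a) = c d`. -/
theorem logDer_ba {z : ℂ} (hz : 0 < z.im) : logDer (expB - expA) z = etaQuot (expC + expD) z := by
  refine logDer_eq_etaQuot ?_ ?_ ?_ ?_ (fun c => ?_) hz
  · simp [sum_levels, expA, expB, expo]
  · simp [sum_levels, expA, expB, expo]; norm_num
  · simp [sum_levels, expC, expD, expo]
  · simp [sum_levels, expC, expD, expo]
  · have h := cuspScale_table c
    simp only [forall_levels, sum_levels]
    rcases h with h | h | h | h <;> simp [h, expA, expB, expC, expD, expo] <;> norm_num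

/-- `D log (b/c) = a d`. -/
theorem logDer_bc {z : ℂ} (hz : 0 < z.im) : logDer (expB - expC) z = etaQuot (expA + expD) z := by
  refine logDer_eq_etaQuot ?_ ?_ ?_ ?_ (fun c => ?_) hz
  · simp [sum_levels, expC, expB, expo]
  · simp [sum_levels, expC, expB, expo]; norm_num
  · simp [sum_levels, expA, expD, expo]
  · simp [sum_levels, expA, expD, expo]
  · have h := cuspScale_table c
    simp only [forall_levels, sum_levels]
    rcases h with h | h | h | h <;> simp [h, expA, expB, expC, expD, expo] <;> norm_num

/-- `D log (b/d) = a c`. -/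
theorem logDer_bd {z : ℂ} (hz : 0 < z.im) : logDer (expB - expD) z = etaQuot (expA + expC) z := by
  refine logDer_eq_etaQuot ?_ ?_ ?_ ?_ (fun c => ?_) hz
  · simp [sum_levels, expD, expB, expo]
  · simp [sum_levels, expD, expB, expo]; norm_num
  · simp [sum_levels, expA, expC, expo]
  · simp [sum_levels, expA, expC, expo]
  · have h := cuspScale_table c
    simp only [forall_levels, sum_levels]
    rcases h with h | h | h | h <;> simp [h, expA, expB, expC, expD, expo] <;> norm_num

/-! ### The differential equation for the form of weight one -/

theorem mul_sub_mul_isBigO {f g : ℂ → ℂ} {x y : ℂ} {ν : ℝ} (hν : 0 ≤ ν)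
    (hf : (fun z => f z - x) =O[cuspInf] decay ν) (hg : (fun z => g z - y) =O[cuspInf] decay ν) :
    (fun z => f z * g z - x * y) =O[cuspInf] decay ν := by
  have h1 : (fun z => (f z - x) * (g z - y)) =O[cuspInf] decay ν := by
    have := hf.mul (hg.trans (decay_isBigO_one hν))
    simpa using this
  refine ((h1.add (hg.const_mul_left x)).add (hf.const_mul_left y)).congr_left fun z => ?_
  ring

/-- The defect in the differential equation for `D log a`, in terms of logarithmic derivatives. -/
noncomputable def defect (e e' w₁ w₂ w₃ : ℂ) : ℂ := e' - e * e - w₁ * ((w₃ + 2 * w₂) / 3 - w₁)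

/-- `defect` as a function of the nome. -/
noncomputable def defectQ (q : ℂ) : ℂ :=
  defect (logDerQ expA q) (q * deriv (logDerQ expA) q) (logDerQ (expB - expA) q)
    (logDerQ (expB - expC) q) (logDerQ (expB - expD) q)

theorem analyticAt_defectQ {q : ℂ} (hq : ‖q‖ < 1) : AnalyticAt ℂ defectQ q := by
  have hA := analyticAt_logDerQ expA hq
  have h1 := analyticAt_logDerQ (expB - expA) hq
  have h2 := analyticAt_logDerQ (expB - expC) hq
  have h3 := analyticAt_logDerQ (expB - expD) hq
  exact ((analyticAt_id.mul hA.deriv).sub (hA.mul hA)).sub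
    (h1.mul (((h3.add (analyticAt_const.mul h2)).div_const).sub h1))

theorem defectQ_zero : defectQ 0 = 0 := by
  simp only [defectQ, defect, logDerQ_zero, sum_levels]
  simp [expA, expB, expC, expD, expo]
  norm_num

/-- Together with the vanishing at q = 0 this shows that the q-coefficient is zero. That is all that
is needed: the defect will be a multiple of abcd = η(τ)²η(2τ)²η(3τ)²η(6τ)², whose expansion starts
with q. -/
theorem hasDerivAt_defectQ_zero : HasDerivAt defectQ 0 0 := by
  have h0 : ‖(0 : ℂ)‖ < 1 := by simp
  have hA := hasDerivAt_logDerQ_zero expA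
  have hA' := (hasDerivAt_id (0 : ℂ)).mul
    (analyticAt_logDerQ expA h0).deriv.differentiableAt.hasDerivAt
  have h1 := hasDerivAt_logDerQ_zero (expB - expA)
  have h2 := hasDerivAt_logDerQ_zero (expB - expC)
  have h3 := hasDerivAt_logDerQ_zero (expB - expD)
  have := (hA'.sub (hA.mul hA)).sub (h1.mul (((h3.add (h2.const_mul 2)).div_const 3).sub h1))
  refine HasDerivAt.congr_deriv (f' := _) this ?_
  simp only [Pi.add_apply, Pi.sub_apply, id, logDerQ_zero, sum_levels, hA.deriv]
  simp [expA, expB, expC, expD, expo]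
  norm_num

theorem differentiableOn_defect : DifferentiableOn ℂ (fun z => defectQ (nome z)) {z | 0 < z.im} :=
  fun z hz => ((analyticAt_defectQ (norm_nome_lt_one hz)).differentiableAt.comp z
    (hasDerivAt_nome z).differentiableAt).differentiableWithinAt

/-- For e = D log a with a of weight one, the anomalous terms of De and e² cancel, so De - e² is
modular of weight four. The other summand is a product of two weight two forms. -/
theorem defect_mobius {a b c d : ℤ} (h : a * d - b * c = 1) :
    ∃ B : ℕ → ℝ, ((6 : ℤ) ∣ c → ∀ k ∈ levels, cuspScale k c = k ∧ ∃ m : ℤ, B k = m) ∧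
      ∀ z : ℂ, 0 < z.im → defectQ (nome ((a * z + b) / (c * z + d))) = (c * z + d) ^ 4 *
        defect (logDerAt expA (fun k => cuspScale k c) B z)
          (logDerAt' expA (fun k => cuspScale k c) B z)
          (logDerAt (expB - expA) (fun k => cuspScale k c) B z)
          (logDerAt (expB - expC) (fun k => cuspScale k c) B z)
          (logDerAt (expB - expD) (fun k => cuspScale k c) B z) := by
  obtain ⟨B, δ, hδ, h6, hT⟩ := exists_etaQuot_transform h
  have hs : ∀ k ∈ levels, 0 < cuspScale k c := fun k hk => cuspScale_pos (levels_pos hk) c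
  refine ⟨B, fun hc k hk => ⟨(h6 hc k hk).1, (h6 hc k hk).2.2⟩, fun z hz => ?_⟩
  have hj := cocycle_ne_zero h hz
  have hpi : (Real.pi : ℂ) ≠ 0 := by exact_mod_cast Real.pi_ne_zero
  have eA : ∀ z : ℂ, 0 < z.im → logDer expA ((a * z + b) / (c * z + d))
      = (c * z + d) ^ 2 * logDerAt expA (fun k => cuspScale k c) B z
        + 1 / (2 * Real.pi * I) * c * (c * z + d) := by
    intro z hz
    rw [(hT z hz expA).2, sum_levels]
    simp [expA, expo]
  have h1 := (hasDerivAt_logDer expA (im_mobius_pos h hz)).comp z (hasDerivAt_mobius h hz)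
  have hl : HasDerivAt (fun z : ℂ => c * z + d) (c : ℂ) z := by
    simpa using ((hasDerivAt_id z).const_mul (c : ℂ)).add_const (d : ℂ)
  have h2 := ((hl.fun_pow 2).fun_mul (hasDerivAt_logDerAt expA B hs hz)).fun_add
    (hl.const_mul (1 / (2 * Real.pi * I) * c))
  have h3 := h1.unique (h2.congr_of_eventuallyEq (by
    filter_upwards [upper_mem_nhds hz] with w hw using eA w hw))
  have hw : ∀ n : ℕ → ℤ, ∑ k ∈ levels, n k = 0 → logDer n ((a * z + b) / (c * z + d))
      = (c * z + d) ^ 2 * logDerAt n (fun k => cuspScale k c) B z := by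
    intro n hn
    rw [(hT z hz n).2, hn]; simp
  simp only [defectQ, ← logDer_eq]
  rw [eA z hz, hw _ (by simp [sum_levels, expA, expB, expo]),
    hw _ (by simp [sum_levels, expB, expC, expo]), hw _ (by simp [sum_levels, expB, expD, expo])]
  set M := (a * z + b) / (c * z + d)
  set D := nome M * deriv (logDerQ expA) (nome M)
  have h4 : D = (c * z + d) ^ 2 * ((1 / (2 * Real.pi * I)) * (2 * c * (c * z + d)
      * logDerAt expA (fun k => cuspScale k c) B z
      + (c * z + d) ^ 2 * (2 * Real.pi * I * logDerAt' expA (fun k => cuspScale k c) B z)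
      + 1 / (2 * Real.pi * I) * c * c)) := by
    have h5 : D = (c * z + d) ^ 2 * ((1 / (2 * Real.pi * I)) *
        (2 * Real.pi * I * D * (1 / (c * z + d) ^ 2))) := by
      field_simp
    rw [h5]
    congr 2
    rw [h3]
    push_cast
    ring
  rw [h4, defect, defect]
  field_simp
  ring

theorem logDerAt'_eq_logDer (n : ℕ → ℤ) {s B : ℕ → ℝ} (hs : ∀ k ∈ levels, s k = k)
    (hB : ∀ k ∈ levels, ∃ m : ℤ, B k = m) {z : ℂ} (hz : 0 < z.im) :
    logDerAt' n s B z = nome z * deriv (logDerQ n) (nome z) := by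
  have h1 := hasDerivAt_logDerAt n (s := s) B (fun k hk => by
    rw [hs k hk]; exact_mod_cast levels_pos hk) hz
  rw [logDerAt_eq_logDer hs hB] at h1
  have h2 := h1.unique (hasDerivAt_logDer n hz)
  have hpi : (2 * Real.pi * I : ℂ) ≠ 0 := by simp [Real.pi_ne_zero]
  exact mul_left_cancel₀ hpi h2

/-- The defect vanishes at every cusp, so it is a multiple of the cusp form abcd; its q-coefficient
is zero, so the multiple is zero. -/
theorem defect_eq_zero {z : ℂ} (hz : 0 < z.im) : defectQ (nome z) = 0 := by
  obtain ⟨C, hC⟩ := eq_const_mul_etaQuot (F := fun z => defectQ (nome z))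
    (n := expA + expB + expC + expD) (w := 4) (by simp [sum_levels, expA, expB, expC, expD, expo])
    differentiableOn_defect
    (fun a b c d h h6 _ z hz => congrArg (· ^ 24) <| by
      obtain ⟨B, hB, hT⟩ := defect_mobius h
      have hs := fun k hk => (hB h6 k hk).1
      have hB' := fun k hk => (hB h6 k hk).2
      rw [hT z hz, logDerAt'_eq_logDer _ hs hB' hz, logDerAt_eq_logDer hs hB',
        logDerAt_eq_logDer hs hB', logDerAt_eq_logDer hs hB', logDerAt_eq_logDer hs hB']
      simp only [defectQ, logDer_eq])
    (fun a b c d h => by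
      obtain ⟨B, -, hT⟩ := defect_mobius h
      refine ⟨_, hT, ?_⟩
      have hs : ∀ k ∈ levels, 0 < cuspScale k c := fun k hk => cuspScale_pos (levels_pos hk) c
      set ν := 1 / 24 * ∑ k ∈ levels, ((expA + expB + expC + expD) k) * cuspScale k c with hν
      have hν0 : 0 ≤ ν ∧ ∀ k ∈ levels, ν ≤ cuspScale k c := by
        rw [hν]
        simp only [forall_levels, sum_levels]
        rcases cuspScale_table c with h | h | h | h <;>
          simp [h, expA, expB, expC, expD, expo] <;> norm_num
      have hO := fun n : ℕ → ℤ => logDerAt_sub_isBigO (n := n) (s := fun k => cuspScale k c) B hs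
        hν0.2
      have hO' := logDerAt'_isBigO expA (s := fun k => cuspScale k c) B hs hν0.2
      have h1 := mul_sub_mul_isBigO hν0.1 (hO expA) (hO expA)
      have h2 := mul_sub_mul_isBigO hν0.1 (hO (expB - expA))
        (((((hO (expB - expD)).add ((hO (expB - expC)).const_mul_left 2)).const_mul_left
          (1 / 3)).sub (hO (expB - expA))).congr_left fun z => by
            rw [show ∀ x₁ x₂ x₃ y₁ y₂ y₃ : ℂ, 1 / 3 * (x₁ - y₁ + 2 * (x₂ - y₂)) - (x₃ - y₃)
              = ((x₁ + 2 * x₂) / 3 - x₃) - ((y₁ + 2 * y₂) / 3 - y₃) by intros; ring])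
      -- What remains is that the constant terms of the two products cancel, which is checked at
      -- each of the four kinds of cusps. The mixture (w₃ + 2w₂)/3 in `defect` is consistent with
      -- all four.
      refine ((hO'.sub h1).sub h2).congr_left fun z => ?_
      rw [defect]
      simp only [sum_levels]
      rcases cuspScale_table c with h | h | h | h <;>
        simp [h, expA, expB, expC, expD, expo] <;> ring)
  have h1 : C = 0 := by
    refine const_eq_of_nome (f := defectQ) (m := 1)
      (analyticAt_unitQ (expA + expB + expC + expD) (by simp)).continuousAt (unitQ_zero _) ?_
      fun z hz => ?_
    · have := hasDerivAt_defectQ_zero.tendsto_slope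
      refine this.congr fun q => ?_
      simp [slope, defectQ_zero, div_eq_inv_mul]
    · rw [hC z hz, etaQuot_eq _ (m := 1)]
      simp [sum_levels, expA, expB, expC, expD, expo]
  have := hC z hz
  simpa [h1] using this

/-! ### The linear relations and the differential system -/

/-- The weight one form with a zero at the cusp `1/3`. -/
noncomputable def formA (z : ℂ) : ℂ := etaQuot expA z
/-- The weight one form with a zero at the cusp `i∞`. -/
noncomputable def formB (z : ℂ) : ℂ := etaQuot expB z
/-- The weight one form with a zero at the cusp `1/2`. -/
noncomputable def formC (z : ℂ) : ℂ := etaQuot expC z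
/-- The weight one form with a zero at the cusp `0`. -/
noncomputable def formD (z : ℂ) : ℂ := etaQuot expD z

theorem formA_ne_zero {z : ℂ} (hz : 0 < z.im) : formA z ≠ 0 := etaQuot_ne_zero _ hz

theorem formC_ne_zero {z : ℂ} (hz : 0 < z.im) : formC z ≠ 0 := etaQuot_ne_zero _ hz

theorem logDer_ba' {z : ℂ} (hz : 0 < z.im) : logDer (expB - expA) z = formC z * formD z := by
  rw [logDer_ba hz, etaQuot_add _ _ hz]; rfl
theorem logDer_bc' {z : ℂ} (hz : 0 < z.im) : logDer (expB - expC) z = formA z * formD z := by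
  rw [logDer_bc hz, etaQuot_add _ _ hz]; rfl
theorem logDer_bd' {z : ℂ} (hz : 0 < z.im) : logDer (expB - expD) z = formA z * formC z := by
  rw [logDer_bd hz, etaQuot_add _ _ hz]; rfl

/-- Writing n also for the eta quotient, D log(b/a) = f n and D log(b/n) = f a give b · D((n - a)/b)
= -n · fa + a · fn = 0. So n - a is a constant multiple of b. -/
theorem etaQuot_linear_relation {n : ℕ → ℤ} {f g : ℂ → ℂ}
    (hA : ∀ z : ℂ, 0 < z.im → logDer (expB - expA) z = f z * etaQuot n z)
    (hn : ∀ z : ℂ, 0 < z.im → logDer (expB - n) z = f z * formA z)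
    (hg : AnalyticAt ℂ g 0) (hg0 : g 0 = 1) (hgf : ∀ z : ℂ, 0 < z.im → f z = g (nome z))
    {κ : ℂ} (hκ : ((n 1 - expA 1 : ℤ) : ℂ) = -κ) {z : ℂ} (hz : 0 < z.im) :
    etaQuot n z = formA z + κ * formB z := by
  have hb := fun z (hz : 0 < Complex.im z) => etaQuot_ne_zero expB hz
  obtain ⟨C, hC⟩ := exists_eq_of_hasDerivAt_zero
    (f := fun z => (etaQuot n z - formA z) / etaQuot expB z) fun z hz => by
    refine ((((hasDerivAt_etaQuot n hz).fun_sub (hasDerivAt_etaQuot expA hz)).fun_div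
      (hasDerivAt_etaQuot expB hz) (hb z hz))).congr_deriv ?_
    have h1 := hA z hz
    have h2 := hn z hz
    rw [logDer_sub] at h1 h2
    rw [div_eq_zero_iff]
    left
    rw [formA] at h2
    linear_combination 2 * Real.pi * I * etaQuot expB z * (etaQuot expA z * h1 - etaQuot n z * h2)
  have h1 : ∀ z : ℂ, 0 < z.im → etaQuot n z = formA z + C * formB z := by
    intro z hz
    have := hC z hz
    rw [div_eq_iff (hb z hz)] at this
    rw [formB]
    linear_combination this
  -- The difference of the two logarithmic derivatives is f(n - a) = C f b, with f = 1 + O(q) and b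
  -- = q + O(q²). Hence C is the q-coefficient of that difference, which depends only on the
  -- exponents of η(τ).
  have hCκ : C = κ := by
    refine const_eq_of_nome (f := fun q => logDerQ (expB - expA) q - logDerQ (expB - n) q) (m := 1)
      (u := fun q => g q * unitQ expB q) (hg.mul (analyticAt_unitQ expB (by simp))).continuousAt
      (by simp [hg0]) ?_ fun z hz => ?_
    · have h2 := ((hasDerivAt_logDerQ_zero (expB - expA)).fun_sub
        (hasDerivAt_logDerQ_zero (expB - n))).tendsto_slope
      have h3 : -(((expB - expA) 1 : ℤ) : ℂ) - -(((expB - n) 1 : ℤ) : ℂ) = κ := by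
        simp only [Pi.sub_apply]
        push_cast at hκ ⊢
        linear_combination -hκ
      rw [h3] at h2
      refine h2.congr fun q => ?_
      have h4 : logDerQ (expB - expA) 0 - logDerQ (expB - n) 0 = 0 := by
        have h5 : ContinuousAt (fun q => logDerQ (expB - expA) q - logDerQ (expB - n) q) 0 :=
          ((analyticAt_logDerQ _ (by simp)).sub (analyticAt_logDerQ _ (by simp))).continuousAt
        have h6 := h5.tendsto.comp tendsto_nome
        have h7 : Tendsto (fun z => C * (g (nome z) * (nome z ^ 1 * unitQ expB (nome z)))) cuspInf
            (𝓝 (C * (g 0 * (0 ^ 1 * unitQ expB 0)))) :=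
          (((hg.continuousAt.tendsto.comp tendsto_nome).mul ((tendsto_nome.pow 1).mul
            ((analyticAt_unitQ expB (by simp)).continuousAt.tendsto.comp tendsto_nome)))).const_mul C
        simp only [zero_pow (one_ne_zero), zero_mul, mul_zero] at h7
        refine tendsto_nhds_unique (h6.congr' ?_) h7
        filter_upwards [eventually_cuspInf_pos] with z hz
        simp only [Function.comp]
        rw [← logDer_eq, ← logDer_eq, hA z hz, hn z hz, h1 z hz, hgf z hz, formB,
          etaQuot_eq expB (m := 1) (by simp [sum_levels, expB, expo])]
        ring
      simp only [slope, h4, vsub_eq_sub, sub_zero, smul_eq_mul, pow_one]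
      ring
    · rw [← logDer_eq, ← logDer_eq, hA z hz, hn z hz, h1 z hz, hgf z hz, formB,
        etaQuot_eq expB (m := 1) (by simp [sum_levels, expB, expo])]
      ring
  rw [h1 z hz, hCκ]

theorem etaQuot_eq_unitQ {n : ℕ → ℤ} (h : ∑ k ∈ levels, k * n k = 0) (z : ℂ) :
    etaQuot n z = unitQ n (nome z) := by
  rw [etaQuot_eq n (m := 0) (by simpa using h)]; simp

theorem formC_eq {z : ℂ} (hz : 0 < z.im) : formC z = formA z + formB z := by
  have := etaQuot_linear_relation (n := expC) (f := formD) (g := unitQ expD) (κ := 1)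
    (fun z hz => by rw [logDer_ba' hz, mul_comm]; rfl)
    (fun z hz => by rw [logDer_bc' hz, mul_comm])
    (analyticAt_unitQ expD (by simp)) (unitQ_zero _)
    (fun z _ => etaQuot_eq_unitQ (by simp [sum_levels, expD, expo]) z)
    (by simp [expA, expC, expo]) hz
  rw [formC, this, one_mul]

theorem formD_eq {z : ℂ} (hz : 0 < z.im) : formD z = formA z - 8 * formB z := by
  have := etaQuot_linear_relation (n := expD) (f := formC) (g := unitQ expC) (κ := -8)
    (fun z hz => by rw [logDer_ba' hz]; rfl)
    (fun z hz => by rw [logDer_bd' hz, mul_comm])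
    (analyticAt_unitQ expC (by simp)) (unitQ_zero _)
    (fun z _ => etaQuot_eq_unitQ (by simp [sum_levels, expC, expo]) z)
    (by simp [expA, expD, expo]) hz
  rw [formD, this]
  ring

/-- The differential equation for the logarithmic derivative of `a`. -/
theorem deriv_logDerQ_expA {z : ℂ} (hz : 0 < z.im) :
    nome z * deriv (logDerQ expA) (nome z) = logDer expA z ^ 2
      + 2 * formB z * (formA z + 4 * formB z) * (formC z * formD z) := by
  have h := defect_eq_zero hz
  simp only [defectQ, defect, ← logDer_eq] at h
  rw [logDer_ba' hz, logDer_bc' hz, logDer_bd' hz] at h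
  have hC := formC_eq hz
  have hD := formD_eq hz
  rw [hC, hD] at h ⊢
  linear_combination h

/-! ### Double Lambert series -/

/-- The exponent of the term with index `p` in a double Lambert series. -/
def lamExp (p : ℕ × ℕ) : ℕ := (p.1 + 1) * (p.2 + 1)

theorem lamExp_pos (p : ℕ × ℕ) : 0 < lamExp p := by unfold lamExp; positivity

theorem lamExp_ne_zero (p : ℕ × ℕ) : (lamExp p : ℂ) ≠ 0 := by exact_mod_cast (lamExp_pos p).ne'

/-- At most polynomial growth of the coefficients of a double Lambert series. -/
def PolyGrowth (u : ℕ × ℕ → ℂ) : Prop := ∃ (K : ℝ) (A : ℕ), ∀ p, ‖u p‖ ≤ K * (lamExp p : ℝ) ^ A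

/-- The double Lambert series with coefficients `u`. -/
noncomputable def lambert (u : ℕ × ℕ → ℂ) (q : ℂ) : ℂ := ∑' p, u p * q ^ lamExp p

theorem PolyGrowth.mul {u v : ℕ × ℕ → ℂ} (hu : PolyGrowth u) (hv : PolyGrowth v) :
    PolyGrowth fun p => u p * v p := by
  obtain ⟨K, A, h⟩ := hu
  obtain ⟨K', A', h'⟩ := hv
  refine ⟨K * K', A + A', fun p => ?_⟩
  rw [norm_mul, pow_add]
  calc ‖u p‖ * ‖v p‖ ≤ (K * (lamExp p : ℝ) ^ A) * (K' * (lamExp p : ℝ) ^ A') :=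
        mul_le_mul (h p) (h' p) (norm_nonneg _) ((norm_nonneg _).trans (h p))
    _ = _ := by ring

theorem PolyGrowth.of_bounded {u : ℕ × ℕ → ℂ} {K : ℝ} (h : ∀ p, ‖u p‖ ≤ K) : PolyGrowth u :=
  ⟨K, 0, by simpa using h⟩

theorem polyGrowth_lamExp : PolyGrowth fun p => (lamExp p : ℂ) :=
  ⟨1, 1, fun p => by simp⟩

theorem polyGrowth_snd_sq : PolyGrowth fun p => ((p.2 : ℂ) + 1) ^ 2 := by
  refine ⟨1, 2, fun p => ?_⟩
  have h : ‖(p.2 : ℂ) + 1‖ = (p.2 : ℝ) + 1 := by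
    rw [← Nat.cast_add_one, Complex.norm_natCast]; push_cast; ring
  rw [norm_pow, h, one_mul]
  have h2 : p.2 + 1 ≤ lamExp p := by unfold lamExp; nlinarith
  have h3 : (p.2 : ℝ) + 1 ≤ lamExp p := by exact_mod_cast h2
  gcongr

theorem PolyGrowth.div_lamExp {u : ℕ × ℕ → ℂ} (hu : PolyGrowth u) :
    PolyGrowth fun p => u p / lamExp p := by
  obtain ⟨K, A, h⟩ := hu
  refine ⟨K, A, fun p => le_trans ?_ (h p)⟩
  rw [norm_div, Complex.norm_natCast]
  exact div_le_self (norm_nonneg _) (by exact_mod_cast lamExp_pos p)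

/-- With s = √r, the inequality k + l ≤ 2kl gives r^(kl) ≤ s^k · s^l, so the double series is
dominated by a product of two single ones. -/
theorem summable_lamExp (A : ℕ) {r : ℝ} (h0 : 0 ≤ r) (h1 : r < 1) :
    Summable fun p => (lamExp p : ℝ) ^ A * r ^ lamExp p := by
  set s := √r with hs
  have hs0 : 0 ≤ s := Real.sqrt_nonneg _
  have hs1 : s < 1 := by
    rw [hs, Real.sqrt_lt' one_pos]; simpa using h1
  have hr : r = s ^ 2 := (Real.sq_sqrt h0).symm
  have hS : Summable fun n : ℕ => ((n : ℝ) + 1) ^ A * s ^ (n + 1) := by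
    have := (summable_nat_add_iff 1).2
      (summable_pow_mul_geometric_of_norm_lt_one A (r := s) (by rwa [Real.norm_of_nonneg hs0]))
    simpa using this
  have hP := hS.mul_of_nonneg hS (fun n => by positivity) (fun n => by positivity)
  refine Summable.of_nonneg_of_le (fun p => by positivity) (fun p => ?_) hP
  have e : (lamExp p : ℝ) ^ A = ((p.1 : ℝ) + 1) ^ A * ((p.2 : ℝ) + 1) ^ A := by
    unfold lamExp; push_cast; rw [mul_pow]
  have h2 : (p.1 + 1) + (p.2 + 1) ≤ 2 * lamExp p := by
    unfold lamExp; nlinarith [Nat.zero_le (p.1 * p.2)]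
  have h3 : r ^ lamExp p ≤ s ^ ((p.1 + 1) + (p.2 + 1)) := by
    rw [hr, ← pow_mul]
    exact pow_le_pow_of_le_one hs0 hs1.le h2
  rw [e]
  calc _ ≤ ((p.1 : ℝ) + 1) ^ A * ((p.2 : ℝ) + 1) ^ A * s ^ ((p.1 + 1) + (p.2 + 1)) := by gcongr
    _ = _ := by rw [pow_add]; ring

theorem PolyGrowth.summable_norm {u : ℕ × ℕ → ℂ} (hu : PolyGrowth u) {r : ℝ} (h0 : 0 ≤ r)
    (h1 : r < 1) : Summable fun p => ‖u p‖ * r ^ lamExp p := by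
  obtain ⟨K, A, h⟩ := hu
  refine Summable.of_nonneg_of_le (fun p => by positivity) (fun p => ?_)
    ((summable_lamExp A h0 h1).mul_left K)
  rw [← mul_assoc]
  exact mul_le_mul_of_nonneg_right (h p) (by positivity)

theorem PolyGrowth.summable {u : ℕ × ℕ → ℂ} (hu : PolyGrowth u) {q : ℂ} (hq : ‖q‖ < 1) :
    Summable fun p => u p * q ^ lamExp p := by
  refine Summable.of_norm ?_
  simpa using hu.summable_norm (norm_nonneg q) hq

theorem lambert_zero (u : ℕ × ℕ → ℂ) : lambert u 0 = 0 := by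
  simp [lambert, (lamExp_pos _).ne']

theorem PolyGrowth.exists_hasDerivAt {u : ℕ × ℕ → ℂ} (hu : PolyGrowth u) {q : ℂ} (hq : ‖q‖ < 1) :
    HasDerivAt (lambert u) (∑' p, u p * (lamExp p * q ^ (lamExp p - 1))) q := by
  obtain ⟨ρ, hρ, hρ1⟩ := exists_between hq
  have hρ0 : 0 < ρ := (norm_nonneg q).trans_lt hρ
  have hS := ((hu.mul polyGrowth_lamExp).summable_norm hρ0.le hρ1).mul_left ρ⁻¹
  refine hasDerivAt_tsum_of_isPreconnected (t := Metric.ball 0 ρ) hS Metric.isOpen_ball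
    (convex_ball _ _).isPreconnected (g := fun p q => u p * q ^ lamExp p)
    (g' := fun p q => u p * (lamExp p * q ^ (lamExp p - 1)))
    (fun p y _ => (hasDerivAt_pow _ _).const_mul _) (fun p y hy => ?_)
    (Metric.mem_ball_self hρ0) (hu.summable (by simp)) (by simpa using hρ)
  have hy' : ‖y‖ ≤ ρ := by simpa using (Metric.mem_ball.1 hy).le
  have e : ρ ^ lamExp p = ρ ^ (lamExp p - 1) * ρ := by
    rw [← pow_succ, Nat.sub_add_cancel (lamExp_pos p)]
  rw [norm_mul, norm_mul, norm_mul, norm_pow, e]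
  calc _ ≤ ‖u p‖ * (‖(lamExp p : ℂ)‖ * ρ ^ (lamExp p - 1)) := by gcongr
    _ = _ := by field_simp

theorem PolyGrowth.analyticAt {u : ℕ × ℕ → ℂ} (hu : PolyGrowth u) {q : ℂ} (hq : ‖q‖ < 1) :
    AnalyticAt ℂ (lambert u) q := by
  have : DifferentiableOn ℂ (lambert u) (Metric.ball 0 1) := fun q hq =>
    (hu.exists_hasDerivAt (by simpa using hq)).differentiableAt.differentiableWithinAt
  exact this.analyticAt (Metric.isOpen_ball.mem_nhds (by simpa using hq))

/-- `q d/dq` multiplies the coefficients of a Lambert series by the exponents. -/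
theorem PolyGrowth.mul_deriv {u : ℕ × ℕ → ℂ} (hu : PolyGrowth u) {q : ℂ} (hq : ‖q‖ < 1) :
    q * deriv (lambert u) q = lambert (fun p => u p * lamExp p) q := by
  rw [(hu.exists_hasDerivAt hq).deriv, lambert, ← tsum_mul_left]
  refine tsum_congr fun p => ?_
  have e : q ^ lamExp p = q ^ (lamExp p - 1) * q := by
    rw [← pow_succ, Nat.sub_add_cancel (lamExp_pos p)]
  rw [e]; ring

theorem PolyGrowth.deriv_zero {u : ℕ × ℕ → ℂ} (hu : PolyGrowth u) :
    deriv (lambert u) 0 = u (0, 0) := by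
  rw [(hu.exists_hasDerivAt (by simp)).deriv, tsum_eq_single (0, 0)]
  · simp [lamExp]
  · intro p hp
    have : lamExp p - 1 ≠ 0 := by
      obtain ⟨a, b⟩ := p
      unfold lamExp
      rcases Nat.eq_zero_or_pos a with rfl | ha
      · rcases Nat.eq_zero_or_pos b with rfl | hb
        · simp at hp
        · simp; omega
      · have : 2 ≤ (a + 1) * (b + 1) := by nlinarith
        simp only; omega
    simp [this]

/-- A Lambert series starting with `q ^ g` is `O(q ^ g)`. -/
theorem PolyGrowth.norm_le {u : ℕ × ℕ → ℂ} (hu : PolyGrowth u) {g : ℕ}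
    (hg : ∀ p, lamExp p < g → u p = 0) :
    ∃ C, ∀ q : ℂ, ‖q‖ ≤ 1 / 2 → ‖lambert u q‖ ≤ C * ‖q‖ ^ g := by
  have hS := hu.summable_norm (r := 1 / 2) (by norm_num) (by norm_num)
  refine ⟨2 ^ g * ∑' p, ‖u p‖ * (1 / 2) ^ lamExp p, fun q hq => ?_⟩
  have hb : ∀ p, ‖u p * q ^ lamExp p‖ ≤ (2 ^ g * ‖q‖ ^ g) * (‖u p‖ * (1 / 2) ^ lamExp p) := by
    intro p
    by_cases hp : lamExp p < g
    · simp [hg p hp]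
    obtain ⟨k, hk⟩ := Nat.exists_eq_add_of_le (not_lt.1 hp)
    rw [norm_mul, norm_pow, hk, pow_add, pow_add]
    have h1 : (2 : ℝ) ^ g * (1 / 2) ^ g = 1 := by rw [← mul_pow]; norm_num
    calc ‖u p‖ * (‖q‖ ^ g * ‖q‖ ^ k) ≤ ‖u p‖ * (‖q‖ ^ g * (1 / 2) ^ k) := by gcongr
      _ = _ := by linear_combination (-‖u p‖ * ‖q‖ ^ g * (1 / 2) ^ k) * h1
  calc ‖lambert u q‖ ≤ ∑' p, (2 ^ g * ‖q‖ ^ g) * (‖u p‖ * (1 / 2) ^ lamExp p) :=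
        tsum_of_norm_bounded (hS.mul_left _).hasSum hb
    _ = _ := by rw [tsum_mul_left]; ring

theorem PolyGrowth.isBigO {u : ℕ × ℕ → ℂ} (hu : PolyGrowth u) {g : ℕ}
    (hg : ∀ p, lamExp p < g → u p = 0) :
    (fun z => lambert u (nome (z / 6))) =O[cuspInf] decay (g / 6) := by
  obtain ⟨C, hC⟩ := hu.norm_le hg
  refine IsBigO.of_bound C ?_
  have hd : ∀ z : ℂ, ‖nome (z / 6)‖ = decay (1 / 6) z := fun z => by
    have := norm_nome_affine (1 / 6) 0 z
    push_cast at this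
    rw [← this]; congr 2; ring
  filter_upwards [(tendsto_decay (μ := 1 / 6) (by norm_num)).eventually
    (ge_mem_nhds (show (0 : ℝ) < 1 / 2 by norm_num))] with z hz
  refine (hC _ ((hd z).trans_le hz)).trans (le_of_eq ?_)
  rw [hd, Real.norm_of_nonneg (decay_pos _ _).le]
  congr 1
  unfold decay
  rw [← Real.exp_nat_mul]; congr 1; ring

theorem nome_div_six_norm {z : ℂ} (hz : 0 < z.im) : ‖nome (z / 6)‖ < 1 := by
  refine norm_nome_lt_one ?_
  have : (z / 6).im = z.im / 6 := by simp
  rw [this]; positivity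

/-! ### Lattice sums of weight three and their Fourier expansions -/

/-- The Eisenstein-type sum of weight `3` over `ℤ × ℤ` weighted by `f`. -/
noncomputable def latticeSum (f : ℤ × ℤ → ℂ) (z : ℂ) : ℂ :=
  ∑' p : ℤ × ℤ, f p / ((p.1 : ℂ) * z + p.2) ^ 3

/-- Bounded odd weights on `ℤ × ℤ` with period `6` in both arguments. -/
structure OddPeriodic (f : ℤ × ℤ → ℂ) : Prop where
  odd : ∀ p, f (-p) = -f p
  periodic : ∀ m n u v : ℤ, f (m + 6 * u, n + 6 * v) = f (m, n)
  bound : ∀ p, ‖f p‖ ≤ 1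

/-- The action of a matrix on the weights. -/
def slashWeight (f : ℤ × ℤ → ℂ) (a b c d : ℤ) (p : ℤ × ℤ) : ℂ :=
  f (p.1 * d - p.2 * c, -p.1 * b + p.2 * a)

theorem OddPeriodic.slashWeight {f : ℤ × ℤ → ℂ} (hf : OddPeriodic f) (a b c d : ℤ) :
    OddPeriodic (slashWeight f a b c d) where
  odd p := by
    unfold DelPezzo.slashWeight
    rw [← hf.odd]; congr 1; ext <;> simp <;> ring
  periodic m n u v := by
    refine (congrArg f ?_).trans (hf.periodic _ _ (u * d - v * c) (-u * b + v * a))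
    ext <;> simp <;> ring
  bound p := hf.bound _

/-- The matrix permutes the lattice ℤ × ℤ by right multiplication on row vectors; reindexing moves
its inverse onto the weight. -/
theorem latticeSum_mobius (f : ℤ × ℤ → ℂ) {a b c d : ℤ} (h : a * d - b * c = 1) {z : ℂ}
    (hz : 0 < z.im) :
    latticeSum f ((a * z + b) / (c * z + d))
      = (c * z + d) ^ 3 * latticeSum (slashWeight f a b c d) z := by
  have hj := cocycle_ne_zero h hz
  let e : ℤ × ℤ ≃ ℤ × ℤ :=
    { toFun := fun p => (p.1 * a + p.2 * c, p.1 * b + p.2 * d)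
      invFun := fun p => (p.1 * d - p.2 * c, -p.1 * b + p.2 * a)
      left_inv := fun p => by
        ext
        · simp only; linear_combination p.1 * h
        · simp only; linear_combination p.2 * h
      right_inv := fun p => by
        ext
        · simp only; linear_combination p.1 * h
        · simp only; linear_combination p.2 * h }
  unfold latticeSum
  rw [← tsum_mul_left, ← e.tsum_eq fun p => (c * z + d : ℂ) ^ 3 *
    (DelPezzo.slashWeight f a b c d p / ((p.1 : ℂ) * z + p.2) ^ 3)]
  refine tsum_congr fun p => ?_
  have e1 : DelPezzo.slashWeight f a b c d (e p) = f p := congrArg f (e.left_inv p)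
  have e2 : (p.1 : ℂ) * ((a * z + b) / (c * z + d)) + p.2
      = (((e p).1 : ℂ) * z + (e p).2) / (c * z + d) := by
    simp only [e, Equiv.coe_fn_mk]
    rw [eq_div_iff hj, add_mul, mul_assoc, div_mul_cancel₀ _ hj]
    push_cast
    ring
  have e4 : f p / ((p.1 : ℂ) * ((a * z + b) / (c * z + d)) + p.2) ^ 3
      = (c * z + d) ^ 3 * (f p / (((e p).1 : ℂ) * z + (e p).2) ^ 3) := by
    rw [e2, div_pow, div_div_eq_mul_div]
    ring
  rw [e1]
  exact e4

theorem OddPeriodic.summable {f : ℤ × ℤ → ℂ} (hf : OddPeriodic f) {z : ℂ} (hz : 0 < z.im) :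
    Summable fun p : ℤ × ℤ => f p / ((p.1 : ℂ) * z + p.2) ^ 3 := by
  have h := (summable_prod_eisSummand le_rfl ⟨z, hz⟩).norm
  refine Summable.of_norm_bounded h fun p => ?_
  rw [norm_div]
  have e : ‖EisensteinSeries.eisSummand (3 : ℕ) ![p.1, p.2] ⟨z, hz⟩‖
      = 1 / ‖((p.1 : ℂ) * z + p.2) ^ 3‖ := by
    simp only [EisensteinSeries.eisSummand, Matrix.cons_val_zero, Matrix.cons_val_one]
    rw [zpow_neg, zpow_natCast, norm_inv, one_div]
  rw [e]
  have := hf.bound p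
  gcongr

/-- The Fourier transform of a weight in its second argument. -/
noncomputable def weightHat (f : ℤ × ℤ → ℂ) (p : ℕ × ℕ) : ℂ :=
  ∑ j : Fin 6, f ((p.1 + 1 : ℕ), (j : ℕ)) * nome ((p.2 + 1) * (j : ℕ) / 6)

theorem OddPeriodic.norm_weightHat_le {f : ℤ × ℤ → ℂ} (hf : OddPeriodic f) (p : ℕ × ℕ) :
    ‖weightHat f p‖ ≤ 6 := by
  refine (norm_sum_le _ _).trans ?_
  calc _ ≤ ∑ j : Fin 6, (1 : ℝ) := by
        refine Finset.sum_le_sum fun j _ => ?_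
        rw [norm_mul, norm_nome]
        have : ((((p.2 : ℂ) + 1) * (j : ℕ) / 6)).im = 0 := by
          have : (((p.2 : ℂ) + 1) * (j : ℕ) / 6) = ((((p.2 : ℝ) + 1) * (j : ℕ) / 6 : ℝ) : ℂ) := by
            push_cast; ring
          rw [this, ofReal_im]
        rw [this]
        simpa using hf.bound _
    _ = 6 := by simp

/-- The coefficients of the Fourier expansion of `latticeSum f`. -/
noncomputable def latticeCoeff (f : ℤ × ℤ → ℂ) (p : ℕ × ℕ) : ℂ :=
  weightHat f p * ((p.2 : ℂ) + 1) ^ 2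

theorem OddPeriodic.polyGrowth {f : ℤ × ℤ → ℂ} (hf : OddPeriodic f) :
    PolyGrowth (latticeCoeff f) :=
  (PolyGrowth.of_bounded hf.norm_weightHat_le).mul polyGrowth_snd_sq

/-- The factor in front of the Fourier expansion. -/
noncomputable def latticeFactor : ℂ := 2 * ((-2 * Real.pi * I) ^ 3 / 2 / 216)

theorem latticeFactor_ne_zero : latticeFactor ≠ 0 := by
  unfold latticeFactor
  have : (Real.pi : ℂ) ≠ 0 := by exact_mod_cast Real.pi_ne_zero
  simp [this, I_ne_zero]

/-- On each residue class of n modulo 6 the weight is constant, and Lipschitz's formula for ∑ (w +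
k)⁻³ applies with w = ((m + 1)z + j)/6. The factor 216 = 6³ comes from this rescaling, and summing
over j produces the finite Fourier transform of the weight. -/
theorem OddPeriodic.tsum_row {f : ℤ × ℤ → ℂ} (hf : OddPeriodic f) {z : ℂ} (hz : 0 < z.im) (m : ℕ) :
    ∑' n : ℤ, f ((m + 1 : ℕ), n) / (((m + 1 : ℕ) : ℂ) * z + n) ^ 3
      = (-2 * Real.pi * I) ^ 3 / 2 / 216
        * ∑' l : ℕ, latticeCoeff f (m, l) * nome (z / 6) ^ lamExp (m, l) := by
  have hS : Summable fun n : ℤ => f ((m + 1 : ℕ), n) / (((m + 1 : ℕ) : ℂ) * z + n) ^ 3 := by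
    simpa using (hf.summable hz).prod_factor ((m + 1 : ℕ) : ℤ)
  have e : ∀ x : ℤ × Fin 6, (Int.divModEquiv 6).symm x = 6 * x.1 + ((x.2 : ℕ) : ℤ) := by
    intro x; simp [Int.divModEquiv]; ring
  have hT : ∀ j : Fin 6, HasSum (fun k : ℤ => f ((m + 1 : ℕ), 6 * k + ((j : ℕ) : ℤ))
      / (((m + 1 : ℕ) : ℂ) * z + ((6 * k + ((j : ℕ) : ℤ) : ℤ) : ℂ)) ^ 3)
      ((-2 * Real.pi * I) ^ 3 / 2 / 216 * (f ((m + 1 : ℕ), ((j : ℕ) : ℤ)) * ∑' l : ℕ,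
        ((l : ℂ) + 1) ^ 2 * (nome ((l + 1) * (j : ℕ) / 6) * nome (z / 6) ^ lamExp (m, l)))) := by
    intro j
    have hS' := ((Int.divModEquiv 6).symm.summable_iff.2 hS).comp_injective
      (i := fun k : ℤ => ((k, j) : ℤ × Fin 6)) (fun _ _ h => by simpa using h)
    simp only [Function.comp_def, e] at hS'
    refine hS'.hasSum_iff.2 ?_
    have hw : 0 < ((((m + 1 : ℕ) : ℂ) * z + (j : ℕ)) / 6).im := by
      have : ((((m + 1 : ℕ) : ℂ) * z + (j : ℕ)) / 6).im = ((m + 1 : ℕ) : ℝ) * z.im / 6 := by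
        simp
      rw [this]; positivity
    have hq := EisensteinSeries.qExpansion_identity_pnat (k := 2) (by norm_num) ⟨_, hw⟩
    rw [tsum_pnat_eq_tsum_succ (f := fun n : ℕ => (n : ℂ) ^ 2 * cexp (2 * Real.pi * I *
      ((⟨_, hw⟩ : UpperHalfPlane) : ℂ)) ^ n)] at hq
    simp only at hq
    have e1 : ∀ k : ℤ, f ((m + 1 : ℕ), 6 * k + ((j : ℕ) : ℤ))
      / (((m + 1 : ℕ) : ℂ) * z + ((6 * k + ((j : ℕ) : ℤ) : ℤ) : ℂ)) ^ 3
      = f ((m + 1 : ℕ), ((j : ℕ) : ℤ)) / 216 *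
        (1 / ((((m + 1 : ℕ) : ℂ) * z + (j : ℕ)) / 6 + k) ^ (2 + 1)) := by
      intro k
      have h1 : f ((m + 1 : ℕ), 6 * k + ((j : ℕ) : ℤ)) = f ((m + 1 : ℕ), ((j : ℕ) : ℤ)) := by
        rw [← hf.periodic (m + 1 : ℕ) ((j : ℕ) : ℤ) 0 k]; congr 2; ring
      have h2 : ((((m + 1 : ℕ) : ℂ) * z + (j : ℕ)) / 6 + k)
        = (((m + 1 : ℕ) : ℂ) * z + ((6 * k + ((j : ℕ) : ℤ) : ℤ) : ℂ)) / 6 := by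
        push_cast; ring
      rw [h1, h2, div_pow, one_div_div]
      norm_num
      ring
    rw [tsum_congr e1, tsum_mul_left, hq]
    have e2 : ∀ l : ℕ, ((l + 1 : ℕ) : ℂ) ^ 2 * cexp (2 * Real.pi * I *
        ((((m + 1 : ℕ) : ℂ) * z + (j : ℕ)) / 6)) ^ (l + 1)
        = ((l : ℂ) + 1) ^ 2 * (nome ((l + 1) * (j : ℕ) / 6) * nome (z / 6) ^ lamExp (m, l)) := by
      intro l
      rw [← nome_nat_mul, ← nome_add]
      congr 1
      · push_cast; ring
      · unfold nome lamExp
        rw [← Complex.exp_nat_mul]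
        congr 1; push_cast; ring
    rw [tsum_congr e2]
    norm_num [Nat.factorial]
    ring
  have hfib := hasSum_sum (s := (Finset.univ : Finset (Fin 6))) fun j _ => hT j
  have h1 : ∑' n : ℤ, f ((m + 1 : ℕ), n) / (((m + 1 : ℕ) : ℂ) * z + n) ^ 3
      = ∑' k : ℤ, ∑ j : Fin 6, f ((m + 1 : ℕ), 6 * k + ((j : ℕ) : ℤ))
      / (((m + 1 : ℕ) : ℂ) * z + ((6 * k + ((j : ℕ) : ℤ) : ℤ) : ℂ)) ^ 3 := by
    rw [← (Int.divModEquiv 6).symm.tsum_eq]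
    refine ((Int.divModEquiv 6).symm.summable_iff.2 hS).tsum_prod.trans ?_
    refine tsum_congr fun k => ?_
    rw [tsum_fintype]
    simp only [Function.comp_def, e]
  rw [h1, hfib.tsum_eq, ← Finset.mul_sum]
  congr 1
  have hsum : ∀ j : Fin 6, Summable fun l : ℕ =>
      ((l : ℂ) + 1) ^ 2 * (nome ((l + 1) * (j : ℕ) / 6) * nome (z / 6) ^ lamExp (m, l)) := by
    intro j
    have := (polyGrowth_snd_sq.summable_norm (norm_nonneg _) (nome_div_six_norm hz)).prod_factor m
    refine Summable.of_norm_bounded this fun l => ?_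
    rw [norm_mul, norm_mul, norm_pow (nome (z / 6))]
    have : ‖nome (((l : ℂ) + 1) * (j : ℕ) / 6)‖ = 1 := by
      rw [norm_nome, show (((l : ℂ) + 1) * (j : ℕ) / 6)
        = ((((l : ℝ) + 1) * (j : ℕ) / 6 : ℝ) : ℂ) by push_cast; ring, ofReal_im]
      simp
    rw [this, one_mul]
  rw [← (hasSum_sum fun j _ => (hsum j).hasSum.mul_left
    (f ((m + 1 : ℕ), ((j : ℕ) : ℤ)))).tsum_eq]
  refine tsum_congr fun l => ?_
  unfold latticeCoeff weightHat
  rw [Finset.sum_mul, Finset.sum_mul]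
  refine Finset.sum_congr rfl fun j _ => ?_
  ring

/-- The Fourier expansion of `latticeSum f`. -/
theorem OddPeriodic.latticeSum_eq {f : ℤ × ℤ → ℂ} (hf : OddPeriodic f) {z : ℂ} (hz : 0 < z.im) :
    latticeSum f z = ∑' n : ℤ, f (0, n) / (n : ℂ) ^ 3
      + latticeFactor * lambert (latticeCoeff f) (nome (z / 6)) := by
  have hS := hf.summable hz
  unfold latticeSum
  rw [hS.tsum_prod, tsum_int_eq_zero_add_two_mul_tsum_pnat]
  · congr 1
    · simp
    · have h1 := tsum_pnat_eq_tsum_succ (f := fun m : ℕ => ∑' n : ℤ, (f ((m : ℤ), n)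
        / (((m : ℤ) : ℂ) * z + (n : ℂ)) ^ 3 : ℂ))
      refine (congrArg (fun x : ℂ => 2 • x) h1).trans ?_
      have hl := hf.polyGrowth.summable (nome_div_six_norm hz)
      unfold lambert latticeFactor
      rw [hl.tsum_prod, mul_assoc, ← tsum_mul_left, nsmul_eq_mul, Nat.cast_ofNat]
      congr 2
      funext m
      rw [← hf.tsum_row hz m]
      simp
  · intro m
    simp only
    -- Both the weight and the cube are odd, so the rows m and -m contribute equally.
    rw [← tsum_comp_neg (fun n : ℤ => f (-m, n) / (((-m : ℤ) : ℂ) * z + n) ^ 3)]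
    refine tsum_congr fun n => ?_
    have h1 : f (-m, -n) = - f (m, n) := hf.odd (m, n)
    rw [h1]
    have h2 : ((-m : ℤ) : ℂ) * z + ((-n : ℤ) : ℂ) = -((m : ℂ) * z + n) := by push_cast; ring
    rw [h2, Odd.neg_pow (by decide), neg_div_neg_eq]
  · exact hS.prod

/-! ### The product a c d as an Eisenstein series -/

/-- The nontrivial Dirichlet character modulo `6`. -/
def chiSix (n : ℤ) : ℤ := if n % 6 = 1 then 1 else if n % 6 = 5 then -1 else 0

/-- The weight of the Eisenstein series of weight `3` on `Γ₁(6)`. -/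
def baseWeight (p : ℤ × ℤ) : ℂ := if p.1 % 6 = 0 then (chiSix p.2 : ℂ) else 0

/-- The odd function of period `6` with values `0, 1, 1, 0, -1, -1`. -/
def psi (l : ℕ) : ℤ :=
  if l % 6 = 1 ∨ l % 6 = 2 then 1 else if l % 6 = 4 ∨ l % 6 = 5 then -1 else 0

theorem abs_psi_le (l : ℕ) : |psi l| ≤ 1 := by
  unfold psi; split_ifs <;> simp

theorem chiSix_add (n v : ℤ) : chiSix (n + 6 * v) = chiSix n := by
  unfold chiSix
  rw [Int.add_mul_emod_self_left]

theorem chiSix_neg (n : ℤ) : chiSix (-n) = -chiSix n := by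
  unfold chiSix
  split_ifs <;> omega

theorem oddPeriodic_baseWeight : OddPeriodic baseWeight where
  odd p := by
    unfold baseWeight
    have : (-p).1 % 6 = 0 ↔ p.1 % 6 = 0 := by rw [Prod.fst_neg]; omega
    simp only [this, Prod.snd_neg, chiSix_neg]
    split_ifs <;> simp
  periodic m n u v := by
    unfold baseWeight
    simp only [chiSix_add, Int.add_mul_emod_self_left]
  bound p := by
    unfold baseWeight chiSix
    split_ifs <;> simp

theorem chiSix_ne_zero {n : ℤ} (h : chiSix n ≠ 0) : IsCoprime n 6 := by
  have : n % 6 = 1 ∨ n % 6 = 5 := by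
    unfold chiSix at h
    split_ifs at h <;> simp_all
  rcases this with h | h
  · exact ⟨1, -(n / 6), by omega⟩
  · exact ⟨-1, n / 6 + 1, by omega⟩

/-- For a cusp of denominator prime to `6`, divisible by `2`, `3`, or `6`, the transformed weight
is supported on first arguments divisible by `gcd (6, c)`. -/
theorem gcd_dvd_of_slashWeight_ne_zero {a b c d : ℤ} (h : a * d - b * c = 1) {p : ℤ × ℤ}
    (hp : slashWeight baseWeight a b c d p ≠ 0) : ((Int.gcd 6 c : ℕ) : ℤ) ∣ p.1 := by
  have h1 : (p.1 * d - p.2 * c) % 6 = 0 := by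
    by_contra hne
    simp [slashWeight, baseWeight, hne] at hp
  have hg6 : ((Int.gcd 6 c : ℕ) : ℤ) ∣ 6 := Int.gcd_dvd_left _ _
  have hgc : ((Int.gcd 6 c : ℕ) : ℤ) ∣ c := Int.gcd_dvd_right _ _
  have h2 : ((Int.gcd 6 c : ℕ) : ℤ) ∣ p.1 * d - p.2 * c := hg6.trans (Int.dvd_of_emod_eq_zero h1)
  have h3 : ((Int.gcd 6 c : ℕ) : ℤ) ∣ p.1 * d := by
    have := dvd_add h2 (hgc.mul_left p.2)
    simpa using this
  have h4 : p.1 = a * (p.1 * d) - p.1 * b * c := by linear_combination -p.1 * h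
  rw [h4]
  exact dvd_sub (h3.mul_left _) (hgc.mul_left _)

/-- A nonzero value would need 6 ∣ nc with n prime to 6, hence 6 ∣ c. So the Eisenstein series has
no constant term at cusps not equivalent to i∞; the convergence of Q at these cusps rests on this.
-/
theorem slashWeight_zero {a b c d : ℤ} (hc : ¬ (6 : ℤ) ∣ c) (n : ℤ) :
    slashWeight baseWeight a b c d (0, n) = 0 := by
  by_contra hp
  have h1 : (0 * d - n * c) % 6 = 0 := by
    by_contra hne
    exact hp (if_neg hne)
  have h2 : IsCoprime (-0 * b + n * a) 6 := by
    apply chiSix_ne_zero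
    intro h0
    simp only [slashWeight, baseWeight, h0] at hp
    simp at hp
  have h3 : IsCoprime n 6 := by
    rw [neg_zero, zero_mul, zero_add] at h2
    exact h2.of_mul_left_left
  have h4 : (6 : ℤ) ∣ n * c := by
    have := Int.dvd_of_emod_eq_zero h1
    rw [zero_mul, zero_sub, dvd_neg] at this
    exact this
  exact hc (h3.symm.dvd_of_dvd_mul_left h4)

/-- The diagonal invariance of the weight under `Γ(6)` up to sign. -/
theorem slashWeight_of_dvd {a b c d : ℤ} (h : a * d - b * c = 1) (hc : (6 : ℤ) ∣ c)
    (hb : (6 : ℤ) ∣ b) : ∃ ε : ℂ, ε ^ 24 = 1 ∧ ∀ p, slashWeight baseWeight a b c d p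
      = ε * baseWeight p := by
  obtain ⟨c, rfl⟩ := hc
  obtain ⟨b, rfl⟩ := hb
  have had : (a * d) % 6 = 1 := by
    have : a * d = 1 + 6 * (6 * b * c) := by linear_combination h
    rw [this]; omega
  have ha : (a % 6 = 1 ∧ d % 6 = 1) ∨ (a % 6 = 5 ∧ d % 6 = 5) := by
    have h1 := Int.emod_nonneg a (by norm_num : (6 : ℤ) ≠ 0)
    have h2 := Int.emod_lt_of_pos a (by norm_num : (0 : ℤ) < 6)
    have h3 := Int.emod_nonneg d (by norm_num : (6 : ℤ) ≠ 0)
    have h4 := Int.emod_lt_of_pos d (by norm_num : (0 : ℤ) < 6)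
    rw [Int.mul_emod] at had
    generalize a % 6 = x at *
    generalize d % 6 = y at *
    interval_cases x <;> interval_cases y <;> simp_all
  have e1 : ∀ p : ℤ × ℤ, slashWeight baseWeight a (6 * b) (6 * c) d p
      = baseWeight (p.1 * d, p.2 * a) := by
    intro p
    rw [← oddPeriodic_baseWeight.periodic _ _ (-p.2 * c) (-p.1 * b)]
    unfold slashWeight
    congr 1; ext <;> simp <;> ring
  rcases ha with ⟨ha, hd⟩ | ⟨ha, hd⟩
  · obtain ⟨s, rfl⟩ : ∃ s, a = 1 + 6 * s := ⟨a / 6, by omega⟩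
    obtain ⟨t, rfl⟩ : ∃ t, d = 1 + 6 * t := ⟨d / 6, by omega⟩
    refine ⟨1, by simp, fun p => ?_⟩
    rw [e1, one_mul, ← oddPeriodic_baseWeight.periodic p.1 p.2 (p.1 * t) (p.2 * s)]
    congr 1; ext <;> simp <;> ring
  · obtain ⟨s, rfl⟩ : ∃ s, a = -1 + 6 * s := ⟨a / 6 + 1, by omega⟩
    obtain ⟨t, rfl⟩ : ∃ t, d = -1 + 6 * t := ⟨d / 6 + 1, by omega⟩
    refine ⟨-1, by norm_num, fun p => ?_⟩
    rw [e1, neg_one_mul, ← oddPeriodic_baseWeight.odd,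
      ← oddPeriodic_baseWeight.periodic (-p).1 (-p).2 (p.1 * t) (p.2 * s)]
    congr 1; ext <;> simp <;> ring

theorem OddPeriodic.differentiableOn {f : ℤ × ℤ → ℂ} (hf : OddPeriodic f) :
    DifferentiableOn ℂ (latticeSum f) {z | 0 < z.im} := by
  intro z hz
  refine (DifferentiableAt.congr_of_eventuallyEq (f := fun z => ∑' n : ℤ, f (0, n) / (n : ℂ) ^ 3
      + latticeFactor * lambert (latticeCoeff f) (nome (z / 6))) ?_ ?_).differentiableWithinAt
  · refine (DifferentiableAt.const_mul ?_ _).const_add _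
    refine DifferentiableAt.comp (g := lambert (latticeCoeff f)) z
      (hf.polyGrowth.analyticAt (nome_div_six_norm hz)).differentiableAt ?_
    exact DifferentiableAt.comp (g := nome) z (hasDerivAt_nome _).differentiableAt (by fun_prop)
  · filter_upwards [upper_mem_nhds hz] with w hw using hf.latticeSum_eq hw

theorem exists_nome_eq {q : ℂ} (h0 : q ≠ 0) (h1 : ‖q‖ < 1) : ∃ z : ℂ, 0 < z.im ∧ nome z = q := by
  have hpi := Real.pi_pos
  have hpi' : (2 * Real.pi * I : ℂ) ≠ 0 := by simp [Real.pi_ne_zero]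
  have e : nome (Complex.log q / (2 * Real.pi * I)) = q := by
    rw [nome, mul_div_cancel₀ _ hpi', Complex.exp_log h0]
  refine ⟨_, ?_, e⟩
  rw [← e, norm_nome, Real.exp_lt_one_iff] at h1
  nlinarith

theorem hasDerivAt_unitQ_zero (n : ℕ → ℤ) : HasDerivAt (unitQ n) (-n 1) 0 := by
  have h : ∀ k ∈ levels, HasDerivAt (fun q : ℂ => euler (q ^ k) ^ n k)
      (-n k * (k * (0 : ℂ) ^ (k - 1))) 0 := by
    intro k hk
    have h1 : HasDerivAt euler (-1) ((0 : ℂ) ^ k) := by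
      rw [zero_pow (levels_pos hk).ne']; exact hasDerivAt_euler_zero
    have h2 := h1.comp (0 : ℂ) (hasDerivAt_pow k (0 : ℂ))
    have h3 : euler ((0 : ℂ) ^ k) = 1 := by rw [zero_pow (levels_pos hk).ne', euler_zero]
    have h4 := (hasDerivAt_zpow (n k) (euler ((0 : ℂ) ^ k)) (Or.inl (by rw [h3]; simp))).comp
      (0 : ℂ) h2
    refine h4.congr_deriv ?_
    rw [h3, one_zpow]; ring
  have h2 := HasDerivAt.fun_finsetProd h
  refine h2.congr_deriv ?_
  have h3 : ∀ k ∈ levels, euler ((0 : ℂ) ^ k) = 1 := fun k hk => by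
    rw [zero_pow (levels_pos hk).ne', euler_zero]
  have h4 : ∀ i ∈ levels, ∏ j ∈ levels.erase i, euler ((0 : ℂ) ^ j) ^ n j = 1 := fun i _ =>
    Finset.prod_eq_one fun j hj => by rw [h3 j (Finset.mem_of_mem_erase hj), one_zpow]
  rw [Finset.sum_congr rfl fun i hi => by rw [h4 i hi, one_smul], sum_levels]
  norm_num

/-- The exponents of `a c d`. -/
def expE : ℕ → ℤ := expA + expC + expD

/-- At a cusp with g = gcd(6, c) < 6 the product acd vanishes to order g/6, and the Fourier series
of the lattice sum starts no earlier, since the transformed weight lives on first arguments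
divisible by g. At i∞ boundedness suffices. -/
theorem exists_latticeSum_eq_etaQuot :
    ∃ C, ∀ z : ℂ, 0 < z.im → latticeSum baseWeight z = C * etaQuot expE z := by
  refine eq_const_mul_etaQuot (w := 3) (by simp [sum_levels, expE, expA, expC, expD, expo])
    oddPeriodic_baseWeight.differentiableOn (fun a b c d h hc hb z hz => ?_) fun a b c d h => ?_
  · obtain ⟨ε, h1, hε⟩ := slashWeight_of_dvd h hc hb
    have : latticeSum (slashWeight baseWeight a b c d) z = ε * latticeSum baseWeight z := by
      unfold latticeSum
      rw [← tsum_mul_left]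
      exact tsum_congr fun p => by rw [hε, mul_div_assoc]
    rw [latticeSum_mobius _ h hz, this, mul_left_comm, mul_pow ε, h1, one_mul]
  · refine ⟨_, fun z hz => latticeSum_mobius _ h hz, ?_⟩
    have hf := oddPeriodic_baseWeight.slashWeight a b c d
    set f := slashWeight baseWeight a b c d with hfdef
    have hO : (fun z => lambert (latticeCoeff f) (nome (z / 6)))
        =O[cuspInf] decay ((Int.gcd 6 c : ℕ) / 6) := by
      refine hf.polyGrowth.isBigO fun p hp => ?_
      unfold latticeCoeff weightHat
      rw [Finset.sum_eq_zero, zero_mul]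
      intro j _
      by_contra hne
      have := gcd_dvd_of_slashWeight_ne_zero h (left_ne_zero_of_mul hne)
      have h2 := Nat.le_of_dvd (Nat.succ_pos _) (Int.natCast_dvd_natCast.1 this)
      have h3 : p.1 + 1 ≤ lamExp p := Nat.le_mul_of_pos_right _ (Nat.succ_pos _)
      omega
    have key : latticeSum f =ᶠ[cuspInf] fun z => ∑' n : ℤ, f (0, n) / (n : ℂ) ^ 3
        + latticeFactor * lambert (latticeCoeff f) (nome (z / 6)) := by
      filter_upwards [eventually_cuspInf_pos] with z hz using hf.latticeSum_eq hz
    refine IsBigO.congr' ?_ key.symm EventuallyEq.rfl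
    have h6 : Int.gcd 6 c ≠ 6 → ¬ (6 : ℤ) ∣ c := fun h1 h2 => h1 (by exact_mod_cast Int.gcd_eq_left (by norm_num) h2)
    have h0 : Int.gcd 6 c ≠ 6 → ∑' n : ℤ, f (0, n) / (n : ℂ) ^ 3 = 0 := fun h1 => by
      have : ∀ n : ℤ, f (0, n) / (n : ℂ) ^ 3 = 0 := fun n => by
        rw [hfdef, slashWeight_zero (h6 h1), zero_div]
      simp [this]
    rcases cuspScale_table c with h | h | h | h
    · have e : 1 / 24 * ∑ k ∈ levels, (expE k : ℝ) * cuspScale k c = ((Int.gcd 6 c : ℕ) : ℝ) / 6 := by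
        simp [sum_levels, h, expE, expA, expC, expD, expo]; norm_num
      rw [e, h0 (by omega)]
      simpa using hO.const_mul_left latticeFactor
    · have e : 1 / 24 * ∑ k ∈ levels, (expE k : ℝ) * cuspScale k c = ((Int.gcd 6 c : ℕ) : ℝ) / 6 := by
        simp [sum_levels, h, expE, expA, expC, expD, expo]; norm_num
      rw [e, h0 (by omega)]
      simpa using hO.const_mul_left latticeFactor
    · have e : 1 / 24 * ∑ k ∈ levels, (expE k : ℝ) * cuspScale k c = ((Int.gcd 6 c : ℕ) : ℝ) / 6 := by
        simp [sum_levels, h, expE, expA, expC, expD, expo]; norm_num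
      rw [e, h0 (by omega)]
      simpa using hO.const_mul_left latticeFactor
    · have e : 1 / 24 * ∑ k ∈ levels, (expE k : ℝ) * cuspScale k c = 0 := by
        simp [sum_levels, h, expE, expA, expC, expD, expo]; norm_num
      rw [e, decay_zero]
      refine (isBigO_const_const _ one_ne_zero _).add (IsBigO.const_mul_left ?_ _)
      refine hO.trans ?_
      refine decay_isBigO_one ?_
      positivity

/-- The primitive sixth root of unity. -/
noncomputable def zetaSix : ℂ := nome (1 / 6)

theorem zetaSix_sq : zetaSix ^ 2 = zetaSix - 1 := by
  have h3 : zetaSix ^ 3 = -1 := by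
    rw [zetaSix, ← nome_nat_mul, nome, ← exp_pi_mul_I]; congr 1; push_cast; ring
  have hne : zetaSix + 1 ≠ 0 := by
    intro h0
    have h1 : zetaSix = -1 := by linear_combination h0
    have h2 : zetaSix ^ 2 = 1 := by rw [h1]; norm_num
    have h4 : nome (1 / 3) = 1 := by
      have e : nome (1 / 3) = zetaSix ^ 2 := by
        rw [zetaSix, ← nome_nat_mul]; congr 1; push_cast; ring
      rw [e, h2]
    rw [nome, Complex.exp_eq_one_iff] at h4
    obtain ⟨n, hn⟩ := h4
    have h5 : (1 / 3 : ℂ) = n := by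
      have : (2 * Real.pi * I : ℂ) ≠ 0 := by simp [Real.pi_ne_zero]
      apply mul_left_cancel₀ this; linear_combination hn
    have h6 : (1 : ℂ) = ((3 * n : ℤ) : ℂ) := by push_cast; linear_combination 3 * h5
    have h7 : (1 : ℤ) = 3 * n := by exact_mod_cast h6
    omega
  have : (zetaSix + 1) * (zetaSix ^ 2 - zetaSix + 1) = 0 := by linear_combination h3
  rcases mul_eq_zero.1 this with h | h
  · exact absurd h hne
  · linear_combination h

theorem zetaSix_pow_mod (l : ℕ) : zetaSix ^ l = zetaSix ^ (l % 6) := by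
  have h6 : zetaSix ^ 6 = 1 := by
    rw [zetaSix, ← nome_nat_mul]; convert nome_int 1 using 2; norm_num
  conv_lhs => rw [← Nat.div_add_mod l 6, pow_add, pow_mul, h6, one_pow, one_mul]

/-- This is 2i sin(πl/3) = i√3 · ψ(l): up to the factor 2ζ - 1 = i√3, the function ψ is the Fourier
transform of the odd character modulo 6. -/
theorem zetaSix_pow_sub (l : ℕ) :
    zetaSix ^ l - zetaSix ^ (5 * l) = (2 * zetaSix - 1) * psi l := by
  have h := zetaSix_sq
  rw [zetaSix_pow_mod l, zetaSix_pow_mod (5 * l), Nat.mul_mod]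
  unfold psi
  have hl : l % 6 < 6 := Nat.mod_lt _ (by norm_num)
  have h3 : zetaSix ^ 3 = -1 := by linear_combination (zetaSix + 1) * h
  have h4 : zetaSix ^ 4 = -zetaSix := by linear_combination zetaSix * h3
  have h5 : zetaSix ^ 5 = 1 - zetaSix := by linear_combination zetaSix ^ 2 * h3 - h
  interval_cases l % 6 <;> norm_num [h, h3, h4, h5] <;> ring

/-- The coefficients of the Fourier expansion of `a c d`. -/
def psiCoeff (p : ℕ × ℕ) : ℂ := psi (p.2 + 1) * ((p.2 : ℂ) + 1) ^ 2

theorem norm_psi_le (l : ℕ) : ‖(psi l : ℂ)‖ ≤ 1 := by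
  rw [Complex.norm_intCast]; exact_mod_cast abs_psi_le l

theorem polyGrowth_psiCoeff : PolyGrowth psiCoeff :=
  (PolyGrowth.of_bounded fun p => norm_psi_le (p.2 + 1)).mul polyGrowth_snd_sq

theorem weightHat_baseWeight (p : ℕ × ℕ) : weightHat baseWeight p =
    if 6 ∣ p.1 + 1 then (2 * zetaSix - 1) * psi (p.2 + 1) else 0 := by
  unfold weightHat
  split_ifs with h
  · have h1 : ((p.1 + 1 : ℕ) : ℤ) % 6 = 0 := by omega
    have hn : ∀ j : ℕ, nome ((p.2 + 1) * (j : ℕ) / 6) = zetaSix ^ (j * (p.2 + 1)) := by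
      intro j
      rw [zetaSix, ← nome_nat_mul]; congr 1; push_cast; ring
    rw [← zetaSix_pow_sub]
    simp only [Fin.sum_univ_six, baseWeight, h1, if_true, hn, chiSix]
    norm_num
    ring
  · refine Finset.sum_eq_zero fun j _ => ?_
    have h1 : ¬ ((p.1 + 1 : ℕ) : ℤ) % 6 = 0 := by omega
    simp only [baseWeight, h1, if_false, zero_mul]

/-- Only first indices divisible by 6 contribute, and for these the powers of q^(1/6) are powers of
q. -/
theorem lambert_baseWeight (z : ℂ) : lambert (latticeCoeff baseWeight) (nome (z / 6))
    = (2 * zetaSix - 1) * lambert psiCoeff (nome z) := by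
  unfold lambert
  rw [← tsum_mul_left]
  have hinj : Function.Injective fun p : ℕ × ℕ => ((6 * p.1 + 5, p.2) : ℕ × ℕ) := by
    rintro ⟨a, b⟩ ⟨c, d⟩ h
    simp only [Prod.mk.injEq] at h
    ext <;> simp <;> omega
  rw [← hinj.tsum_eq (f := fun p => latticeCoeff baseWeight p * nome (z / 6) ^ lamExp p)]
  · refine tsum_congr fun p => ?_
    have h1 : 6 ∣ 6 * p.1 + 5 + 1 := by omega
    simp only [latticeCoeff, weightHat_baseWeight, h1, if_true, psiCoeff]
    have h2 : nome z = nome (z / 6) ^ 6 := by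
      rw [← nome_nat_mul]; congr 1; push_cast; ring
    have h3 : lamExp (6 * p.1 + 5, p.2) = 6 * lamExp p := by unfold lamExp; ring
    rw [h2, ← pow_mul, h3]
    ring
  · intro p hp
    have : 6 ∣ p.1 + 1 := by
      by_contra hne
      simp [latticeCoeff, weightHat_baseWeight, hne] at hp
    exact ⟨((p.1 + 1) / 6 - 1, p.2), by ext <;> simp; omega⟩

theorem etaQuot_expE {z : ℂ} (hz : 0 < z.im) :
    etaQuot expE z = formA z * formC z * formD z := by
  rw [expE, etaQuot_add _ _ hz, etaQuot_add _ _ hz]; rfl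

/-- The Eisenstein series of weight `3` on `Γ₁(6)` whose primitive is `log Q`. -/
noncomputable def formE (z : ℂ) : ℂ := formA z * formC z * formD z

/-- Comparing the coefficients of q⁰ and q¹ with acd = 1 - q + O(q²) expresses both C and the factor
of the Lambert series through each other. The L-value in the constant term thus never has to be
evaluated, and C ≠ 0 follows from the explicit nonzero factor. -/
theorem exists_latticeSum_baseWeight : ∃ C : ℂ, C ≠ 0 ∧ ∀ z : ℂ, 0 < z.im →
    latticeSum baseWeight z = C * formE z ∧ formE z = 1 - lambert psiCoeff (nome z) := by
  obtain ⟨C, hC⟩ := exists_latticeSum_eq_etaQuot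
  set L := ∑' n : ℤ, baseWeight (0, n) / (n : ℂ) ^ 3 with hL
  set κ := latticeFactor * (2 * zetaSix - 1) with hκ
  have hκ0 : κ ≠ 0 := by
    refine mul_ne_zero latticeFactor_ne_zero fun h0 => ?_
    have h1 : zetaSix = 1 / 2 := by linear_combination h0 / 2
    have := zetaSix_sq
    rw [h1] at this
    norm_num at this
  have hm : ∑ k ∈ levels, k * expE k = 24 * (0 : ℕ) := by
    simp [sum_levels, expE, expA, expC, expD, expo]
  have key : ∀ z : ℂ, 0 < z.im → L + κ * lambert psiCoeff (nome z) = C * unitQ expE (nome z) := by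
    intro z hz
    have h1 := hC z hz
    rw [oddPeriodic_baseWeight.latticeSum_eq hz, lambert_baseWeight, etaQuot_eq expE hm] at h1
    rw [pow_zero, one_mul] at h1
    rw [← h1, ← hL, hκ]; ring
  have hlam : AnalyticAt ℂ (lambert psiCoeff) 0 := polyGrowth_psiCoeff.analyticAt (by simp)
  have hu : AnalyticAt ℂ (unitQ expE) 0 := analyticAt_unitQ _ (by simp)
  have h1 : C = L := by
    refine const_eq_of_nome (f := fun q => L + κ * lambert psiCoeff q) (u := unitQ expE) (m := 0)
      hu.continuousAt (unitQ_zero _) ?_ fun z hz => by rw [key z hz, pow_zero, one_mul]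
    simp only [pow_zero, div_one]
    have : ContinuousAt (fun q => L + κ * lambert psiCoeff q) 0 :=
      (continuousAt_const.mul hlam.continuousAt).const_add _
    have h2 := this.tendsto
    rw [lambert_zero, mul_zero, add_zero] at h2
    exact h2.mono_left nhdsWithin_le_nhds
  have hd : HasDerivAt (unitQ expE) (-1) 0 := by
    simpa [expE, expA, expC, expD, expo] using hasDerivAt_unitQ_zero expE
  have h2 : κ = -C := by
    have hd2 := (((polyGrowth_psiCoeff.exists_hasDerivAt (q := 0) (by simp)).differentiableAt
      |>.hasDerivAt).const_mul κ).const_add L |>.sub (hd.const_mul C)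
    rw [polyGrowth_psiCoeff.deriv_zero] at hd2
    have h3 := hd2.unique ((hasDerivAt_const (0 : ℂ) (0 : ℂ)).congr_of_eventuallyEq ?_)
    · simp only [psiCoeff, psi] at h3
      norm_num at h3
      linear_combination h3
    · filter_upwards [Metric.ball_mem_nhds (0 : ℂ) one_pos] with q hq
      rcases eq_or_ne q 0 with rfl | hq0
      · simp [lambert_zero, h1]
      · obtain ⟨z, hz, rfl⟩ := exists_nome_eq hq0 (by simpa using hq)
        simp [key z hz]
  refine ⟨C, ?_, fun z hz => ⟨by rw [hC z hz, etaQuot_expE hz, formE], ?_⟩⟩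
  · rintro rfl
    exact hκ0 (by simp [h2])
  · have h3 := key z hz
    have hC0 : C ≠ 0 := by rintro rfl; exact hκ0 (by simp [h2])
    rw [formE, ← etaQuot_expE hz, etaQuot_eq expE hm, pow_zero, one_mul]
    apply mul_left_cancel₀ hC0
    rw [← h3, h2, h1]; ring

theorem formE_eq {z : ℂ} (hz : 0 < z.im) : formE z = 1 - lambert psiCoeff (nome z) := by
  obtain ⟨C, -, h⟩ := exists_latticeSum_baseWeight
  exact (h z hz).2

/-- The expansion of `formE` at a cusp not equivalent to `i∞`. -/
theorem exists_formE_mobius {a b c d : ℤ} (h : a * d - b * c = 1) (hc : ¬ (6 : ℤ) ∣ c) :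
    ∃ u, PolyGrowth u ∧ ∀ z : ℂ, 0 < z.im →
      formE ((a * z + b) / (c * z + d)) = (c * z + d) ^ 3 * lambert u (nome (z / 6)) := by
  obtain ⟨C, hC, hE⟩ := exists_latticeSum_baseWeight
  have hf := oddPeriodic_baseWeight.slashWeight a b c d
  refine ⟨fun p => (latticeFactor / C) * latticeCoeff (slashWeight baseWeight a b c d) p,
    (PolyGrowth.of_bounded (u := fun _ => latticeFactor / C) fun _ => le_rfl).mul hf.polyGrowth,
    fun z hz => ?_⟩
  have h0 : ∑' n : ℤ, slashWeight baseWeight a b c d (0, n) / (n : ℂ) ^ 3 = 0 := by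
    have : ∀ n : ℤ, slashWeight baseWeight a b c d (0, n) / (n : ℂ) ^ 3 = 0 := fun n => by
      rw [slashWeight_zero hc, zero_div]
    simp [this]
  have h1 := (hE _ (im_mobius_pos h hz)).1
  rw [latticeSum_mobius _ h hz, hf.latticeSum_eq hz, h0, zero_add] at h1
  have h2 : lambert (fun p => (latticeFactor / C) * latticeCoeff (slashWeight baseWeight a b c d) p)
      (nome (z / 6)) = latticeFactor / C *
        lambert (latticeCoeff (slashWeight baseWeight a b c d)) (nome (z / 6)) := by
    unfold lambert
    rw [← tsum_mul_left]
    exact tsum_congr fun p => by ring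
  rw [h2]
  apply mul_left_cancel₀ hC
  rw [← h1]
  field_simp

/-! ### Power series with coefficients of geometric growth -/

/-- The sum of the power series with coefficients `a`. -/
noncomputable def powSum (a : ℕ → ℂ) (x : ℂ) : ℂ := ∑' m, a m * x ^ m

/-- Coefficients bounded by a polynomial times `R ^ m`. -/
def GeomGrowth (R : ℝ) (a : ℕ → ℂ) : Prop :=
  ∃ (C : ℝ) (A : ℕ), ∀ m : ℕ, ‖a m‖ ≤ C * ((m : ℝ) ^ A * R ^ m) + if m = 0 then ‖a 0‖ else 0

theorem GeomGrowth.natCast_mul {R : ℝ} {a : ℕ → ℂ} (ha : GeomGrowth R a) :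
    GeomGrowth R fun m => m * a m := by
  obtain ⟨C, A, h⟩ := ha
  refine ⟨C, A + 1, fun m => ?_⟩
  rcases Nat.eq_zero_or_pos m with rfl | hm
  · simp
  · have := h m
    rw [if_neg hm.ne', add_zero] at this ⊢
    rw [norm_mul, Complex.norm_natCast, pow_succ]
    calc (m : ℝ) * ‖a m‖ ≤ m * (C * ((m : ℝ) ^ A * R ^ m)) := by gcongr
      _ = _ := by ring

theorem GeomGrowth.summable_norm {R : ℝ} {a : ℕ → ℂ} (ha : GeomGrowth R a) (hR : 0 ≤ R) {r : ℝ}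
    (hr : 0 ≤ r) (h : R * r < 1) : Summable fun m => ‖a m‖ * r ^ m := by
  obtain ⟨C, A, hb⟩ := ha
  have h1 := (summable_pow_mul_geometric_of_norm_lt_one A (r := R * r)
    (by rwa [Real.norm_of_nonneg (by positivity)])).mul_left C
  have h2 : Summable fun m : ℕ => if m = 0 then ‖a 0‖ else 0 :=
    summable_of_ne_finset_zero (s := {0}) fun m hm => by simp at hm; simp [hm]
  refine Summable.of_nonneg_of_le (fun m => by positivity) (fun m => ?_) (h1.add h2)
  rcases Nat.eq_zero_or_pos m with rfl | hm
  · simpa using hb 0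
  · have := hb m
    rw [if_neg hm.ne', add_zero] at this ⊢
    rw [mul_pow]
    calc ‖a m‖ * r ^ m ≤ (C * ((m : ℝ) ^ A * R ^ m)) * r ^ m := by gcongr
      _ = _ := by ring

theorem GeomGrowth.summable {R : ℝ} {a : ℕ → ℂ} (ha : GeomGrowth R a) (hR : 0 ≤ R) {x : ℂ}
    (h : R * ‖x‖ < 1) : Summable fun m => a m * x ^ m :=
  Summable.of_norm (by simpa using ha.summable_norm hR (norm_nonneg x) h)

theorem powSum_zero (a : ℕ → ℂ) : powSum a 0 = a 0 := by
  rw [powSum, tsum_eq_single 0]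
  · simp
  · intro m hm; simp [hm]

theorem GeomGrowth.exists_hasDerivAt {R : ℝ} {a : ℕ → ℂ} (ha : GeomGrowth R a) (hR : 0 < R) {x : ℂ}
    (h : R * ‖x‖ < 1) : ∃ D, HasDerivAt (powSum a) D x ∧ x * D = powSum (fun m => m * a m) x := by
  have hx : ‖x‖ < 1 / R := by rw [lt_div_iff₀ hR]; linarith
  obtain ⟨ρ, hρ, hρ1⟩ := exists_between hx
  have hρ0 : 0 < ρ := (norm_nonneg x).trans_lt hρ
  have hρR : R * ρ < 1 := by rw [lt_div_iff₀ hR] at hρ1; linarith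
  have hS := (ha.natCast_mul.summable_norm hR.le hρ0.le hρR).mul_left ρ⁻¹
  refine ⟨∑' m, a m * (m * x ^ (m - 1)), hasDerivAt_tsum_of_isPreconnected
    (t := Metric.ball 0 ρ) hS Metric.isOpen_ball
    (convex_ball _ _).isPreconnected (g := fun m x => a m * x ^ m)
    (g' := fun m x => a m * (m * x ^ (m - 1)))
    (fun p y _ => (hasDerivAt_pow _ _).const_mul _) (fun m y hy => ?_)
    (Metric.mem_ball_self hρ0) (ha.summable hR.le (by simp)) (by simpa using hρ), ?_⟩
  · have hy' : ‖y‖ ≤ ρ := by simpa using (Metric.mem_ball.1 hy).le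
    rcases Nat.eq_zero_or_pos m with rfl | hm
    · simp
    · have e : ρ ^ m = ρ ^ (m - 1) * ρ := by rw [← pow_succ, Nat.sub_add_cancel hm]
      rw [norm_mul, norm_mul, norm_mul, norm_pow, e]
      calc _ ≤ ‖a m‖ * (‖(m : ℂ)‖ * ρ ^ (m - 1)) := by gcongr
        _ = _ := by field_simp
  · rw [powSum, ← tsum_mul_left]
    refine tsum_congr fun m => ?_
    rcases Nat.eq_zero_or_pos m with rfl | hm
    · simp
    · have e : x ^ m = x ^ (m - 1) * x := by rw [← pow_succ, Nat.sub_add_cancel hm]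
      rw [e]; ring

theorem GeomGrowth.powSum_eq {R : ℝ} {a : ℕ → ℂ} (ha : GeomGrowth R a) (hR : 0 ≤ R) {x : ℂ}
    (h : R * ‖x‖ < 1) : powSum a x = a 0 + x * powSum (fun m => a (m + 1)) x := by
  rw [powSum, (ha.summable hR h).tsum_eq_zero_add, powSum, ← tsum_mul_left]
  simp only [pow_zero, mul_one]
  congr 1
  exact tsum_congr fun m => by ring

/-! ### The holomorphic solution of the Picard–Fuchs equation -/

/-- The coefficients `f_m` as complex numbers. -/
noncomputable def fC (d : Smoothing) (m : ℕ) : ℂ := (fCoeff d m : ℂ)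

/-- The recursion has |κ| + |λ| ≤ 13 and |μ| ≤ 9, and 13 · 14 + 9 = 191 ≤ 14². This is the source of
the radius 1/14 used below. -/
theorem abs_fCoeff_le (d : Smoothing) (m : ℕ) : |fCoeff d m| ≤ 14 ^ m := by
  have hκ : |kappa d| ≤ 10 := by cases d <;> norm_num [kappa]
  have hl : |lam d| ≤ 3 := by cases d <;> norm_num [lam]
  have hμ : |mu d| ≤ 9 := by cases d <;> norm_num [mu]
  have : |fCoeff d m| ≤ 14 ^ m ∧ |fCoeff d (m + 1)| ≤ 14 ^ (m + 1) := by
    induction m with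
    | zero =>
      refine ⟨by simp [fCoeff], ?_⟩
      simp only [fCoeff, abs_neg]; norm_num; linarith
    | succ m ih =>
      refine ⟨ih.2, ?_⟩
      have hm : (0 : ℚ) ≤ m := Nat.cast_nonneg m
      rw [fCoeff, abs_div, abs_of_pos (by positivity : (0 : ℚ) < ((m : ℚ) + 2) ^ 2),
        div_le_iff₀ (by positivity)]
      have h1 : |-(kappa d * (((m : ℚ) + 1) ^ 2 + (m + 1)) + lam d)| ≤ 13 * ((m : ℚ) + 2) ^ 2 := by
        rw [abs_neg]
        refine (abs_add_le _ _).trans ?_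
        rw [abs_mul, abs_of_nonneg (by positivity : (0 : ℚ) ≤ ((m : ℚ) + 1) ^ 2 + (m + 1))]
        have := mul_le_mul_of_nonneg_right hκ
          (by positivity : (0 : ℚ) ≤ ((m : ℚ) + 1) ^ 2 + (m + 1))
        nlinarith
      have h2 : |mu d * ((m : ℚ) + 1) ^ 2| ≤ 9 * ((m : ℚ) + 2) ^ 2 := by
        rw [abs_mul, abs_of_nonneg (by positivity : (0 : ℚ) ≤ ((m : ℚ) + 1) ^ 2)]
        have := mul_le_mul_of_nonneg_right hμ (by positivity : (0 : ℚ) ≤ ((m : ℚ) + 1) ^ 2)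
        nlinarith
      calc _ ≤ |-(kappa d * (((m : ℚ) + 1) ^ 2 + (m + 1)) + lam d)| * |fCoeff d (m + 1)|
            + |mu d * ((m : ℚ) + 1) ^ 2| * |fCoeff d m| := by
            rw [← abs_mul, ← abs_mul]; exact abs_add_le _ _
        _ ≤ (13 * ((m : ℚ) + 2) ^ 2) * 14 ^ (m + 1) + (9 * ((m : ℚ) + 2) ^ 2) * 14 ^ m := by
            gcongr
            · exact ih.2
            · exact ih.1
        _ = 191 * (((m : ℚ) + 2) ^ 2 * 14 ^ m) := by ring
        _ ≤ 196 * (((m : ℚ) + 2) ^ 2 * 14 ^ m) := by gcongr; norm_num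
        _ = _ := by ring
  exact this.1

theorem norm_fC_le (d : Smoothing) (m : ℕ) : ‖fC d m‖ ≤ 14 ^ m := by
  rw [fC, Complex.norm_ratCast]
  exact_mod_cast abs_fCoeff_le d m

theorem geomGrowth_fC (d : Smoothing) : GeomGrowth 14 (fC d) := by
  refine ⟨1, 0, fun m => ?_⟩
  have := norm_fC_le d m
  split_ifs <;> [skip; simpa using this]
  have := norm_nonneg (fC d 0)
  simp only [pow_zero, one_mul]
  linarith [norm_fC_le d m]

/-- The solution `f`. -/
noncomputable def solF (d : Smoothing) : ℂ → ℂ := powSum (fC d)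

/-- The derivative `θ f`. -/
noncomputable def solF1 (d : Smoothing) : ℂ → ℂ := powSum fun m => m * fC d m

/-- The derivative `θ² f`. -/
noncomputable def solF2 (d : Smoothing) : ℂ → ℂ := powSum fun m => m * (m * fC d m)

theorem fC_rec (d : Smoothing) (m : ℕ) : ((m : ℂ) + 2) ^ 2 * fC d (m + 2)
    + ((kappa d : ℂ) * (((m : ℂ) + 1) ^ 2 + (m + 1)) + lam d) * fC d (m + 1)
    - mu d * ((m : ℂ) + 1) ^ 2 * fC d m = 0 := by
  have h : ((m : ℚ) + 2) ^ 2 ≠ 0 := by positivity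
  have : ((m : ℚ) + 2) ^ 2 * fCoeff d (m + 2)
    + (kappa d * (((m : ℚ) + 1) ^ 2 + (m + 1)) + lam d) * fCoeff d (m + 1)
    - mu d * ((m : ℚ) + 1) ^ 2 * fCoeff d m = 0 := by
    rw [fCoeff]; field_simp; ring
  simp only [fC]
  exact_mod_cast this

/-- The coefficient recursion summed against powers of x; terms are peeled off because the recursion
connects three consecutive coefficients. -/
theorem solF_ode (d : Smoothing) {x : ℂ} (hx : 14 * ‖x‖ < 1) :
    (1 + kappa d * x - mu d * x ^ 2) * solF2 d x + (kappa d * x - 2 * mu d * x ^ 2) * solF1 d x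
      + (lam d * x - mu d * x ^ 2) * solF d x = 0 := by
  have h0 := geomGrowth_fC d
  have h1 := h0.natCast_mul
  have h2 := h1.natCast_mul
  have hR : (0 : ℝ) ≤ 14 := by norm_num
  have e0 := h0.powSum_eq hR hx
  have e1 := h1.powSum_eq hR hx
  have e2 := h2.powSum_eq hR hx
  have hs : ∀ {a : ℕ → ℂ}, (Summable fun m => a m * x ^ m) →
      x ≠ 0 → Summable fun m => a (m + 1) * x ^ m := by
    intro a ha hx0
    have := ((summable_nat_add_iff 1).2 ha).mul_left x⁻¹
    refine this.congr fun m => ?_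
    field_simp
    ring
  rcases eq_or_ne x 0 with rfl | hx0
  · simp [solF2, powSum_zero]
  have s0 := h0.summable hR hx
  have s1 := h1.summable hR hx
  have s2 := h2.summable hR hx
  have t0 := hs s0 hx0
  have t1 := hs s1 hx0
  have t2 := hs s2 hx0
  have u2 := hs t2 hx0
  have e3 : powSum (fun m => ((m + 1 : ℕ) : ℂ) * (((m + 1 : ℕ) : ℂ) * fC d (m + 1))) x
      = fC d 1 + x * powSum (fun m => ((m + 2 : ℕ) : ℂ) * (((m + 2 : ℕ) : ℂ) * fC d (m + 2))) x := by
    rw [powSum, t2.tsum_eq_zero_add, powSum, ← tsum_mul_left]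
    congr 1
    · simp
    · exact tsum_congr fun m => by ring
  have key : powSum (fun m => ((m + 2 : ℕ) : ℂ) * (((m + 2 : ℕ) : ℂ) * fC d (m + 2))) x
      + kappa d * (powSum (fun m => ((m + 1 : ℕ) : ℂ) * (((m + 1 : ℕ) : ℂ) * fC d (m + 1))) x
        + powSum (fun m => ((m + 1 : ℕ) : ℂ) * fC d (m + 1)) x)
      + lam d * powSum (fun m => fC d (m + 1)) x
      - mu d * (solF2 d x + 2 * solF1 d x + solF d x) = 0 := by
    have hT := ((u2.hasSum.add ((t2.hasSum.add t1.hasSum).mul_left (kappa d : ℂ))).add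
      (t0.hasSum.mul_left (lam d : ℂ))).sub
      (((s2.hasSum.add (s1.hasSum.mul_left 2)).add s0.hasSum).mul_left (mu d : ℂ))
    refine (hT.unique ?_)
    convert hasSum_zero using 1
    funext m
    have := fC_rec d m
    push_cast
    linear_combination x ^ m * this
  have f1 : fC d 1 = -lam d * fC d 0 := by simp [fC, fCoeff]
  simp only [solF2, solF1, solF] at key ⊢
  rw [e3] at e2
  simp only [Nat.cast_zero, zero_mul, zero_add] at e1 e2
  linear_combination e2 + x ^ 2 * key + x * f1 + kappa d * x * (e2 - x * e3 + e1) + lam d * x * e0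

theorem eq_of_hasDerivAt_zero_of_tendsto {f : ℂ → ℂ} {M : ℝ} {L : ℂ}
    (h : ∀ z : ℂ, M < z.im → HasDerivAt f 0 z) (hL : Tendsto f cuspInf (𝓝 L)) {z : ℂ}
    (hz : M < z.im) : f z = L := by
  have ho : IsOpen {z : ℂ | M < z.im} := isOpen_lt continuous_const continuous_im
  have hc : ∀ w : ℂ, M < w.im → f w = f z := fun w hw =>
    ho.is_const_of_deriv_eq_zero (convex_halfSpace_im_gt M).isPreconnected
      (fun w hw => (h w hw).differentiableAt.differentiableWithinAt) (fun w hw => (h w hw).deriv)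
      hw hz
  refine tendsto_nhds_unique ?_ hL
  refine tendsto_const_nhds.congr' ?_
  filter_upwards [eventually_cuspInf (M + 1)] with w hw
  exact (hc w (by linarith)).symm

theorem hasDerivAt_powSum_comp {a : ℕ → ℂ} (ha : GeomGrowth 14 a) {P : ℂ → ℂ} {z w : ℂ}
    (hP : HasDerivAt P (2 * Real.pi * I * (w * P z)) z) (hz : 14 * ‖P z‖ < 1) :
    HasDerivAt (fun z => powSum a (P z))
      (2 * Real.pi * I * (w * powSum (fun m => m * a m) (P z))) z := by
  obtain ⟨D, hD, hx⟩ := ha.exists_hasDerivAt (by norm_num) hz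
  refine (hD.comp z hP).congr_deriv ?_
  rw [← hx]; ring

/-- A function `f` on the upper half plane that satisfies the Picard–Fuchs equation in terms of a
mirror coordinate `P` with `D log P = W` is the pullback of the holomorphic solution. -/
theorem solF_comp_eq (d : Smoothing) {f e W P : ℂ → ℂ} {M : ℝ}
    (hf : ∀ z : ℂ, M < z.im → HasDerivAt f (2 * Real.pi * I * (e z * f z)) z)
    (hP : ∀ z : ℂ, M < z.im → HasDerivAt P (2 * Real.pi * I * (W z * P z)) z)
    (he : ∀ z : ℂ, M < z.im → HasDerivAt e (2 * Real.pi * I *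
      (e z ^ 2 - W z * (lam d * P z - mu d * P z ^ 2) * f z ^ 2)) z)
    (hW : ∀ z : ℂ, M < z.im → (1 + kappa d * P z - mu d * P z ^ 2) * f z ^ 2 = W z)
    (hf0 : ∀ z : ℂ, M < z.im → f z ≠ 0)
    (hsmall : ∀ z : ℂ, M < z.im → 14 * ‖P z‖ < 1)
    (tf : Tendsto f cuspInf (𝓝 1)) (te : Tendsto e cuspInf (𝓝 0)) (tP : Tendsto P cuspInf (𝓝 0))
    {z : ℂ} (hz : M < z.im) : solF d (P z) = f z := by
  have h0 := geomGrowth_fC d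
  have h1 := h0.natCast_mul
  have hc : ∀ a : ℕ → ℂ, GeomGrowth 14 a → Tendsto (fun z => powSum a (P z)) cuspInf (𝓝 (a 0)) := by
    intro a ha
    obtain ⟨D, hD, -⟩ := ha.exists_hasDerivAt (x := 0) (by norm_num) (by simp)
    have := hD.continuousAt.tendsto
    rw [powSum_zero] at this
    exact this.comp tP
  have dF : ∀ z : ℂ, M < z.im → HasDerivAt (fun z => solF d (P z))
      (2 * Real.pi * I * (W z * solF1 d (P z))) z := fun z hz =>
    hasDerivAt_powSum_comp h0 (hP z hz) (hsmall z hz)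
  have dF1 : ∀ z : ℂ, M < z.im → HasDerivAt (fun z => solF1 d (P z))
      (2 * Real.pi * I * (W z * solF2 d (P z))) z := fun z hz =>
    hasDerivAt_powSum_comp h1 (hP z hz) (hsmall z hz)
  -- With p = 1 + κP - μP² the operator is θ(pθ) plus a term of order zero, so p times the Wronskian
  -- of f and the power series solution is constant. By `hW`, pθf = e/f. The constant is zero
  -- because both terms tend to 0 at i∞.
  have wr : ∀ z : ℂ, M < z.im → f z * ((1 + kappa d * P z - mu d * P z ^ 2) * solF1 d (P z))
      - solF d (P z) * (e z / f z) = 0 := by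
    intro z hz
    refine eq_of_hasDerivAt_zero_of_tendsto (M := M) (f := fun z => f z *
      ((1 + kappa d * P z - mu d * P z ^ 2) * solF1 d (P z)) - solF d (P z) * (e z / f z))
      (fun z hz => ?_) ?_ hz
    · have hp : HasDerivAt (fun z => 1 + kappa d * P z - mu d * P z ^ 2)
          (kappa d * (2 * Real.pi * I * (W z * P z)) - mu d * (2 * P z *
            (2 * Real.pi * I * (W z * P z)))) z := by
        refine ((((hP z hz).const_mul (kappa d : ℂ)).const_add 1).fun_sub
          (((hP z hz).fun_pow 2).const_mul (mu d : ℂ))).congr_deriv ?_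
        norm_num
      refine (((hf z hz).fun_mul (hp.fun_mul (dF1 z hz))).fun_sub
        ((dF z hz).fun_mul ((he z hz).fun_div (hf z hz) (hf0 z hz)))).congr_deriv ?_
      have ho := solF_ode d (hsmall z hz)
      have hw := hW z hz
      have := hf0 z hz
      field_simp
      rw [← hw]
      linear_combination (2 * Real.pi * I * (1 + kappa d * P z - mu d * P z ^ 2) * f z ^ 3 * f z) * ho
    · have := (tf.mul ((((tP.const_mul (kappa d : ℂ)).const_add 1).sub
        ((tP.pow 2).const_mul (mu d : ℂ))).mul (hc _ h1))).sub ((hc _ h0).mul (te.div tf one_ne_zero))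
      simpa [solF, solF1] using this
  -- Vanishing of the Wronskian makes the ratio constant, and both functions tend to 1.
  have hq : solF d (P z) / f z = 1 := by
    refine eq_of_hasDerivAt_zero_of_tendsto (M := M) (f := fun z => solF d (P z) / f z)
      (fun z hz => ?_) ?_ hz
    · refine ((dF z hz).fun_div (hf z hz) (hf0 z hz)).congr_deriv ?_
      have hw := hW z hz
      have h := wr z hz
      have hf' := hf0 z hz
      field_simp at h ⊢
      rw [← hw]
      linear_combination 2 * Real.pi * I * h
    · have : Tendsto (fun z => solF d (P z) / f z) cuspInf (𝓝 (fC d 0 / 1)) :=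
        (hc _ h0).div tf one_ne_zero
      simpa [fC, fCoeff] using this
  have := hf0 z hz
  field_simp at hq
  exact hq

/-! ### The modular parametrisation of the mirror coordinate -/

/-- The exponents of the modular form of weight one that solves the Picard–Fuchs equation. -/
def expF : Smoothing → ℕ → ℤ
  | .sixI => expA
  | .sixII => expC

/-- The exponents of `D log P`. -/
def expW : Smoothing → ℕ → ℤ
  | .sixI => expC + expD
  | .sixII => expA + expD

/-- The mirror coordinate as a function on the upper half plane. -/
noncomputable def mirror (d : Smoothing) (z : ℂ) : ℂ := -etaQuot (expB - expF d) z

theorem mirror_ne_zero (d : Smoothing) {z : ℂ} (hz : 0 < z.im) : mirror d z ≠ 0 :=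
  neg_ne_zero.2 (etaQuot_ne_zero _ hz)

theorem logDer_mirror (d : Smoothing) {z : ℂ} (hz : 0 < z.im) :
    logDer (expB - expF d) z = etaQuot (expW d) z := by
  cases d
  · exact logDer_ba hz
  · exact logDer_bc hz

theorem hasDerivAt_mirror (d : Smoothing) {z : ℂ} (hz : 0 < z.im) :
    HasDerivAt (mirror d) (2 * Real.pi * I * (etaQuot (expW d) z * mirror d z)) z := by
  refine (hasDerivAt_etaQuot (expB - expF d) hz).neg.congr_deriv ?_
  rw [logDer_mirror d hz, mirror]; ring

theorem mirror_eq_nome (d : Smoothing) (z : ℂ) :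
    mirror d z = -(nome z * unitQ (expB - expF d) (nome z)) := by
  rw [mirror, etaQuot_eq _ (m := 1), pow_one]
  cases d <;> simp [sum_levels, expF, expA, expB, expC, expo]

theorem hauptmodul_eq (d : Smoothing) (τ : UpperHalfPlane) : hauptmodul d τ = mirror d τ := by
  have h1 := eta_ne_zero' τ.2
  have h2 := eta_ne_zero' (im_natCast_mul (k := 2) (by norm_num) τ.2)
  have h3 := eta_ne_zero' (im_natCast_mul (k := 3) (by norm_num) τ.2)
  have h6 := eta_ne_zero' (im_natCast_mul (k := 6) (by norm_num) τ.2)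
  cases d
  · rw [hauptmodul, mirror, etaQuot, prod_levels]
    simp [expF, expA, expB, expo]
    norm_cast
    field_simp
  · rw [hauptmodul, mirror, etaQuot, prod_levels]
    simp [expF, expC, expB, expo]
    norm_cast
    field_simp

theorem tendsto_unitQ (n : ℕ → ℤ) : Tendsto (fun z => unitQ n (nome z)) cuspInf (𝓝 1) := by
  have := (analyticAt_unitQ n (q := 0) (by simp)).continuousAt.tendsto
  rw [unitQ_zero] at this
  exact this.comp tendsto_nome

theorem tendsto_mirror (d : Smoothing) : Tendsto (mirror d) cuspInf (𝓝 0) := by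
  rw [funext (mirror_eq_nome d)]
  simpa using (tendsto_nome.mul (tendsto_unitQ (expB - expF d))).neg

theorem tendsto_mirror_div (d : Smoothing) :
    Tendsto (fun z => mirror d z / nome z) cuspInf (𝓝 (-1)) := by
  refine (tendsto_unitQ (expB - expF d)).neg.congr fun z => ?_
  have := nome_ne_zero z
  rw [mirror_eq_nome]; field_simp

theorem tendsto_etaQuot_expF (d : Smoothing) : Tendsto (etaQuot (expF d)) cuspInf (𝓝 1) := by
  refine (tendsto_unitQ (expF d)).congr fun z => (etaQuot_eq_unitQ ?_ z).symm
  cases d <;> simp [sum_levels, expF, expA, expC, expo]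

theorem tendsto_logDer_expF (d : Smoothing) : Tendsto (logDer (expF d)) cuspInf (𝓝 0) := by
  have h := (analyticAt_logDerQ (expF d) (q := 0) (by simp)).continuousAt.tendsto
  have h0 : logDerQ (expF d) 0 = 0 := by
    rw [logDerQ_zero]
    cases d <;> simp [sum_levels, expF, expA, expC, expo] <;> norm_num
  rw [h0] at h
  rw [funext (logDer_eq (expF d))]
  exact h.comp tendsto_nome

theorem mirror_sixI {z : ℂ} (hz : 0 < z.im) : mirror .sixI z = -(formB z / formA z) := by
  rw [mirror, expF, etaQuot_sub _ _ hz]; rfl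

theorem mirror_sixII {z : ℂ} (hz : 0 < z.im) : mirror .sixII z = -(formB z / formC z) := by
  rw [mirror, expF, etaQuot_sub _ _ hz]; rfl

theorem etaQuot_expW_sixI {z : ℂ} (hz : 0 < z.im) : etaQuot (expW .sixI) z = formC z * formD z := by
  rw [expW, etaQuot_add _ _ hz]; rfl

theorem etaQuot_expW_sixII {z : ℂ} (hz : 0 < z.im) : etaQuot (expW .sixII) z = formA z * formD z := by
  rw [expW, etaQuot_add _ _ hz]; rfl

/-- The leading coefficient factors: 1 + 7P - 8P² = (1 - P)(1 + 8P) becomes (a + b)(a - 8b)/a² for P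
= -b/a, and 1 + 10P + 9P² = (1 + P)(1 + 9P) becomes (c - b)(c - 9b)/c² for P = -b/c. The linear
relations turn these into cd/a² and ad/c². -/
theorem quadratic_mirror (d : Smoothing) {z : ℂ} (hz : 0 < z.im) :
    (1 + kappa d * mirror d z - mu d * mirror d z ^ 2) * etaQuot (expF d) z ^ 2
      = etaQuot (expW d) z := by
  have hA := formA_ne_zero hz
  have hC := formC_ne_zero hz
  have eC := formC_eq hz
  have eD := formD_eq hz
  cases d
  · rw [mirror_sixI hz, etaQuot_expW_sixI hz, expF, show etaQuot expA z = formA z from rfl, eC, eD]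
    simp only [kappa, mu]
    push_cast
    field_simp
    ring
  · rw [mirror_sixII hz, etaQuot_expW_sixII hz, expF, show etaQuot expC z = formC z from rfl]
    have eA : formA z = formC z - formB z := by rw [eC]; ring
    rw [eA] at eD
    rw [eD, eA]
    simp only [kappa, mu]
    push_cast
    field_simp
    ring

/-- In case 6I this is the weight four identity for D log a. Case 6II reduces to it by D log c = D
log a + bd, the difference of the formulas for D log(b/a) and D log(b/c). -/
theorem hasDerivAt_logDer_expF (d : Smoothing) {z : ℂ} (hz : 0 < z.im) :
    HasDerivAt (logDer (expF d)) (2 * Real.pi * I * (logDer (expF d) z ^ 2 - etaQuot (expW d) z *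
      (lam d * mirror d z - mu d * mirror d z ^ 2) * etaQuot (expF d) z ^ 2)) z := by
  have hA := formA_ne_zero hz
  have hC := formC_ne_zero hz
  have eC := formC_eq hz
  have eD := formD_eq hz
  have d1 := hasDerivAt_logDer expA hz
  rw [deriv_logDerQ_expA hz] at d1
  cases d
  · rw [mirror_sixI hz, etaQuot_expW_sixI hz, expF, show etaQuot expA z = formA z from rfl]
    refine d1.congr_deriv ?_
    simp only [lam, mu]
    push_cast
    field_simp
    ring
  · rw [mirror_sixII hz, etaQuot_expW_sixII hz, expF, show etaQuot expC z = formC z from rfl]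
    have h1 := logDer_ba' hz
    have h2 := logDer_bc' hz
    have h3 := logDer_bd' hz
    have hfun : logDer expC =ᶠ[𝓝 z] fun z => logDer expA z + formB z * formD z := by
      filter_upwards [upper_mem_nhds hz] with w hw
      have h1 := logDer_ba' hw
      have h2 := logDer_bc' hw
      rw [logDer_sub] at h1 h2
      linear_combination h1 - h2 + formD w * formC_eq hw
    have e1 := hfun.eq_of_nhds
    rw [logDer_sub] at h1 h2 h3
    have dB : HasDerivAt formB _ z := hasDerivAt_etaQuot expB hz
    have dD : HasDerivAt formD _ z := hasDerivAt_etaQuot expD hz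
    refine (HasDerivAt.congr_of_eventuallyEq (d1.add (dB.mul dD)) hfun).congr_deriv ?_
    rw [show etaQuot expB z = formB z from rfl, show etaQuot expD z = formD z from rfl, e1]
    simp only [lam, mu]
    push_cast
    have e2 : logDer expB z = logDer expA z + formC z * formD z := by linear_combination h1
    have e3 : logDer expD z = logDer expA z + formC z * formD z - formA z * formC z := by
      linear_combination h1 - h3
    rw [e2, e3]
    have eA : formA z = formC z - formB z := by rw [eC]; ring
    field_simp
    rw [eD, eA]
    ring

/-! ### The quantum variable on the upper half plane -/

/-- The continuation of `Q` to the upper half plane, up to its factor `-q`. -/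
noncomputable def potential (z : ℂ) : ℂ := lambert (fun p => psiCoeff p / lamExp p) (nome z)

/-- The quantum variable as a function on the upper half plane. -/
noncomputable def quantum (z : ℂ) : ℂ := -nome z * cexp (-potential z)

theorem hasDerivAt_lambert_nome {u : ℕ × ℕ → ℂ} (hu : PolyGrowth u) {z : ℂ} (hz : 0 < z.im) :
    HasDerivAt (fun z => lambert u (nome z))
      (2 * Real.pi * I * lambert (fun p => u p * lamExp p) (nome z)) z := by
  have h := ((hu.analyticAt (norm_nome_lt_one hz)).differentiableAt.hasDerivAt).comp z
    (hasDerivAt_nome z)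
  refine h.congr_deriv ?_
  rw [← hu.mul_deriv (norm_nome_lt_one hz)]; ring

theorem hasDerivAt_potential {z : ℂ} (hz : 0 < z.im) :
    HasDerivAt potential (2 * Real.pi * I * (1 - formE z)) z := by
  refine (hasDerivAt_lambert_nome polyGrowth_psiCoeff.div_lamExp hz).congr_deriv ?_
  rw [formE_eq hz]
  congr 1
  rw [sub_sub_cancel]
  congr 1
  funext p
  exact div_mul_cancel₀ _ (lamExp_ne_zero p)

theorem quantum_ne_zero (z : ℂ) : quantum z ≠ 0 :=
  mul_ne_zero (neg_ne_zero.2 (nome_ne_zero z)) (exp_ne_zero _)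

theorem hasDerivAt_quantum {z : ℂ} (hz : 0 < z.im) :
    HasDerivAt quantum (2 * Real.pi * I * (formE z * quantum z)) z := by
  refine ((hasDerivAt_nome z).neg.mul (hasDerivAt_potential hz).neg.cexp).congr_deriv ?_
  simp only [quantum, Pi.neg_apply]
  ring

/-- The coefficients of `g`. -/
noncomputable def gC (d : Smoothing) (m : ℕ) : ℂ := if m = 0 then 0 else fC d m / m

theorem geomGrowth_gC (d : Smoothing) : GeomGrowth 14 (gC d) := by
  refine ⟨1, 0, fun m => ?_⟩
  rcases Nat.eq_zero_or_pos m with rfl | hm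
  · simp
  · rw [if_neg hm.ne', gC, if_neg hm.ne', norm_div, Complex.norm_natCast]
    simp only [pow_zero, one_mul, add_zero]
    exact (div_le_self (norm_nonneg _) (by exact_mod_cast hm)).trans (norm_fC_le d m)

theorem g_eq_powSum (d : Smoothing) {x : ℂ} (hx : 14 * ‖x‖ < 1) : g d x = powSum (gC d) x := by
  rw [(geomGrowth_gC d).powSum_eq (by norm_num) hx, gC, if_pos rfl, zero_add, powSum,
    ← tsum_mul_left, g]
  refine tsum_congr fun m => ?_
  rw [gC, if_neg (Nat.succ_ne_zero m), fC]
  push_cast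
  ring

theorem powSum_theta_gC (d : Smoothing) {x : ℂ} (hx : 14 * ‖x‖ < 1) :
    powSum (fun m => m * gC d m) x = solF d x - 1 := by
  have h1 := (geomGrowth_gC d).natCast_mul.powSum_eq (by norm_num) hx
  have h2 := (geomGrowth_fC d).powSum_eq (by norm_num) hx
  have h3 : (fun m => ((m + 1 : ℕ) : ℂ) * gC d (m + 1)) = fun m => fC d (m + 1) := by
    funext m
    rw [gC, if_neg (Nat.succ_ne_zero m), mul_div_cancel₀]
    exact_mod_cast Nat.succ_ne_zero m
  have h4 : fC d 0 = 1 := by simp [fC, fCoeff]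
  rw [h3] at h1
  rw [solF, h1, h2, h4]
  simp

theorem etaQuot_expW_mul (d : Smoothing) {z : ℂ} (hz : 0 < z.im) :
    etaQuot (expW d) z * etaQuot (expF d) z = formE z := by
  cases d
  · rw [etaQuot_expW_sixI hz, expF, show etaQuot expA z = formA z from rfl, formE]; ring
  · rw [etaQuot_expW_sixII hz, expF, show etaQuot expC z = formC z from rfl, formE]; ring

/-- Near i∞ the logarithmic derivative of P exp g(P) is (1 + θg) · D log P = f · D log P = acd, the
same as that of `quantum`. The ratio is therefore constant, and it tends to 1 because P/q → -1. -/
theorem exists_quantum_eq (d : Smoothing) : ∃ M : ℝ, 0 ≤ M ∧ ∀ z : ℂ, M < z.im →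
    14 * ‖mirror d z‖ < 1 ∧ Q d (mirror d z) = quantum z := by
  have hev : ∀ᶠ z in cuspInf, 14 * ‖mirror d z‖ < 1 := by
    have h1 := ((tendsto_mirror d).norm.const_mul 14)
    rw [norm_zero, mul_zero] at h1
    exact h1.eventually (gt_mem_nhds one_pos)
  obtain ⟨s, hs, hs'⟩ := mem_comap.1 hev
  obtain ⟨M₀, hM₀⟩ := mem_atTop_sets.1 hs
  have hsm : ∀ z : ℂ, max 0 M₀ < z.im → 14 * ‖mirror d z‖ < 1 := fun z hz =>
    hs' (hM₀ _ ((le_max_right _ _).trans hz.le))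
  have hpos : ∀ z : ℂ, max 0 M₀ < z.im → 0 < z.im := fun z hz => (le_max_left _ _).trans_lt hz
  refine ⟨max 0 M₀, le_max_left _ _, fun z hz => ⟨hsm z hz, ?_⟩⟩
  have hF : ∀ z : ℂ, max 0 M₀ < z.im → solF d (mirror d z) = etaQuot (expF d) z := fun z hz =>
    solF_comp_eq d (f := etaQuot (expF d)) (e := logDer (expF d)) (W := etaQuot (expW d))
      (P := mirror d) (M := max 0 M₀)
      (fun z hz => (hasDerivAt_etaQuot (expF d) (hpos z hz)).congr_deriv (by ring))
      (fun z hz => hasDerivAt_mirror d (hpos z hz))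
      (fun z hz => hasDerivAt_logDer_expF d (hpos z hz))
      (fun z hz => quadratic_mirror d (hpos z hz))
      (fun z hz => etaQuot_ne_zero _ (hpos z hz)) hsm
      (tendsto_etaQuot_expF d) (tendsto_logDer_expF d) (tendsto_mirror d) hz
  have hg := geomGrowth_gC d
  have key : ∀ z : ℂ, max 0 M₀ < z.im →
      mirror d z * cexp (powSum (gC d) (mirror d z)) / quantum z = 1 := by
    intro z hz
    refine eq_of_hasDerivAt_zero_of_tendsto (M := max 0 M₀)
      (f := fun z => mirror d z * cexp (powSum (gC d) (mirror d z)) / quantum z)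
      (fun z hz => ?_) ?_ hz
    · have hz0 := hpos z hz
      have hP := hasDerivAt_mirror d hz0
      refine ((hP.fun_mul (hasDerivAt_powSum_comp hg hP (hsm z hz)).cexp).fun_div
        (hasDerivAt_quantum hz0) (quantum_ne_zero z)).congr_deriv ?_
      rw [powSum_theta_gC d (hsm z hz), hF z hz, div_eq_zero_iff, ← etaQuot_expW_mul d hz0]
      left
      ring
    · obtain ⟨D, hD, -⟩ := hg.exists_hasDerivAt (x := 0) (by norm_num) (by simp)
      have h1 := hD.continuousAt.tendsto.comp (tendsto_mirror d)
      have h2 := (polyGrowth_psiCoeff.div_lamExp.analyticAt (q := 0) (by simp)).continuousAt.tendsto.comp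
        tendsto_nome
      have h3 := ((tendsto_mirror_div d).neg.mul h1.cexp).mul h2.cexp
      have h4 : - -(1 : ℂ) * cexp (powSum (gC d) 0) *
          cexp (lambert (fun p => psiCoeff p / lamExp p) 0) = 1 := by
        rw [powSum_zero, lambert_zero]; simp [gC]
      rw [h4] at h3
      refine h3.congr fun z => ?_
      have := nome_ne_zero z
      simp only [Function.comp, quantum, potential, Complex.exp_neg]
      field_simp
  have := key z hz
  rw [div_eq_one_iff_eq (quantum_ne_zero z)] at this
  rw [Q, g_eq_powSum d (hsm z hz), this]

/-! ### Analytic continuation along paths -/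

theorem analyticAt_mirror (d : Smoothing) {z : ℂ} (hz : 0 < z.im) : AnalyticAt ℂ (mirror d) z :=
  (show DifferentiableOn ℂ (mirror d) {z | 0 < z.im} from fun _ hw =>
    (hasDerivAt_mirror d hw).differentiableAt.differentiableWithinAt).analyticAt (upper_mem_nhds hz)

theorem analyticAt_quantum {z : ℂ} (hz : 0 < z.im) : AnalyticAt ℂ quantum z :=
  (show DifferentiableOn ℂ quantum {z | 0 < z.im} from fun _ hw =>
    (hasDerivAt_quantum hw).differentiableAt.differentiableWithinAt).analyticAt (upper_mem_nhds hz)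

/-- D log P is an eta quotient and so has no zeros. Hence P is a local biholomorphism, and germs on
the P-line correspond to germs on the upper half plane. -/
theorem deriv_mirror_ne_zero (d : Smoothing) {z : ℂ} (hz : 0 < z.im) : deriv (mirror d) z ≠ 0 := by
  rw [(hasDerivAt_mirror d hz).deriv]
  exact mul_ne_zero (by simp [Real.pi_ne_zero])
    (mul_ne_zero (etaQuot_ne_zero _ hz) (mirror_ne_zero d hz))

theorem map_nhds_mirror (d : Smoothing) {z : ℂ} (hz : 0 < z.im) :
    map (mirror d) (𝓝 z) = 𝓝 (mirror d z) :=
  (analyticAt_mirror d hz).hasStrictDerivAt.map_nhds_eq (deriv_mirror_ne_zero d hz)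

/-- Two germs at `P(z)` agree if their pullbacks by the mirror coordinate agree. -/
theorem eventuallyEq_mirror_iff (d : Smoothing) {z : ℂ} (hz : 0 < z.im) {F G : ℂ → ℂ} :
    F =ᶠ[𝓝 (mirror d z)] G ↔ (fun w => F (mirror d w)) =ᶠ[𝓝 z] fun w => G (mirror d w) := by
  rw [← map_nhds_mirror d hz]; rfl

/-- The germ is `quantum` composed with the local inverse of P. -/
theorem exists_germ (d : Smoothing) {z : ℂ} (hz : 0 < z.im) : ∃ F : ℂ → ℂ,
    AnalyticAt ℂ F (mirror d z) ∧ (fun w => F (mirror d w)) =ᶠ[𝓝 z] quantum := by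
  have hs := (analyticAt_mirror d hz).hasStrictDerivAt
  have h0 := deriv_mirror_ne_zero d hz
  have hl := hs.eventually_left_inverse h0
  refine ⟨fun x => quantum (hs.localInverse _ _ _ h0 x), ?_, ?_⟩
  · refine AnalyticAt.fun_comp (g := quantum) ?_ ((analyticAt_mirror d hz).analyticAt_localInverse h0)
    rw [hl.self_of_nhds]
    exact analyticAt_quantum hz
  · filter_upwards [hl] with w hw
    rw [hw]

theorem continuousOn_coe_path {r : ℚ} {τ : ℝ → UpperHalfPlane} (hτ : IsPathToCusp r τ) {s : ℝ}
    (hs : s ∈ Set.Ioo (0 : ℝ) 1) : Tendsto (fun t => (τ t : ℂ)) (𝓝 s) (𝓝 (τ s : ℂ)) :=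
  (UpperHalfPlane.continuous_coe.tendsto _).comp
    (hτ.continuousOn.continuousAt (isOpen_Ioo.mem_nhds hs)).tendsto

theorem exists_continuation (d : Smoothing) {r : ℚ} {τ : ℝ → UpperHalfPlane}
    (hτ : IsPathToCusp r τ) :
    ∃ F, IsContinuationAlong (Q d) (fun s => mirror d (τ s)) F := by
  choose F hF1 hF2 using fun s => exists_germ d (τ s).2
  refine ⟨F, fun s _ => hF1 s, fun s hs => ?_, ?_⟩
  · have := (continuousOn_coe_path hτ hs).eventually (hF2 s).eventuallyEq_nhds
    filter_upwards [this] with t ht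
    rw [eventuallyEq_mirror_iff d (τ t).2]
    exact (hF2 t).trans ht.symm
  · obtain ⟨M, -, hM⟩ := exists_quantum_eq d
    filter_upwards [hτ.start.eventually (eventually_gt_atTop M)] with s hs
    rw [eventuallyEq_mirror_iff d (τ s).2]
    refine (hF2 s).trans ?_
    have : {z : ℂ | M < z.im} ∈ 𝓝 (τ s : ℂ) :=
      (isOpen_lt continuous_const continuous_im).mem_nhds hs
    filter_upwards [this] with z hz using (hM z hz).2.symm

/-- Agreement of the pulled-back germ with `quantum` is a locally constant condition on the
parameter, by the identity theorem on a small ball. It holds near the start of the path, and the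
interval is connected. -/
theorem continuation_eq (d : Smoothing) {r : ℚ} {τ : ℝ → UpperHalfPlane}
    (hτ : IsPathToCusp r τ) {F : ℝ → ℂ → ℂ}
    (hF : IsContinuationAlong (Q d) (fun s => mirror d (τ s)) F) {s : ℝ}
    (hs : s ∈ Set.Ioo (0 : ℝ) 1) : F s (mirror d (τ s)) = quantum (τ s) := by
  let A : ℝ → Prop := fun s => (fun w => F s (mirror d w)) =ᶠ[𝓝 (τ s : ℂ)] quantum
  have hloc : ∀ s ∈ Set.Ioo (0 : ℝ) 1, ∀ᶠ t in 𝓝[Set.Ioo 0 1] s, (A s ↔ A t) := by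
    intro s hs
    have h1 : AnalyticAt ℂ (fun w => F s (mirror d w)) (τ s : ℂ) :=
      AnalyticAt.fun_comp (g := F s) (hF.analyticAt s hs) (analyticAt_mirror d (τ s).2)
    obtain ⟨ε, hε, hball⟩ := Metric.eventually_nhds_iff_ball.1
      (h1.eventually_analyticAt.and (analyticAt_quantum (τ s).2).eventually_analyticAt)
    have hpre := (convex_ball (τ s : ℂ) ε).isPreconnected
    filter_upwards [mem_nhdsWithin_of_mem_nhds ((continuousOn_coe_path hτ hs).eventually
      (Metric.ball_mem_nhds _ hε)), mem_nhdsWithin_of_mem_nhds (hF.consistent s hs)] with t ht hc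
    have hc' := (eventuallyEq_mirror_iff d (τ t).2).1 hc
    have key : ∀ x ∈ Metric.ball (τ s : ℂ) ε, ∀ y ∈ Metric.ball (τ s : ℂ) ε,
        (fun w => F s (mirror d w)) =ᶠ[𝓝 x] quantum →
        (fun w => F s (mirror d w)) =ᶠ[𝓝 y] quantum := by
      intro x hx y hy hxy
      have := AnalyticOnNhd.eqOn_of_preconnected_of_eventuallyEq (𝕜 := ℂ)
        (fun w hw => (hball w hw).1) (fun w hw => (hball w hw).2) hpre hx hxy
      exact this.eventuallyEq_of_mem (Metric.isOpen_ball.mem_nhds hy)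
    have hs' := Metric.mem_ball_self (x := (τ s : ℂ)) hε
    exact ⟨fun h => hc'.trans (key _ hs' _ ht h), fun h => key _ ht _ hs' (hc'.symm.trans h)⟩
  have hiff : ∀ x ∈ Set.Ioo (0 : ℝ) 1, ∀ y ∈ Set.Ioo (0 : ℝ) 1, (A x ↔ A y) := fun x hx y hy =>
    isPreconnected_Ioo.induction₂ (fun x y => A x ↔ A y) hloc
      (fun x y z _ _ _ h1 h2 => h1.trans h2) (fun x y _ _ h => h.symm) hx hy
  obtain ⟨M, -, hM⟩ := exists_quantum_eq d
  obtain ⟨t, ⟨hti, htM⟩, ht⟩ := ((hF.initial.and (hτ.start.eventually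
    (eventually_gt_atTop M))).and (Ioo_mem_nhdsGT one_pos)).exists
  have hA : A t := by
    refine ((eventuallyEq_mirror_iff d (τ t).2).1 hti).trans ?_
    have : {z : ℂ | M < z.im} ∈ 𝓝 (τ t : ℂ) :=
      (isOpen_lt continuous_const continuous_im).mem_nhds htM
    filter_upwards [this] with z hz using (hM z hz).2
  exact ((hiff t ht s hs).1 hA).eq_of_nhds

/-- The limit at a cusp in terms of the function `quantum` on the upper half plane. -/
theorem isLimitAtCusp_of_quantum (d : Smoothing) {r : ℚ} {L : ℂ}
    (h : ∀ τ : ℝ → UpperHalfPlane, IsPathToCusp r τ →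
      (IsNontangential r τ → Tendsto (fun s => quantum (τ s)) (𝓝[<] 1) (𝓝 L)) ∧
      ∀ L', Tendsto (fun s => quantum (τ s)) (𝓝[<] 1) (𝓝 L') → L' = L) :
    IsLimitAtCusp d r L := by
  intro τ hτ
  simp only [hauptmodul_eq]
  refine ⟨exists_continuation d hτ, fun F hF => ?_⟩
  have he : (fun s => F s (mirror d (τ s))) =ᶠ[𝓝[<] 1] fun s => quantum (τ s) := by
    filter_upwards [Ioo_mem_nhdsLT one_pos] with s hs using continuation_eq d hτ hF hs
  exact ⟨fun hn => ((h τ hτ).1 hn).congr' he.symm, fun L' hL => (h τ hτ).2 L' (hL.congr' he)⟩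

/-! ### Eichler integrals -/

/-- The Eichler integral of the weight-three form with expansion coefficients `u`. -/
noncomputable def eichler (u : ℕ × ℕ → ℂ) (c d : ℂ) (w : ℂ) : ℂ :=
  6 * ((c * w + d) * lambert (fun p => u p / lamExp p) (nome (w / 6)))
    - c * (36 / (2 * Real.pi * I)) * lambert (fun p => u p / lamExp p / lamExp p) (nome (w / 6))

theorem hasDerivAt_lambert_nome_div {u : ℕ × ℕ → ℂ} (hu : PolyGrowth u) {z : ℂ} (hz : 0 < z.im) :
    HasDerivAt (fun z => lambert (fun p => u p / lamExp p) (nome (z / 6)))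
      (2 * Real.pi * I / 6 * lambert u (nome (z / 6))) z := by
  have hz6 : 0 < (z / 6).im := by
    have : (z / 6).im = z.im / 6 := by simp
    rw [this]; positivity
  have h := (hasDerivAt_lambert_nome hu.div_lamExp hz6).comp z ((hasDerivAt_id z).div_const 6)
  refine h.congr_deriv ?_
  have : (fun p => u p / (lamExp p : ℂ) * lamExp p) = u :=
    funext fun p => div_mul_cancel₀ _ (lamExp_ne_zero p)
  simp only [this]
  ring

/-- Integration by parts: the second series cancels the derivative of the linear factor. A single
factor cz + d remains in weight three because the change of variables contributes (cz + d)⁻²; the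
numbers 6 and 36 come from the nome of z/6. -/
theorem hasDerivAt_eichler {u : ℕ × ℕ → ℂ} (hu : PolyGrowth u) (c d : ℂ) {z : ℂ} (hz : 0 < z.im) :
    HasDerivAt (eichler u c d)
      (2 * Real.pi * I * ((c * z + d) * lambert u (nome (z / 6)))) z := by
  have h1 := hasDerivAt_lambert_nome_div hu hz
  have h2 := hasDerivAt_lambert_nome_div hu.div_lamExp hz
  have h3 : HasDerivAt (fun z => c * z + d) c z := by
    simpa using ((hasDerivAt_id z).const_mul c).add_const d
  refine (((h3.fun_mul h1).const_mul 6).fun_sub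
    (h2.const_mul (c * (36 / (2 * Real.pi * I))))).congr_deriv ?_
  have : (Real.pi : ℂ) ≠ 0 := by exact_mod_cast Real.pi_ne_zero
  have := I_ne_zero
  field_simp
  ring

/-- Near a cusp other than those equivalent to `i∞` the function `quantum` is a constant times the
exponential of an Eichler integral. -/
theorem exists_quantum_mobius {a b c d : ℤ} (h : a * d - b * c = 1) (hc : ¬ (6 : ℤ) ∣ c) :
    ∃ (u : ℕ × ℕ → ℂ) (L : ℂ), PolyGrowth u ∧ L ≠ 0 ∧ ∀ w : ℂ, 0 < w.im →
      quantum ((a * w + b) / (c * w + d)) = L * cexp (eichler u c d w) := by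
  obtain ⟨u, hu, hE⟩ := exists_formE_mobius h hc
  obtain ⟨L, hL⟩ := exists_eq_of_hasDerivAt_zero (f := fun w =>
    quantum ((a * w + b) / (c * w + d)) * cexp (-eichler u c d w)) fun w hw => by
    have hj := cocycle_ne_zero h hw
    have h1 := HasDerivAt.comp (h₂ := quantum) w (hasDerivAt_quantum (im_mobius_pos h hw))
      (hasDerivAt_mobius h hw)
    refine (h1.fun_mul (hasDerivAt_eichler hu c d hw).neg.cexp).congr_deriv ?_
    rw [hE w hw]
    simp only [Function.comp]
    field_simp
    ring
  have key : ∀ w : ℂ, 0 < w.im →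
      quantum ((a * w + b) / (c * w + d)) = L * cexp (eichler u c d w) := by
    intro w hw
    rw [← hL w hw, mul_assoc, ← Complex.exp_add, neg_add_cancel, Complex.exp_zero, mul_one]
  refine ⟨u, L, hu, ?_, key⟩
  rintro rfl
  have := key I (by simp)
  rw [zero_mul] at this
  exact quantum_ne_zero _ this

theorem tendsto_lambert_cuspInf {u : ℕ × ℕ → ℂ} (hu : PolyGrowth u) :
    Tendsto (fun w => lambert u (nome (w / 6))) cuspInf (𝓝 0) := by
  refine (hu.isBigO (g := 1) fun p hp => absurd hp (by have := lamExp_pos p; omega)).trans_tendsto ?_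
  exact tendsto_decay (by norm_num)

theorem tendsto_im_mul_lambert {u : ℕ × ℕ → ℂ} (hu : PolyGrowth u) :
    Tendsto (fun w => (w.im : ℂ) * lambert u (nome (w / 6))) cuspInf (𝓝 0) := by
  have h1 := hu.isBigO (g := 1) fun p hp => absurd hp (by have := lamExp_pos p; omega)
  have h2 : (fun w : ℂ => (w.im : ℂ)) =O[cuspInf] fun w => w.im :=
    IsBigO.of_bound 1 (Eventually.of_forall fun w => by simp)
  refine (h2.mul h1).trans_tendsto ?_
  have h3 : Tendsto (fun y : ℝ => y * Real.exp (-(Real.pi / 3) * y)) atTop (𝓝 0) := by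
    have := Real.tendsto_pow_mul_exp_neg_atTop_nhds_zero 1
    have h4 := (this.comp (tendsto_id.const_mul_atTop (by positivity : 0 < Real.pi / 3))).const_mul
      (3 / Real.pi)
    rw [mul_zero] at h4
    refine h4.congr fun y => ?_
    have := Real.pi_pos
    simp only [Function.comp, id]
    field_simp
  refine (h3.comp tendsto_im_cuspInf).congr fun w => ?_
  simp only [Function.comp, decay]
  congr 2
  push_cast
  ring

/-- The Eichler integral tends to zero in sectors. -/
theorem tendsto_eichler {u : ℕ × ℕ → ℂ} (hu : PolyGrowth u) (c d : ℂ) {α : Type*} {l : Filter α}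
    {w : α → ℂ} (hw : Tendsto w l cuspInf) {K : ℝ}
    (hK : ∀ᶠ s in l, ‖c * w s + d‖ ≤ K * (w s).im) :
    Tendsto (fun s => eichler u c d (w s)) l (𝓝 0) := by
  have h1 := (tendsto_im_mul_lambert hu.div_lamExp).comp hw
  have h2 := (tendsto_lambert_cuspInf hu.div_lamExp.div_lamExp).comp hw
  have h3 : Tendsto (fun s => (c * w s + d) * lambert (fun p => u p / lamExp p) (nome (w s / 6))) l
      (𝓝 0) := by
    have hO : (fun s => (c * w s + d)) =O[l] fun s => ((w s).im : ℂ) := by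
      refine IsBigO.of_bound K ?_
      filter_upwards [hK, (hw.eventually eventually_cuspInf_pos)] with s hs hp
      rwa [Complex.norm_real, Real.norm_of_nonneg hp.le]
    exact (hO.mul (isBigO_refl (fun s => lambert (fun p => u p / lamExp p) (nome (w s / 6))) l)).trans_tendsto h1
  have := (h3.const_mul 6).sub (h2.const_mul (c * (36 / (2 * Real.pi * I))))
  simpa [eichler] using this

/-! ### Oscillation along tangential paths -/

theorem exists_ge_exp_eq {ν : ℝ} (hν : ν ≠ 0) {ζ : ℂ} (hζ : ‖ζ‖ = 1) (X : ℝ) :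
    ∃ T, X ≤ T ∧ cexp ((ν * T : ℝ) * I) = ζ := by
  have hν' : 0 < |ν| := abs_pos.2 hν
  have hpi := Real.pi_pos
  obtain ⟨k, hk⟩ := exists_nat_ge ((X - ζ.arg / ν) / (2 * Real.pi / |ν|))
  rw [div_le_iff₀ (by positivity)] at hk
  refine ⟨ζ.arg / ν + k * (2 * Real.pi / |ν|), by linarith, ?_⟩
  have e : cexp ((ζ.arg : ℂ) * I) = ζ := by
    have := Complex.norm_mul_exp_arg_mul_I ζ
    rwa [hζ, ofReal_one, one_mul] at this
  obtain ⟨ε, hε⟩ : ∃ ε : ℤ, ν = ε * |ν| := by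
    rcases abs_cases ν with h | h
    · exact ⟨1, by rw [h.1]; simp⟩
    · exact ⟨-1, by rw [h.1]; simp⟩
  have h1 : ν * (ζ.arg / ν + k * (2 * Real.pi / |ν|)) = ζ.arg + (ε * k : ℤ) * (2 * Real.pi) := by
    rw [mul_add, mul_div_cancel₀ _ hν]
    congr 1
    nth_rewrite 1 [hε]
    push_cast
    field_simp
  rw [h1]
  push_cast
  rw [add_mul, Complex.exp_add, e]
  have := Complex.exp_int_mul_two_pi_mul_I (ε * k)
  push_cast at this
  rw [mul_assoc, this, mul_one]

/-- By continuity x takes all large values arbitrarily close to the end of the path, so every phase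
recurs. -/
theorem frequently_exp_eq {x : ℝ → ℝ} (hx : ContinuousOn x (Set.Ioo 0 1))
    (hxt : Tendsto x (𝓝[<] 1) atTop) {ν : ℝ} (hν : ν ≠ 0) {ζ : ℂ} (hζ : ‖ζ‖ = 1) :
    ∃ᶠ s in 𝓝[<] (1 : ℝ), cexp ((ν * x s : ℝ) * I) = ζ := by
  rw [Filter.frequently_iff]
  intro U hU
  obtain ⟨l, hl, hU'⟩ := (mem_nhdsLT_iff_exists_Ioo_subset' (zero_lt_one' ℝ)).1
    (inter_mem hU (Ioo_mem_nhdsLT (zero_lt_one' ℝ)))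
  obtain ⟨s₁, h1, h1'⟩ := exists_between (show l < 1 from hl)
  obtain ⟨T, hT, hTζ⟩ := exists_ge_exp_eq hν hζ (x s₁)
  obtain ⟨s₂, h2, h2', h2''⟩ := ((hxt.eventually (eventually_ge_atTop T)).and
    (Ioo_mem_nhdsLT h1')).exists
  have hsub : Set.Icc s₁ s₂ ⊆ Set.Ioo 0 1 := fun s hs =>
    (hU' ⟨h1.trans_le hs.1, hs.2.trans_lt h2''⟩).2
  obtain ⟨s, hs, hxs⟩ := intermediate_value_Icc h2'.le (hx.mono hsub) ⟨hT, h2⟩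
  exact ⟨s, (hU' ⟨h1.trans_le hs.1, hs.2.trans_lt h2''⟩).1, by rw [hxs, hTζ]⟩

/-- Once |x| ≥ 1, a continuous x cannot change sign. -/
theorem tendsto_atTop_or_neg {x : ℝ → ℝ} (hx : ContinuousOn x (Set.Ioo 0 1))
    (hxt : Tendsto (fun s => |x s|) (𝓝[<] 1) atTop) :
    Tendsto x (𝓝[<] 1) atTop ∨ Tendsto (fun s => -x s) (𝓝[<] 1) atTop := by
  obtain ⟨l, hl, hU⟩ := (mem_nhdsLT_iff_exists_Ioo_subset' (zero_lt_one' ℝ)).1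
    (inter_mem (hxt.eventually (eventually_ge_atTop 1)) (Ioo_mem_nhdsLT (zero_lt_one' ℝ)))
  have hc : ContinuousOn x (Set.Ioo l 1) := hx.mono fun s hs => (hU hs).2
  by_cases h : ∃ s ∈ Set.Ioo l 1, 0 ≤ x s
  · left
    obtain ⟨s, hs, hxs⟩ := h
    refine hxt.congr' ?_
    filter_upwards [Ioo_mem_nhdsLT (show l < 1 from hl)] with t ht
    rw [abs_of_nonneg]
    by_contra hneg
    obtain ⟨v, hv, hxv⟩ := isPreconnected_Ioo.intermediate_value ht hs hc ⟨(not_le.1 hneg).le, hxs⟩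
    have := (hU hv).1
    simp only [Set.mem_ofPred_eq, hxv, abs_zero] at this
    linarith
  · right
    push Not at h
    refine hxt.congr' ?_
    filter_upwards [Ioo_mem_nhdsLT (show l < 1 from hl)] with t ht
    exact abs_of_neg (h t ht)

/-- If `h` is bounded away from zero and asymptotic to `x ρ e^{iνx}` with `|x| → ∞`, then the
exponential of `h` has no limit. -/
theorem not_tendsto_exp {h : ℝ → ℂ} {x ρ : ℝ → ℝ} {B : ℂ} {ν δ : ℝ} (hB : B ≠ 0) (hν : ν ≠ 0)
    (hδ : 0 < δ) (hx : ContinuousOn x (Set.Ioo 0 1))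
    (hxt : Tendsto (fun s => |x s|) (𝓝[<] 1) atTop) (hρ : ∀ s, 0 < ρ s)
    (hh : ∀ᶠ s in 𝓝[<] (1 : ℝ), δ ≤ ‖h s‖)
    (has : Tendsto (fun s => B * x s * ρ s * cexp ((ν * x s : ℝ) * I) / h s) (𝓝[<] 1) (𝓝 1))
    {M : ℂ} : ¬ Tendsto (fun s => cexp (h s)) (𝓝[<] 1) (𝓝 M) := by
  intro hM
  have hfreq : ∀ ζ : ℂ, ‖ζ‖ = 1 → ∃ᶠ s in 𝓝[<] (1 : ℝ),
      x s * cexp ((ν * x s : ℝ) * I) = ζ * (|x s| : ℝ) := by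
    intro ζ hζ
    rcases tendsto_atTop_or_neg hx hxt with h1 | h1
    · refine ((frequently_exp_eq hx h1 hν hζ).and_eventually
        (h1.eventually (eventually_ge_atTop 0))).mono fun s hs => ?_
      rw [hs.1, abs_of_nonneg hs.2, mul_comm]
    · refine ((frequently_exp_eq hx.fun_neg h1 (neg_ne_zero.2 hν) (ζ := -ζ)
        (by rwa [norm_neg])).and_eventually
        (h1.eventually (eventually_ge_atTop 0))).mono fun s hs => ?_
      have := hs.1
      rw [neg_mul_neg] at this
      rw [this, abs_of_nonpos (by linarith [hs.2])]
      push_cast; ring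
  have hev : ∀ᶠ s in 𝓝[<] (1 : ℝ), ‖B * x s * ρ s * cexp ((ν * x s : ℝ) * I) / h s - 1‖ < 1 / 4 := by
    have := (has.sub_const 1).norm
    rw [sub_self, norm_zero] at this
    exact this.eventually (gt_mem_nhds (by norm_num))
  have hBn : (‖B‖ : ℂ) ≠ 0 := by simpa using hB
  -- Whenever the phase makes the asymptotic form real of sign σ, h lies close to that half-axis and
  -- σ Re h ≥ |h|/2 ≥ δ/2. Both signs recur, so |exp h| is repeatedly at least exp(δ/2) and
  -- repeatedly at most exp(-δ/2).
  have key : ∀ σ : ℝ, |σ| = 1 → ∃ᶠ s in 𝓝[<] (1 : ℝ), δ / 2 ≤ σ * (h s).re := by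
    intro σ hσ
    -- The prescribed phase compensates the argument of B.
    have hζ : ‖(σ * (‖B‖ / B) : ℂ)‖ = 1 := by
      rw [norm_mul, norm_div, Complex.norm_real, Complex.norm_real, Real.norm_eq_abs, hσ, norm_norm,
        div_self (by simpa using hB), one_mul]
    refine ((hfreq _ hζ).and_eventually (hev.and hh)).mono fun s hs => ?_
    obtain ⟨h1, h2, h3⟩ := hs
    have hσ2 : σ * σ = 1 := by rw [← abs_mul_abs_self, hσ, one_mul]
    set y : ℝ := ‖B‖ * |x s| * ρ s with hy
    have e : B * x s * ρ s * cexp ((ν * x s : ℝ) * I) = ((σ * y : ℝ) : ℂ) := by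
      rw [show B * x s * ρ s * cexp ((ν * x s : ℝ) * I)
        = B * ρ s * (x s * cexp ((ν * x s : ℝ) * I)) by ring, h1, hy]
      push_cast
      field_simp
    rw [e] at h2
    have hne : h s ≠ 0 := by
      intro h0
      rw [h0, norm_zero] at h3
      linarith
    have h4 : ‖((σ * y : ℝ) : ℂ) - h s‖ ≤ 1 / 4 * ‖h s‖ := by
      have : ((σ * y : ℝ) : ℂ) - h s = (((σ * y : ℝ) : ℂ) / h s - 1) * h s := by field_simp
      rw [this, norm_mul]
      gcongr
    have h5 : ‖((σ * y : ℝ) : ℂ)‖ = y := by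
      have : 0 ≤ y := by have := hρ s; positivity
      rw [Complex.norm_real, norm_mul, Real.norm_eq_abs, hσ, one_mul, Real.norm_of_nonneg this]
    have h6 : |σ * y - (h s).re| ≤ 1 / 4 * ‖h s‖ := by
      refine le_trans ?_ h4
      have := Complex.abs_re_le_norm (((σ * y : ℝ) : ℂ) - h s)
      simpa using this
    have h7 : ‖h s‖ - y ≤ 1 / 4 * ‖h s‖ := by
      have := norm_sub_norm_le (h s) ((σ * y : ℝ) : ℂ)
      rw [h5, norm_sub_rev] at this
      exact this.trans h4
    have h8 : y - σ * (h s).re ≤ 1 / 4 * ‖h s‖ := by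
      have : y - σ * (h s).re = σ * (σ * y - (h s).re) := by linear_combination -y * hσ2
      rw [this]
      refine (le_abs_self _).trans ?_
      rwa [abs_mul, hσ, one_mul]
    linarith
  have hMn := hM.norm
  have h1 : Real.exp (δ / 2) ≤ ‖M‖ := by
    refine isClosed_Ici.mem_of_frequently_of_tendsto ((key 1 (by simp)).mono fun s hs => ?_) hMn
    rw [Set.mem_Ici, Complex.norm_exp]
    exact Real.exp_le_exp.2 (by linarith)
  have h2 : ‖M‖ ≤ Real.exp (-(δ / 2)) := by
    refine isClosed_Iic.mem_of_frequently_of_tendsto ((key (-1) (by simp)).mono fun s hs => ?_) hMn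
    rw [Set.mem_Iic, Complex.norm_exp]
    exact Real.exp_le_exp.2 (by linarith)
  have h3 := Real.exp_le_exp.1 (h1.trans h2)
  linarith

/-- Along an arbitrary path to `i∞` the exponential of an Eichler integral can only tend to `1`. -/
theorem eq_one_of_tendsto_exp_eichler {u : ℕ × ℕ → ℂ} (hu : PolyGrowth u) {c d : ℤ} (hc : c ≠ 0)
    {w : ℝ → ℂ} (hw : ContinuousOn w (Set.Ioo 0 1)) (hwt : Tendsto w (𝓝[<] 1) cuspInf) {M : ℂ}
    (hM : Tendsto (fun s => cexp (eichler u c d (w s))) (𝓝[<] 1) (𝓝 M)) : M = 1 := by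
  by_contra hM1
  have hM1' : 0 < ‖M - 1‖ := norm_pos_iff.2 (sub_ne_zero.2 hM1)
  -- If M ≠ 1, continuity of exp at 0 keeps the Eichler integral itself away from 0.
  obtain ⟨δ, hδ, hδ'⟩ := Metric.continuousAt_iff.1
    (Complex.continuous_exp.continuousAt (x := (0 : ℂ))) _ (half_pos hM1')
  have hh : ∀ᶠ s in 𝓝[<] (1 : ℝ), δ ≤ ‖eichler u c d (w s)‖ := by
    filter_upwards [hM.eventually (Metric.ball_mem_nhds M (half_pos hM1'))] with s hs
    by_contra hlt
    have h1 := hδ' (x := eichler u c d (w s)) (by simpa using not_le.1 hlt)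
    rw [Complex.exp_zero, dist_eq_norm] at h1
    replace hs : dist _ M < _ := hs
    rw [dist_eq_norm, norm_sub_rev] at hs
    have := norm_add_le (M - cexp (eichler u c d (w s))) (cexp (eichler u c d (w s)) - 1)
    rw [sub_add_sub_cancel] at this
    linarith
  set f := lambert (fun p => u p / lamExp p) with hf
  -- ε collects everything except the term with Re w. It tends to 0 along any path with Im w → ∞,
  -- since Im w times an exponentially small series is small; only Re w can grow without control.
  set ε : ℝ → ℂ := fun s => 6 * ((c * ((w s).im * I) + d) * f (nome (w s / 6)))
    - c * (36 / (2 * Real.pi * I)) * lambert (fun p => u p / lamExp p / lamExp p) (nome (w s / 6))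
    with hε
  have hq : Tendsto (fun s => nome (w s / 6)) (𝓝[<] 1) (𝓝 0) := by
    have h1 := (tendsto_nome_affine (s := 1 / 6) (by norm_num) 0).comp hwt
    refine h1.congr fun s => ?_
    simp only [Function.comp]
    congr 1
    push_cast
    ring
  have hε0 : Tendsto ε (𝓝[<] 1) (𝓝 0) := by
    have h1 := (tendsto_im_mul_lambert hu.div_lamExp).comp hwt
    have h2 := (tendsto_lambert_cuspInf hu.div_lamExp).comp hwt
    have h3 := (tendsto_lambert_cuspInf hu.div_lamExp.div_lamExp).comp hwt
    have := ((h1.const_mul (6 * c * I)).add (h2.const_mul (6 * d : ℂ))).sub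
      (h3.const_mul (c * (36 / (2 * Real.pi * I))))
    simp only [mul_zero, add_zero, sub_zero] at this
    refine this.congr fun s => ?_
    simp only [Function.comp, hε, hf]
    ring
  have hdec : ∀ s, eichler u c d (w s) = 6 * c * (w s).re * f (nome (w s / 6)) + ε s := by
    intro s
    simp only [eichler, hε]
    rw [← hf]
    have := Complex.re_add_im (w s)
    linear_combination (-6 * c * f (nome (w s / 6))) * this
  have hfa : AnalyticAt ℂ f 0 := hu.div_lamExp.analyticAt (by simp)
  have hf0 : f 0 = 0 := lambert_zero _
  -- If the series vanishes identically, only ε remains, which contradicts the lower bound δ.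
  -- Otherwise f behaves like g(0) qⁿ with n ≥ 1, and the main term becomes B x ρ exp(iνx) with x =
  -- Re w.
  by_cases hz : ∀ᶠ q in 𝓝 (0 : ℂ), f q = 0
  · have h1 : ∀ᶠ s in 𝓝[<] (1 : ℝ), ‖ε s‖ < δ := by
      have := hε0.norm
      rw [norm_zero] at this
      exact this.eventually (gt_mem_nhds hδ)
    obtain ⟨s, h2, h3, h4⟩ := (h1.and (hh.and (hq.eventually hz))).exists
    rw [hdec, h4, mul_zero, zero_add] at h3
    linarith
  · obtain ⟨n, g, hg, hg0, hfg⟩ := hfa.exists_eventuallyEq_pow_smul_nonzero_iff.2 hz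
    have hn : n ≠ 0 := by
      rintro rfl
      have := hfg.self_of_nhds
      rw [hf0] at this
      simp at this
      exact hg0 this.symm
    have hgt : Tendsto (fun s => g (nome (w s / 6))) (𝓝[<] 1) (𝓝 (g 0)) :=
      hg.continuousAt.tendsto.comp hq
    have hcC : (c : ℂ) ≠ 0 := by exact_mod_cast hc
    set B : ℂ := 6 * c * g 0 with hB
    have hB0 : B ≠ 0 := mul_ne_zero (mul_ne_zero (by norm_num) hcC) hg0
    set z₀ : ℝ → ℂ := fun s => B * (w s).re * (decay (n / 6) (w s) : ℝ) *
      cexp (((2 * Real.pi * n / 6) * (w s).re : ℝ) * I) with hz₀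
    have hqn : ∀ s, nome (w s / 6) ^ n = (decay (n / 6) (w s) : ℝ) *
        cexp (((2 * Real.pi * n / 6) * (w s).re : ℝ) * I) := by
      intro s
      rw [← nome_nat_mul, nome, decay, Complex.ofReal_exp, ← Complex.exp_add]
      congr 1
      push_cast
      have := Complex.re_add_im (w s)
      have hI := I_mul_I
      linear_combination (-2 * Real.pi * I * n / 6) * this + (2 * Real.pi * n / 6 * (w s).im) * hI
    have has : Tendsto (fun s => z₀ s / eichler u c d (w s)) (𝓝[<] 1) (𝓝 1) := by
      have h1 : Tendsto (fun s => ε s / eichler u c d (w s)) (𝓝[<] 1) (𝓝 0) := by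
        rw [tendsto_zero_iff_norm_tendsto_zero]
        refine squeeze_zero' (Eventually.of_forall fun s => norm_nonneg _) ?_
          (by simpa using hε0.norm.div_const δ)
        filter_upwards [hh] with s hs
        rw [norm_div]
        gcongr
      have h2 := (h1.const_sub 1).mul ((tendsto_const_nhds (x := g 0)).div hgt hg0)
      rw [div_self hg0, sub_zero, one_mul] at h2
      refine h2.congr' ?_
      filter_upwards [hh, hq.eventually hfg, hgt.eventually_ne hg0] with s hs h3 h4
      have hne : eichler u c d (w s) ≠ 0 := by
        intro h0
        rw [h0, norm_zero] at hs
        linarith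
      have h5 := hdec s
      rw [h3, sub_zero, smul_eq_mul, hqn] at h5
      simp only [hz₀, hB, Pi.div_apply]
      generalize ε s = e at h5 ⊢
      generalize cexp (_ * I) = X at h5 ⊢
      field_simp
      linear_combination h5
    -- The main term is bounded below while its exponential factor tends to 0, so |Re w| must tend
    -- to infinity.
    have hxt : Tendsto (fun s => |(w s).re|) (𝓝[<] 1) atTop := by
      have h1 : ∀ᶠ s in 𝓝[<] (1 : ℝ), 1 / 2 < ‖z₀ s / eichler u c d (w s)‖ := by
        have := has.norm
        rw [norm_one] at this
        exact this.eventually (lt_mem_nhds (by norm_num))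
      have h2 := ((tendsto_decay (μ := n / 6) (by positivity)).comp hwt)
      have h3 : Tendsto (fun s => (decay (n / 6) (w s))⁻¹ * (δ / 2 / ‖B‖)) (𝓝[<] 1) atTop := by
        refine Tendsto.atTop_mul_const (by positivity) ?_
        refine Tendsto.comp tendsto_inv_nhdsGT_zero ?_
        exact tendsto_nhdsWithin_iff.2 ⟨h2, Eventually.of_forall fun s => decay_pos _ _⟩
      refine tendsto_atTop_mono' _ ?_ h3
      filter_upwards [h1, hh] with s hs hs'
      have hd := decay_pos (n / 6) (w s)
      rw [norm_div, lt_div_iff₀ (hδ.trans_le hs')] at hs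
      have h4 : ‖z₀ s‖ = ‖B‖ * |(w s).re| * decay (n / 6) (w s) := by
        simp only [hz₀, norm_mul, Complex.norm_exp_ofReal_mul_I, Complex.norm_real,
          Real.norm_eq_abs, mul_one, abs_of_pos hd]
      rw [h4] at hs
      have hBp : 0 < ‖B‖ := norm_pos_iff.2 hB0
      rw [inv_mul_le_iff₀ hd, div_le_iff₀ hBp]
      nlinarith
    exact not_tendsto_exp (h := fun s => eichler u c d (w s)) (x := fun s => (w s).re)
      (ρ := fun s => decay (n / 6) (w s)) (B := B) (ν := 2 * Real.pi * n / 6) hB0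
      (by positivity) hδ (Complex.continuous_re.comp_continuousOn hw) hxt
      (fun s => decay_pos _ _) hh has hM

/-! ### Limits at cusps not equivalent to i∞ -/

theorem im_mobius {a b c d : ℤ} (h : a * d - b * c = 1) (z : ℂ) :
    ((a * z + b) / (c * z + d)).im = z.im / ‖(c * z + d : ℂ)‖ ^ 2 := by
  rw [Complex.div_im, ← sub_div, Complex.sq_norm]
  congr 1
  have h' : (a * d - b * c : ℝ) = 1 := by exact_mod_cast h
  simp
  linear_combination z.im * h'

/-- The limit of `quantum` at a cusp that is not equivalent to `i∞`. -/
theorem exists_cusp_limit {a c : ℤ} (hac : IsCoprime a c) (hc : ¬ (6 : ℤ) ∣ c) :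
    ∃ L : ℂ, Tendsto (fun y : ℝ => quantum ((a / c : ℝ) + y * I)) (𝓝[>] 0) (𝓝 L) ∧
      ∀ τ : ℝ → UpperHalfPlane, IsPathToCusp (a / c) τ →
        (IsNontangential (a / c) τ → Tendsto (fun s => quantum (τ s)) (𝓝[<] 1) (𝓝 L)) ∧
        ∀ L', Tendsto (fun s => quantum (τ s)) (𝓝[<] 1) (𝓝 L') → L' = L := by
  obtain ⟨d, b, hdb⟩ := hac
  have h : a * d - (-b) * c = 1 := by linear_combination hdb
  have hinv : d * a - b * (-c) = 1 := by linear_combination hdb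
  have hc0 : c ≠ 0 := by rintro rfl; simp at hc
  have hcR : (c : ℝ) ≠ 0 := by exact_mod_cast hc0
  have hcC : (c : ℂ) ≠ 0 := by exact_mod_cast hc0
  obtain ⟨u, L, hu, hL, hq⟩ := exists_quantum_mobius h hc
  set r : ℝ := a / c with hr
  have hrat : (((a / c : ℚ) : ℚ) : ℝ) = r := by push_cast; rfl
  let w : ℂ → ℂ := fun z => (d * z + b) / ((-c : ℤ) * z + a)
  have hden : ∀ z : ℂ, ‖((-c : ℤ) * z + a : ℂ)‖ = |(c : ℝ)| * ‖z - r‖ := by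
    intro z
    have : ((-c : ℤ) * z + a : ℂ) = -c * (z - r) := by
      rw [hr]; push_cast; field_simp; ring
    rw [this, norm_mul, norm_neg, Complex.norm_intCast]
  have hwim : ∀ z : ℂ, (w z).im = z.im / ‖z - r‖ ^ 2 / (c : ℝ) ^ 2 := by
    intro z
    rw [show (w z).im = _ from im_mobius hinv z, hden, mul_pow, sq_abs, div_div, mul_comm]
  have hwpos : ∀ z : ℂ, 0 < z.im → 0 < (w z).im := fun z hz => im_mobius_pos hinv hz
  have hcw : ∀ z : ℂ, 0 < z.im → c * w z + d = 1 / ((-c : ℤ) * z + a) := by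
    intro z hz
    have hj := cocycle_ne_zero hinv hz
    simp only [w]
    rw [eq_div_iff hj, add_mul, mul_assoc, div_mul_cancel₀ _ hj]
    have : (d * a + b * c : ℂ) = 1 := by exact_mod_cast hdb
    push_cast
    linear_combination this
  have hback : ∀ z : ℂ, 0 < z.im → quantum z = L * cexp (eichler u c d (w z)) := by
    intro z hz
    have hj := cocycle_ne_zero hinv hz
    rw [← hq _ (hwpos z hz), hcw z hz, div_div_eq_mul_div, div_one]
    congr 1
    simp only [w]
    have : (d * a + b * c : ℂ) = 1 := by exact_mod_cast hdb
    rw [add_mul, mul_assoc, div_mul_cancel₀ _ hj]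
    push_cast
    linear_combination -z * this
  -- The coordinate w carries a/c to i∞ and has Im w = Im z / (c² |z - r|²), so horoball convergence
  -- at r is exactly Im w → ∞.
  have hwt : ∀ {α : Type} {l : Filter α} {z : α → ℂ},
      Tendsto (fun s => (z s).im / ‖z s - r‖ ^ 2) l atTop → Tendsto (fun s => w (z s)) l cuspInf := by
    intro α l z hz
    refine tendsto_comap_iff.2 ?_
    have := hz.atTop_mul_const (show 0 < ((c : ℝ) ^ 2)⁻¹ by positivity)
    refine this.congr fun s => ?_
    simp only [Function.comp, hwim, div_eq_mul_inv]
  have hsector : ∀ {α : Type} {l : Filter α} {z : α → ℂ} {C : ℝ}, (∀ᶠ s in l, 0 < (z s).im) →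
      Tendsto (fun s => (z s).im / ‖z s - r‖ ^ 2) l atTop →
      (∀ᶠ s in l, |(z s).re - r| ≤ C * (z s).im) →
      Tendsto (fun s => quantum (z s)) l (𝓝 L) := by
    intro α l z C hpos hz hC
    have h1 : Tendsto (fun s => eichler u c d (w (z s))) l (𝓝 0) := by
      -- In the sector |z - r| ≤ (C + 1) Im z. As |cw + d| = 1/(|c| |z - r|), this is the bound |cw
      -- + d| ≤ (C + 1) |c| Im w.
      refine tendsto_eichler hu c d (hwt hz) (K := (C + 1) * |(c : ℝ)|) ?_
      filter_upwards [hC, hpos] with s hs hp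
      have hne : 0 < ‖z s - r‖ := by
        rw [norm_pos_iff]
        intro h0
        have := congrArg Complex.im h0
        simp at this
        linarith
      have hle : ‖z s - r‖ ≤ (C + 1) * (z s).im := by
        have := Complex.norm_le_abs_re_add_abs_im (z s - r)
        simp only [sub_re, ofReal_re, sub_im, ofReal_im, sub_zero, abs_of_pos hp] at this
        linarith
      have hca : 0 < |(c : ℝ)| := abs_pos.2 hcR
      rw [hcw _ hp, norm_div, norm_one, hden, hwim, ← sq_abs (c : ℝ)]
      rw [div_div, mul_div_assoc', div_le_div_iff₀ (by positivity) (by positivity)]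
      nlinarith [mul_le_mul_of_nonneg_right hle (by positivity :
        0 ≤ |(c : ℝ)| * |(c : ℝ)| * ‖z s - r‖)]
    have h2 := (h1.cexp.const_mul L)
    rw [Complex.exp_zero, mul_one] at h2
    exact h2.congr' (hpos.mono fun s hs => (hback _ hs).symm)
  refine ⟨L, ?_, fun τ hτ => ⟨fun ⟨C, hC⟩ => ?_, fun L' hL' => ?_⟩⟩
  · have hp : ∀ᶠ y : ℝ in 𝓝[>] 0, 0 < y := eventually_mem_nhdsWithin
    refine hsector (C := 0) (hp.mono fun y hy => by simpa using hy) ?_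
      (Eventually.of_forall fun y => by simp)
    refine (tendsto_inv_nhdsGT_zero (𝕜 := ℝ)).congr' (hp.mono fun y hy => ?_)
    simp
    field_simp
  · refine hsector (C := C) (Eventually.of_forall fun s => (τ s).2) ?_ ?_
    · have := hτ.finish
      rw [show (((a / c : ℚ) : ℚ) : ℂ) = (r : ℂ) by rw [← hrat]; simp] at this
      exact this
    · rw [hrat] at hC
      exact hC
  · have h1 := hτ.finish
    rw [show (((a / c : ℚ) : ℚ) : ℂ) = (r : ℂ) by rw [← hrat]; simp] at h1
    have hcont : ContinuousOn (fun s => w (τ s)) (Set.Ioo 0 1) := by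
      have h2 := UpperHalfPlane.continuous_coe.comp_continuousOn hτ.continuousOn
      exact ((h2.const_mul _).add_const _).div ((h2.const_mul _).add_const _)
        fun s _ => cocycle_ne_zero hinv (τ s).2
    have h3 : Tendsto (fun s => cexp (eichler u c d (w (τ s)))) (𝓝[<] 1) (𝓝 (L' / L)) := by
      refine (hL'.div_const L).congr fun s => ?_
      rw [hback _ (τ s).2]
      field_simp
    have h4 := eq_one_of_tendsto_exp_eichler hu hc0 hcont (hwt h1) h3
    rwa [div_eq_one_iff_eq hL] at h4

/-! ### Mellin transforms and limits at zero -/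

/-- Subtract V times the indicator function of (0, 1], whose Mellin transform is V/s. The rest is
O(t) at 0 and exponentially small at infinity, so its transform is holomorphic at s = 0. -/
theorem tendsto_mul_mellin {F : ℝ → ℂ} {V : ℂ} (hF : ContinuousOn F (Set.Ioi 0))
    (htop : F =O[atTop] fun t : ℝ => Real.exp (-1 * t))
    (hbot : (fun t => F t - V) =O[𝓝[>] 0] fun t : ℝ => t) :
    (∀ s : ℂ, 0 < s.re → DifferentiableAt ℂ (mellin F) s) ∧
      Tendsto (fun s : ℝ => (s : ℂ) * mellin F s) (𝓝[>] 0) (𝓝 V) := by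
  set J : ℝ → ℂ := Set.indicator (Set.Ioc 0 1) (fun _ => 1) with hJ
  have hFl := hF.locallyIntegrableOn (μ := MeasureTheory.volume) measurableSet_Ioi
  have hJV : MeasureTheory.LocallyIntegrableOn (fun t => V * J t) (Set.Ioi 0) := by
    have : MeasureTheory.Integrable J := by
      refine MeasureTheory.IntegrableOn.integrable_indicator ?_ measurableSet_Ioc
      exact MeasureTheory.integrableOn_const (by simp) (by simp)
    exact (this.const_mul V).locallyIntegrable.locallyIntegrableOn _
  have hGl : MeasureTheory.LocallyIntegrableOn (fun t => F t - V * J t) (Set.Ioi 0) :=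
    hFl.sub hJV
  have hFbot : F =O[𝓝[>] 0] fun t : ℝ => t ^ (-(0 : ℝ)) := by
    have h1 : (fun t => F t - V) =O[𝓝[>] 0] fun _ : ℝ => (1 : ℝ) :=
      hbot.trans ((tendsto_id.mono_right nhdsWithin_le_nhds : Tendsto (fun t : ℝ => t) (𝓝[>] 0) (𝓝 0)).isBigO_one ℝ)
    have h2 := h1.add (isBigO_const_const V (one_ne_zero (α := ℝ)) _)
    simpa using h2
  have hGtop : (fun t => F t - V * J t) =O[atTop] fun t : ℝ => Real.exp (-1 * t) := by
    refine htop.congr' ?_ EventuallyEq.rfl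
    filter_upwards [eventually_gt_atTop 1] with t ht
    simp [hJ, ht]
  have hGbot : (fun t => F t - V * J t) =O[𝓝[>] 0] fun t : ℝ => t ^ (-(-1 : ℝ)) := by
    refine hbot.congr' ?_ ?_
    · filter_upwards [Ioo_mem_nhdsGT (zero_lt_one' ℝ)] with t ht
      simp [hJ, ht.1, ht.2.le]
    · exact Eventually.of_forall fun t => by simp
  have hd : ∀ s : ℂ, 0 < s.re → DifferentiableAt ℂ (mellin F) s := fun s hs =>
    mellin_differentiableAt_of_isBigO_rpow_exp one_pos hFl htop hFbot hs
  refine ⟨hd, ?_⟩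
  have hG0 : DifferentiableAt ℂ (mellin fun t => F t - V * J t) 0 :=
    mellin_differentiableAt_of_isBigO_rpow_exp one_pos hGl hGtop hGbot (by simp)
  have he : ∀ s : ℝ, 0 < s → (s : ℂ) * mellin F s
      = s * mellin (fun t => F t - V * J t) s + V := by
    intro s hs
    have hs' : 0 < (s : ℂ).re := by simpa using hs
    have h1 : MellinConvergent F s :=
      mellinConvergent_of_isBigO_rpow_exp one_pos hFl htop hFbot hs'
    have h2 := hasMellin_const_smul (hasMellin_one_Ioc hs').1 V
    have h3 := (hasMellin_sub h1 h2.1).2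
    rw [h2.2, (hasMellin_one_Ioc hs').2] at h3
    simp only [smul_eq_mul] at h3
    rw [h3]
    have : (s : ℂ) ≠ 0 := by exact_mod_cast hs.ne'
    field_simp
    ring
  have hc : Tendsto (fun s : ℝ => (s : ℂ)) (𝓝[>] 0) (𝓝 0) :=
    (continuous_ofReal.tendsto' 0 0 rfl).mono_left nhdsWithin_le_nhds
  have h4 := (hc.mul (hG0.continuousAt.tendsto.comp hc)).add_const V
  rw [zero_mul, zero_add] at h4
  refine h4.congr' ?_
  filter_upwards [self_mem_nhdsWithin] with s hs
  exact (he s hs).symm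

theorem hasSum_of_eq {ι : Type*} {f g : ι → ℂ} {a : ℂ} (h : HasSum f a) (hfg : ∀ i, g i = f i) :
    HasSum g a :=
  (funext hfg : g = f) ▸ h

theorem tendsto_ofReal_mul_Gamma :
    Tendsto (fun s : ℝ => (s : ℂ) * Complex.Gamma s) (𝓝[>] 0) (𝓝 1) := by
  refine Complex.tendsto_self_mul_Gamma_nhds_zero.comp ?_
  refine tendsto_nhdsWithin_iff.2 ⟨(continuous_ofReal.tendsto' 0 0 rfl).mono_left
    nhdsWithin_le_nhds, ?_⟩
  filter_upwards [self_mem_nhdsWithin] with s hs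
  exact ofReal_ne_zero.2 (ne_of_gt hs)

/-! ### The phase of the exponential zeta function at one -/

/-- An Abel-type argument: the function -log(1 - w exp(-t)) has Mellin transform Γ(s) times the
exponential zeta function at s + 1. Comparing the two limits of s times this transform gives the
value at 1; away from x = 0 there is no pole. -/
theorem expZeta_one {x : ℝ} (hx : (x : UnitAddCircle) ≠ 0) :
    HurwitzZeta.expZeta x 1 = -Complex.log (1 - cexp (2 * Real.pi * I * x)) := by
  set w := cexp (2 * Real.pi * I * x) with hw
  have hwn : ‖w‖ = 1 := by
    rw [hw, show 2 * Real.pi * I * x = ((2 * Real.pi * x : ℝ) : ℂ) * I by push_cast; ring]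
    exact Complex.norm_exp_ofReal_mul_I _
  have hw1 : w ≠ 1 := by
    intro h
    obtain ⟨n, hn⟩ := Complex.exp_eq_one_iff.1 h
    apply hx
    have h2 : (x : ℂ) = n := by
      have : (2 * Real.pi * I : ℂ) ≠ 0 := by simp [Real.pi_ne_zero]
      apply mul_left_cancel₀ this
      rw [hn]; ring
    have h3 : x = n := by exact_mod_cast h2
    rw [h3]
    exact (AddCircle.coe_eq_zero_iff 1).2 ⟨n, by simp⟩
  have hslit : ∀ u : ℝ, 0 ≤ u → u ≤ 1 → 1 - w * u ∈ Complex.slitPlane := by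
    intro u hu0 hu1
    left
    have hre : w.re < 1 := by
      refine lt_of_le_of_ne (hwn ▸ Complex.re_le_norm w) fun h => hw1 ?_
      have h1 := Complex.sq_norm_sub_sq_re w
      rw [hwn, h] at h1
      have : w.im = 0 := by nlinarith
      exact Complex.ext (by simpa using h) (by simpa using this)
    simp only [sub_re, one_re, mul_re, ofReal_re, ofReal_im, mul_zero, sub_zero]
    rcases hu0.eq_or_lt with rfl | h0
    · simp
    · nlinarith
  let Λ : ℝ → ℂ := fun u => -Complex.log (1 - w * u)
  have hΛ : ∀ u : ℝ, 0 ≤ u → u ≤ 1 → DifferentiableAt ℝ Λ u := by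
    intro u h0 h1
    have h2 : HasDerivAt (fun u : ℝ => 1 - w * (u : ℂ)) (-(w * 1)) u :=
      ((Complex.ofRealCLM.hasDerivAt (x := u)).const_mul w).const_sub 1
    exact ((h2.clog_real (hslit u h0 h1)).neg).differentiableAt
  let F : ℝ → ℂ := fun t => Λ (Real.exp (-t))
  have hFd : ∀ t : ℝ, 0 ≤ t → DifferentiableAt ℝ F t := fun t ht =>
    DifferentiableAt.comp (g := Λ) t
      (hΛ _ (Real.exp_pos _).le (Real.exp_le_one_iff.2 (neg_nonpos.2 ht))) (by fun_prop)
  have hexp : Tendsto (fun t : ℝ => Real.exp (-t)) atTop (𝓝 0) := Real.tendsto_exp_neg_atTop_nhds_zero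
  have htop : F =O[atTop] fun t : ℝ => Real.exp (-1 * t) := by
    have h := (hΛ 0 le_rfl zero_le_one).isBigO_sub.comp_tendsto hexp
    simpa [F, Λ, Function.comp_def] using h
  have hbot : (fun t => F t - -Complex.log (1 - w)) =O[𝓝[>] 0] fun t : ℝ => t := by
    have h := (hFd 0 le_rfl).isBigO_sub.mono (nhdsWithin_le_nhds (s := Set.Ioi 0))
    simpa [F, Λ] using h
  have hmain := (tendsto_mul_mellin (fun t ht => (hFd t (le_of_lt ht)).continuousAt.continuousWithinAt)
    htop hbot).2
  have hm : ∀ s : ℝ, 0 < s → mellin F s = Complex.Gamma s * HurwitzZeta.expZeta x (s + 1) := by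
    intro s hs
    have hs1 : (s : ℂ) + 1 ≠ 0 := by
      have : s + 1 ≠ 0 := by positivity
      exact_mod_cast this
    have h1 : HasSum (fun n : ℕ => Complex.Gamma s * (w ^ n / n) / ((n : ℝ) : ℂ) ^ (s : ℂ))
        (mellin F s) := by
      refine hasSum_mellin (fun i => ?_) (by simpa using hs) (fun t ht => ?_) ?_
      · rcases Nat.eq_zero_or_pos i with rfl | hi
        · left; simp
        · right; exact_mod_cast hi
      · have h := Complex.hasSum_taylorSeries_neg_log (z := w * (Real.exp (-t) : ℝ)) (by
          rw [norm_mul, hwn, one_mul, Complex.norm_real, Real.norm_of_nonneg (Real.exp_pos _).le]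
          exact Real.exp_lt_one_iff.2 (by simpa using ht))
        refine hasSum_of_eq h fun n => ?_
        rw [mul_pow, ← ofReal_pow, ← Real.exp_nat_mul]
        rw [show (n : ℝ) * -t = -(n : ℝ) * t by ring]
        ring
      · have h := Real.summable_nat_rpow_inv.2 (show 1 < s + 1 by linarith)
        refine h.congr fun n => ?_
        rcases Nat.eq_zero_or_pos n with rfl | hn
        · simp [Real.zero_rpow (show s + 1 ≠ 0 by positivity)]
        · have hn' : (0 : ℝ) < n := by exact_mod_cast hn
          rw [norm_div, norm_pow, hwn, one_pow, Complex.norm_natCast, ofReal_re,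
            Real.rpow_add_one hn'.ne']
          field_simp
    refine h1.unique (hasSum_of_eq ((HurwitzZeta.hasSum_expZeta_of_one_lt_re x (s := s + 1)
      (by simpa using hs)).mul_left (Complex.Gamma s)) fun n => ?_)
    rcases Nat.eq_zero_or_pos n with rfl | hn
    · simp [Complex.zero_cpow hs1]
    · have hn' : (n : ℂ) ≠ 0 := by exact_mod_cast hn.ne'
      rw [Complex.cpow_add _ _ hn', cpow_one, hw, ← Complex.exp_nat_mul, ofReal_natCast,
        mul_comm (n : ℂ) (2 * Real.pi * I * x)]
      have := (Complex.cpow_ne_zero_iff_of_exponent_ne_zero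
        (show (s : ℂ) ≠ 0 by exact_mod_cast hs.ne')).2 hn'
      field_simp
  have hc : Tendsto (fun s : ℝ => HurwitzZeta.expZeta x (s + 1)) (𝓝[>] 0)
      (𝓝 (HurwitzZeta.expZeta x 1)) := by
    have h1 := (HurwitzZeta.differentiable_expZeta_of_ne_zero hx).continuous
    have h2 : Continuous fun s : ℝ => HurwitzZeta.expZeta x (s + 1) := by fun_prop
    exact (h2.tendsto' 0 _ (by simp)).mono_left nhdsWithin_le_nhds
  have h5 := tendsto_ofReal_mul_Gamma.mul hc
  rw [one_mul] at h5
  refine tendsto_nhds_unique (h5.congr' ?_) hmain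
  filter_upwards [self_mem_nhdsWithin] with s hs
  rw [hm s hs]
  ring

/-- The rational multiples of `2 π i`. -/
def IsRationalPhase (z : ℂ) : Prop := ∃ q : ℚ, z = 2 * Real.pi * I * q

theorem IsRationalPhase.add {z w : ℂ} (hz : IsRationalPhase z) (hw : IsRationalPhase w) :
    IsRationalPhase (z + w) := by
  obtain ⟨p, rfl⟩ := hz
  obtain ⟨q, rfl⟩ := hw
  exact ⟨p + q, by push_cast; ring⟩

theorem IsRationalPhase.ratCast_mul {z : ℂ} (hz : IsRationalPhase z) (q : ℚ) :
    IsRationalPhase (q * z) := by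
  obtain ⟨p, rfl⟩ := hz
  exact ⟨q * p, by push_cast; ring⟩

theorem IsRationalPhase.sum {ι : Type*} {s : Finset ι} {f : ι → ℂ}
    (h : ∀ i ∈ s, IsRationalPhase (f i)) : IsRationalPhase (∑ i ∈ s, f i) :=
  Finset.sum_induction f IsRationalPhase (fun _ _ => IsRationalPhase.add) ⟨0, by simp⟩ h

theorem isRationalPhase_iff {z : ℂ} : IsRationalPhase z ↔ IsRootOfUnity (cexp z) := by
  constructor
  · rintro ⟨q, rfl⟩
    refine ⟨q.den, q.den_pos, ?_⟩
    rw [← Complex.exp_nat_mul, Complex.exp_eq_one_iff]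
    refine ⟨q.num, ?_⟩
    have h : (q.den : ℂ) * (q : ℂ) = q.num := by exact_mod_cast Rat.den_mul_eq_num q
    rw [← h]; ring
  · rintro ⟨n, hn, h⟩
    rw [← Complex.exp_nat_mul, Complex.exp_eq_one_iff] at h
    obtain ⟨k, hk⟩ := h
    have hn' : (n : ℂ) ≠ 0 := by exact_mod_cast hn.ne'
    refine ⟨k / n, ?_⟩
    push_cast
    field_simp
    linear_combination hk

/-- Twice the quantity is log(1 - w⁻¹) - log(1 - w), whose exponential is (1 - w⁻¹)/(1 - w) = -w⁻¹,
a root of unity. Being a rational multiple of 2πi does not depend on the branches. At x = 0 the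
value is 0 by oddness. -/
theorem isRationalPhase_sinZeta (q : ℚ) :
    IsRationalPhase (I * HurwitzZeta.sinZeta ((q : ℝ) : UnitAddCircle) 1) := by
  by_cases hx : ((q : ℝ) : UnitAddCircle) = 0
  · refine ⟨0, ?_⟩
    have h := HurwitzZeta.sinZeta_neg 0 1
    rw [neg_zero, eq_neg_iff_add_eq_zero, ← two_mul] at h
    rw [hx, (mul_eq_zero.1 h).resolve_left two_ne_zero]
    simp
  have hx' : ((-(q : ℝ) : ℝ) : UnitAddCircle) ≠ 0 := by
    rw [AddCircle.coe_neg]; exact neg_ne_zero.2 hx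
  set w := cexp (2 * Real.pi * I * (q : ℝ)) with hw
  have h2 : 2 * (I * HurwitzZeta.sinZeta ((q : ℝ) : UnitAddCircle) 1)
      = Complex.log (1 - w⁻¹) - Complex.log (1 - w) := by
    rw [HurwitzZeta.sinZeta_eq, ← AddCircle.coe_neg, expZeta_one hx, expZeta_one hx', hw,
      ← Complex.exp_neg]
    push_cast
    have := I_ne_zero
    field_simp
    ring_nf
  have hw1 : w ≠ 1 := by
    intro h
    obtain ⟨n, hn⟩ := Complex.exp_eq_one_iff.1 h
    apply hx
    have h2 : ((q : ℝ) : ℂ) = n := by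
      have : (2 * Real.pi * I : ℂ) ≠ 0 := by simp [Real.pi_ne_zero]
      apply mul_left_cancel₀ this
      rw [hn]; ring
    have h3 : (q : ℝ) = n := by exact_mod_cast h2
    rw [h3]
    exact (AddCircle.coe_eq_zero_iff 1).2 ⟨n, by simp⟩
  have hw0 : w ≠ 0 := Complex.exp_ne_zero _
  have h3 : IsRationalPhase (2 * (I * HurwitzZeta.sinZeta ((q : ℝ) : UnitAddCircle) 1)) := by
    rw [isRationalPhase_iff, h2, Complex.exp_sub, Complex.exp_log, Complex.exp_log]
    · have h4 : (1 - w⁻¹) / (1 - w) = cexp (2 * Real.pi * I * ((1 / 2 - q : ℚ) : ℂ)) := by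
        have h5 : cexp (2 * Real.pi * I * ((1 / 2 - q : ℚ) : ℂ)) = -w⁻¹ := by
          rw [hw, ← Complex.exp_neg, ← neg_one_mul, ← Complex.exp_pi_mul_I, ← Complex.exp_add]
          congr 1
          push_cast
          ring
        rw [h5]
        have : 1 - w ≠ 0 := sub_ne_zero.2 (Ne.symm hw1)
        field_simp
        ring
      rw [h4, ← isRationalPhase_iff]
      exact ⟨_, rfl⟩
    · exact sub_ne_zero.2 (Ne.symm hw1)
    · exact sub_ne_zero.2 (Ne.symm (inv_ne_one.2 hw1))
  have h4 := h3.ratCast_mul (1 / 2)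
  have h5 : (((1 / 2 : ℚ) : ℚ) : ℂ) * (2 * (I * HurwitzZeta.sinZeta ((q : ℝ) : UnitAddCircle) 1))
      = I * HurwitzZeta.sinZeta ((q : ℝ) : UnitAddCircle) 1 := by
    push_cast; ring
  rwa [h5] at h4

/-! ### The expansion of the potential at a cusp -/

/-- An additive version of `exists_quantum_mobius`: the Mellin transform sees the potential itself,
not its exponential. -/
theorem exists_potential_mobius {a b c d : ℤ} (h : a * d - b * c = 1) (hc : ¬ (6 : ℤ) ∣ c) :
    ∃ (u : ℕ × ℕ → ℂ) (V : ℂ), PolyGrowth u ∧ ∀ w : ℂ, 0 < w.im →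
      potential ((a * w + b) / (c * w + d))
        = 2 * Real.pi * I * ((a * w + b) / (c * w + d)) - eichler u c d w + V := by
  obtain ⟨u, hu, hE⟩ := exists_formE_mobius h hc
  obtain ⟨V, hV⟩ := exists_eq_of_hasDerivAt_zero (f := fun w =>
    potential ((a * w + b) / (c * w + d)) - (2 * Real.pi * I * ((a * w + b) / (c * w + d))
      - eichler u c d w)) fun w hw => by
    have hj := cocycle_ne_zero h hw
    have h1 := HasDerivAt.comp (h₂ := potential) w (hasDerivAt_potential (im_mobius_pos h hw))
      (hasDerivAt_mobius h hw)
    refine (h1.fun_sub (((hasDerivAt_mobius h hw).const_mul (2 * Real.pi * I)).fun_sub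
      (hasDerivAt_eichler hu c d hw))).congr_deriv ?_
    rw [hE w hw]
    field_simp
    ring
  exact ⟨u, V, hu, fun w hw => by rw [← hV w hw]; ring⟩

/-- On the vertical line through the zero of cw + d the linear factor grows only like y, which
exponential decay outweighs. The rate y⁻¹ becomes the O(t) required by `tendsto_mul_mellin`. -/
theorem eichler_isBigO {u : ℕ × ℕ → ℂ} (hu : PolyGrowth u) {c : ℝ} (d : ℂ) {x : ℝ}
    (hx : c * x + d = 0) :
    (fun y : ℝ => eichler u c d (x + y * I)) =O[atTop] fun y : ℝ => y⁻¹ := by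
  have hY : Tendsto (fun y : ℝ => (x : ℂ) + y * I) atTop cuspInf :=
    tendsto_comap_iff.2 (tendsto_id.congr fun y => by simp)
  have hdec : ∀ v : ℕ × ℕ → ℂ, PolyGrowth v →
      (fun y : ℝ => lambert v (nome ((x + y * I) / 6))) =O[atTop] fun y : ℝ => y ^ (-2 : ℝ) := by
    intro v hv
    have h1 := (hv.isBigO (g := 1) fun p hp => absurd hp (by have := lamExp_pos p; omega)).comp_tendsto hY
    refine h1.trans ?_
    have h2 := (isLittleO_exp_neg_mul_rpow_atTop (show 0 < Real.pi / 3 by positivity) (-2)).isBigO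
    refine h2.congr_left fun y => ?_
    simp only [Function.comp, decay]
    congr 1
    have : ((x : ℂ) + y * I).im = y := by simp
    rw [this]
    push_cast
    ring
  have h1 := hdec _ hu.div_lamExp
  have h2 := hdec _ hu.div_lamExp.div_lamExp
  have e1 : (fun y : ℝ => y * y ^ (-2 : ℝ)) =ᶠ[atTop] fun y : ℝ => y⁻¹ := by
    filter_upwards [eventually_gt_atTop 0] with y hy
    rw [Real.rpow_neg hy.le, Real.rpow_two]
    field_simp
  have e2 : (fun y : ℝ => y ^ (-2 : ℝ)) =O[atTop] fun y : ℝ => y⁻¹ := by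
    refine IsBigO.of_bound 1 ?_
    filter_upwards [eventually_ge_atTop 1] with y hy
    have hy0 : 0 < y := by linarith
    rw [Real.rpow_neg hy0.le, Real.rpow_two, one_mul, norm_inv, norm_inv, norm_pow,
      Real.norm_of_nonneg hy0.le]
    exact inv_anti₀ hy0 (by nlinarith)
  have h3 : (fun y : ℝ => (c * (x + y * I) + d : ℂ)) =O[atTop] fun y : ℝ => y := by
    refine IsBigO.of_bound |c| (Eventually.of_forall fun y => ?_)
    rw [show (c * (x + y * I) + d : ℂ) = c * (y * I) by linear_combination hx]
    simp
  have h4 := ((h3.mul h1).congr' EventuallyEq.rfl e1).const_mul_left 6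
  have h5 := (h2.trans e2).const_mul_left (c * (36 / (2 * Real.pi * I)))
  exact h4.sub h5

/-- The potential on the vertical line above a cusp not equivalent to `i∞`. -/
theorem exists_potential_vertical {a c : ℤ} (hac : IsCoprime a c) (hc : ¬ (6 : ℤ) ∣ c) :
    ∃ V : ℂ, (fun t : ℝ => potential ((a / c : ℝ) + (t / (2 * Real.pi) : ℝ) * I) - V)
      =O[𝓝[>] 0] fun t : ℝ => t := by
  obtain ⟨d, b, hdb⟩ := hac
  have h : a * d - (-b) * c = 1 := by linear_combination hdb
  have hc0 : c ≠ 0 := by rintro rfl; simp at hc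
  have hcR : (c : ℝ) ≠ 0 := by exact_mod_cast hc0
  have hcC : (c : ℂ) ≠ 0 := by exact_mod_cast hc0
  obtain ⟨u, V, hu, hV⟩ := exists_potential_mobius h hc
  -- The matrix maps the vertical line above -d/c to the one above a/c and sends height y to 1/(c²
  -- y). Height t/(2π) therefore corresponds to y = 2π/(c² t).
  have hE := eichler_isBigO hu (c := c) d (x := -(d / c : ℝ)) (by push_cast; field_simp; ring)
  have hpi := Real.pi_pos
  have ht : Tendsto (fun t : ℝ => 2 * Real.pi / c ^ 2 * t⁻¹) (𝓝[>] 0) atTop :=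
    tendsto_inv_nhdsGT_zero.const_mul_atTop (by positivity)
  have hE' := hE.comp_tendsto ht
  have hE'' : (fun t : ℝ => ((2 * Real.pi / c ^ 2 * t⁻¹)⁻¹ : ℝ)) =O[𝓝[>] 0] fun t : ℝ => t := by
    refine ((isBigO_refl (fun t : ℝ => t) _).const_mul_left (2 * Real.pi / c ^ 2)⁻¹).congr_left
      fun t => ?_
    rw [mul_inv, inv_inv]
  have hlin : (fun t : ℝ => (-t : ℂ)) =O[𝓝[>] 0] fun t : ℝ => t :=
    IsBigO.of_bound 1 (Eventually.of_forall fun t => by simp)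
  refine ⟨2 * Real.pi * I * (a / c) + V, (hlin.sub (hE'.trans hE'')).congr' ?_ EventuallyEq.rfl⟩
  filter_upwards [self_mem_nhdsWithin] with t ht
  have ht0 : 0 < t := ht
  have htC : (t : ℂ) ≠ 0 := by exact_mod_cast ht0.ne'
  have hpiC : (Real.pi : ℂ) ≠ 0 := by exact_mod_cast hpi.ne'
  have hw := hV (-(d / c : ℝ) + (2 * Real.pi / c ^ 2 * t⁻¹ : ℝ) * I) (by
    have : 0 < 2 * Real.pi / c ^ 2 * t⁻¹ := by positivity
    rwa [add_im, neg_im, ofReal_im, mul_I_im, ofReal_re, neg_zero, zero_add])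
  have hcd : (c : ℂ) * (-(d / c : ℝ) + (2 * Real.pi / c ^ 2 * t⁻¹ : ℝ) * I) + d
      = 2 * Real.pi / (c * t) * I := by
    push_cast; field_simp; ring
  have hz : ((a : ℂ) * (-(d / c : ℝ) + (2 * Real.pi / c ^ 2 * t⁻¹ : ℝ) * I) + (-b : ℤ)) /
      (2 * Real.pi / (c * t) * I) = (a / c : ℝ) + (t / (2 * Real.pi) : ℝ) * I := by
    have h1 : (d * a + b * c : ℂ) = 1 := by exact_mod_cast hdb
    have hI := I_ne_zero
    push_cast
    rw [div_eq_iff (by simp [hpiC, hcC, htC])]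
    field_simp
    linear_combination (-t * c : ℂ) * h1 - (t * c : ℂ) * I_sq
  rw [hcd, hz] at hw
  simp only [Function.comp, ofReal_neg]
  rw [hw]
  push_cast
  have h2 : 2 * Real.pi * I * (a / c + t / (2 * Real.pi) * I) = 2 * Real.pi * I * (a / c) - t := by
    field_simp
    linear_combination (t * c : ℂ) * I_sq
  rw [h2]
  ring

/-! ### The Mellin transform of the potential -/

theorem nome_vertical (r t : ℝ) :
    nome ((r : ℂ) + (t / (2 * Real.pi) : ℝ) * I) = nome r * Real.exp (-t) := by
  have hpi : (Real.pi : ℂ) ≠ 0 := by exact_mod_cast Real.pi_ne_zero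
  rw [nome, nome, ofReal_exp, ← Complex.exp_add]
  congr 1
  push_cast
  field_simp
  linear_combination (t : ℂ) * I_sq

theorem norm_nome_ofReal (r : ℝ) : ‖nome r‖ = 1 := by
  rw [norm_nome]; simp

theorem hasSum_potential (r : ℝ) {t : ℝ} (ht : 0 < t) :
    HasSum (fun p : ℕ × ℕ => psiCoeff p / lamExp p * nome r ^ lamExp p
      * (Real.exp (-(lamExp p : ℝ) * t) : ℝ)) (potential (r + (t / (2 * Real.pi) : ℝ) * I)) := by
  have hq : ‖nome ((r : ℂ) + (t / (2 * Real.pi) : ℝ) * I)‖ < 1 := by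
    rw [nome_vertical, norm_mul, norm_nome_ofReal, one_mul, Complex.norm_real,
      Real.norm_of_nonneg (Real.exp_pos _).le]
    exact Real.exp_lt_one_iff.2 (by linarith)
  refine hasSum_of_eq (polyGrowth_psiCoeff.div_lamExp.summable hq).hasSum fun p => ?_
  rw [nome_vertical, mul_pow, ← ofReal_pow, ← Real.exp_nat_mul, mul_assoc,
    show (lamExp p : ℝ) * -t = -(lamExp p : ℝ) * t by ring]

/-- With k, l ≥ 1 the coefficient has absolute value at most l/k ≤ l, which leaves k^(-σ) · l^(1-σ).
Convergence of the sum over l is what asks for σ > 2. -/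
theorem summable_psiCoeff_div_rpow (r : ℝ) {σ : ℝ} (hσ : 2 < σ) :
    Summable fun p : ℕ × ℕ =>
      ‖psiCoeff p / lamExp p * nome r ^ lamExp p‖ / (lamExp p : ℝ) ^ σ := by
  have h1 : Summable fun n : ℕ => (((n : ℝ) + 1) ^ σ)⁻¹ := by
    have := (summable_nat_add_iff 1).2 (Real.summable_nat_rpow_inv.2 (show 1 < σ by linarith))
    simpa using this
  have h2 : Summable fun n : ℕ => (((n : ℝ) + 1) ^ (σ - 1))⁻¹ := by
    have := (summable_nat_add_iff 1).2 (Real.summable_nat_rpow_inv.2 (show 1 < σ - 1 by linarith))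
    simpa using this
  refine Summable.of_nonneg_of_le (fun p => by positivity) (fun p => ?_)
    (h1.mul_of_nonneg h2 (fun n => by positivity) (fun n => by positivity))
  have hl : (0 : ℝ) < (p.2 : ℝ) + 1 := by positivity
  have hk : (1 : ℝ) ≤ (p.1 : ℝ) + 1 := by simp
  have hk0 : (0 : ℝ) < (p.1 : ℝ) + 1 := by positivity
  have e1 : (lamExp p : ℝ) = ((p.1 : ℝ) + 1) * ((p.2 : ℝ) + 1) := by simp [lamExp]
  have e2 : ‖psiCoeff p / lamExp p * nome r ^ lamExp p‖ ≤ (p.2 : ℝ) + 1 := by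
    rw [norm_mul, norm_pow, norm_nome_ofReal, one_pow, mul_one, norm_div, Complex.norm_natCast, e1,
      psiCoeff, norm_mul, norm_pow, div_le_iff₀ (by positivity)]
    have h3 : ‖(p.2 : ℂ) + 1‖ = (p.2 : ℝ) + 1 := by
      rw [← Nat.cast_succ, Complex.norm_natCast]; simp
    rw [h3]
    calc ‖(psi (p.2 + 1) : ℂ)‖ * ((p.2 : ℝ) + 1) ^ 2 ≤ 1 * ((p.2 : ℝ) + 1) ^ 2 := by
          gcongr; exact norm_psi_le _
      _ ≤ ((p.2 : ℝ) + 1) * (((p.1 : ℝ) + 1) * ((p.2 : ℝ) + 1)) := by nlinarith [mul_pos hl hl]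
  calc _ ≤ ((p.2 : ℝ) + 1) / (lamExp p : ℝ) ^ σ := by gcongr
    _ = _ := by
      rw [e1, Real.mul_rpow hk0.le hl.le, Real.rpow_sub_one hl.ne']
      field_simp

theorem psi_mod (l : ℕ) {N : ℕ} (hN : 6 ∣ N) : psi (l % N) = psi l := by
  unfold psi
  rw [Nat.mod_mod_of_dvd _ hN]

theorem hasSum_expZeta_succ (x : ℝ) {s : ℂ} (hs : 1 < s.re) :
    HasSum (fun k : ℕ => cexp (2 * Real.pi * I * x * (k + 1 : ℕ)) / ((k + 1 : ℕ) : ℂ) ^ s)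
      (HurwitzZeta.expZeta x s) := by
  have h := HurwitzZeta.hasSum_expZeta_of_one_lt_re x hs
  rw [← hasSum_nat_add_iff' 1] at h
  have hs0 : s ≠ 0 := by rintro rfl; norm_num at hs
  simpa [Complex.zero_cpow hs0] using h

/-- For fixed l the sum over k is the exponential zeta function at la/c in s + 1, which depends only
on l modulo c. The sum over l is then the L-function at s - 1 of a function on ℤ/cm; the factor m
makes the modulus a multiple of the period 6 of ψ. -/
theorem mellin_potential (a : ℤ) (c m : ℕ) [NeZero (c * m)] (h6 : 6 ∣ c * m) {s : ℂ}
    (hs : 2 < s.re) :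
    mellin (fun t : ℝ => potential ((a / c : ℝ) + (t / (2 * Real.pi) : ℝ) * I)) s
      = Complex.Gamma s * ZMod.LFunction (fun b : ZMod (c * m) => (psi b.val : ℂ) *
          HurwitzZeta.expZeta (ZMod.toAddCircle (((a * m : ℤ) : ZMod (c * m)) * b)) (s + 1))
          (s - 1) := by
  set r : ℝ := a / c with hr
  have h1 := hasSum_mellin (a := fun p : ℕ × ℕ => psiCoeff p / lamExp p * nome r ^ lamExp p)
    (p := fun p => (lamExp p : ℝ)) (s := s)
    (F := fun t : ℝ => potential (r + (t / (2 * Real.pi) : ℝ) * I))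
    (fun p => Or.inr (by exact_mod_cast lamExp_pos p)) (by linarith)
    (fun t ht => hasSum_potential r ht) (summable_psiCoeff_div_rpow r hs)
  have hm0 : (m : ℝ) ≠ 0 := by
    have := NeZero.ne (c * m); exact_mod_cast (mul_ne_zero_iff.1 this).2
  have hc0 : (c : ℝ) ≠ 0 := by
    have := NeZero.ne (c * m); exact_mod_cast (mul_ne_zero_iff.1 this).1
  set Z : ZMod (c * m) → ℂ := fun b =>
    HurwitzZeta.expZeta (ZMod.toAddCircle (((a * m : ℤ) : ZMod (c * m)) * b)) (s + 1) with hZ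
  have hfib : ∀ l : ℕ, HasSum (fun k : ℕ => Complex.Gamma s *
      (psiCoeff (k, l) / lamExp (k, l) * nome r ^ lamExp (k, l)) / ((lamExp (k, l) : ℝ) : ℂ) ^ s)
      (Complex.Gamma s * (psi (l + 1) * Z ((l + 1 : ℕ) : ZMod (c * m))
        / ((l + 1 : ℕ) : ℂ) ^ (s - 1))) := by
    intro l
    have hx : ZMod.toAddCircle (((a * m : ℤ) : ZMod (c * m)) * ((l + 1 : ℕ) : ZMod (c * m)))
        = ((r * (l + 1 : ℕ) : ℝ) : UnitAddCircle) := by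
      have : ((a * m : ℤ) : ZMod (c * m)) * ((l + 1 : ℕ) : ZMod (c * m))
          = ((a * m * (l + 1 : ℕ) : ℤ) : ZMod (c * m)) := by push_cast; ring
      rw [this, ZMod.toAddCircle_intCast]
      congr 1
      rw [hr]
      push_cast
      field_simp
    have h2 := (hasSum_expZeta_succ (r * (l + 1 : ℕ)) (s := s + 1) (by
      simp; linarith)).mul_left (Complex.Gamma s * psi (l + 1) / ((l + 1 : ℕ) : ℂ) ^ (s - 1))
    rw [← hx] at h2
    have h3 : Complex.Gamma s * (psi (l + 1) * Z ((l + 1 : ℕ) : ZMod (c * m))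
        / ((l + 1 : ℕ) : ℂ) ^ (s - 1)) = Complex.Gamma s * psi (l + 1) / ((l + 1 : ℕ) : ℂ) ^ (s - 1)
          * Z ((l + 1 : ℕ) : ZMod (c * m)) := by ring
    rw [h3]
    refine hasSum_of_eq h2 fun k => ?_
    have hl : ((l + 1 : ℕ) : ℂ) ≠ 0 := Nat.cast_ne_zero.2 (by omega)
    have hk : ((k + 1 : ℕ) : ℂ) ≠ 0 := Nat.cast_ne_zero.2 (by omega)
    have e1 : ((lamExp (k, l) : ℝ) : ℂ) ^ s = ((k + 1 : ℕ) : ℂ) ^ s * ((l + 1 : ℕ) : ℂ) ^ s := by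
      rw [← Complex.natCast_mul_natCast_cpow]; simp [lamExp]
    have e2 : nome r ^ lamExp (k, l) = cexp (2 * Real.pi * I * (r * (l + 1 : ℕ) : ℝ) * (k + 1 : ℕ)) := by
      rw [nome, ← Complex.exp_nat_mul]
      congr 1
      simp [lamExp]
      ring
    have e3 : psiCoeff (k, l) / lamExp (k, l) = psi (l + 1) * ((l + 1 : ℕ) : ℂ) / ((k + 1 : ℕ) : ℂ) := by
      simp only [psiCoeff, lamExp]
      rw [← Nat.cast_succ, Nat.cast_mul]
      field_simp
    rw [e1, e2, e3, Complex.cpow_add _ _ hk, Complex.cpow_sub _ _ hl, cpow_one, cpow_one]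
    generalize cexp _ = E
    have hks : ((k + 1 : ℕ) : ℂ) ^ s ≠ 0 := fun h => hk ((Complex.cpow_eq_zero_iff _ _).1 h).1
    have hls : ((l + 1 : ℕ) : ℂ) ^ s ≠ 0 := fun h => hl ((Complex.cpow_eq_zero_iff _ _).1 h).1
    field_simp
  have h2 := (((Equiv.prodComm ℕ ℕ).hasSum_iff.2 h1).prod_fiberwise hfib)
  refine h2.unique (HasSum.mul_left _ ?_)
  have hs1 : 1 < (s - 1).re := by simp; linarith
  rw [ZMod.LFunction_eq_LSeries _ hs1]
  have h4 := (ZMod.LSeriesSummable_of_one_lt_re (fun b : ZMod (c * m) => (psi b.val : ℂ) * Z b) hs1).hasSum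
  rw [← hasSum_nat_add_iff' 1] at h4
  simp only [Finset.range_one, Finset.sum_singleton, LSeries.term_zero, sub_zero] at h4
  refine hasSum_of_eq h4 fun l => ?_
  rw [LSeries.term_of_ne_zero (by omega), ZMod.val_natCast, psi_mod _ h6]

/-! ### The continuation of the Mellin transform -/

theorem psi_val_neg {N : ℕ} [NeZero N] (h6 : 6 ∣ N) (b : ZMod N) : psi (-b).val = -psi b.val := by
  rw [ZMod.neg_val]
  split_ifs with h
  · subst h; simp [psi]
  · have hb := ZMod.val_lt b
    unfold psi
    obtain ⟨k, rfl⟩ := h6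
    split_ifs <;> omega

/-- The regular part of the Dirichlet series of the potential. -/
noncomputable def zetaSum (N : ℕ) [NeZero N] (j : ZMod N) (s : ℂ) : ℂ :=
  (N : ℂ) ^ (-(s - 1)) * ∑ b : ZMod N, (psi b.val : ℂ) *
    (HurwitzZeta.hurwitzZetaOdd (ZMod.toAddCircle b) (s - 1)
        * HurwitzZeta.cosZeta (ZMod.toAddCircle (j * b)) (s + 1)
      + I * (HurwitzZeta.hurwitzZetaEven (ZMod.toAddCircle b) (s - 1)
        * HurwitzZeta.sinZeta (ZMod.toAddCircle (j * b)) (s + 1)))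

/-- Since ψ is odd, pairing b with -b kills the products even × cosine and odd × sine. -/
theorem LFunction_eq_zetaSum {N : ℕ} [NeZero N] (h6 : 6 ∣ N) (j : ZMod N) (s : ℂ) :
    ZMod.LFunction (fun b : ZMod N => (psi b.val : ℂ) *
      HurwitzZeta.expZeta (ZMod.toAddCircle (j * b)) (s + 1)) (s - 1) = zetaSum N j s := by
  rw [ZMod.LFunction, zetaSum]
  congr 1
  rw [← sub_eq_zero, ← Finset.sum_sub_distrib]
  have hodd : ∀ f : ZMod N → ℂ, (∀ b, f (-b) = -f b) → ∑ b, f b = 0 := fun f hf => by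
    have h1 : ∑ b, f (-b) = ∑ b, f b := Equiv.sum_comp (Equiv.neg _) f
    simp only [hf, Finset.sum_neg_distrib] at h1
    exact self_eq_neg.1 h1.symm
  refine hodd _ fun b => ?_
  simp only [psi_val_neg h6, mul_neg, map_neg, HurwitzZeta.expZeta, HurwitzZeta.hurwitzZeta,
    HurwitzZeta.hurwitzZetaOdd_neg, HurwitzZeta.hurwitzZetaEven_neg, HurwitzZeta.cosZeta_neg,
    HurwitzZeta.sinZeta_neg]
  push_cast
  ring

/-- The two excluded points are the possible pole of the cosine zeta function at s + 1 = 1 and that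
of the even Hurwitz zeta function at s - 1 = 1. -/
theorem differentiableAt_zetaSum {N : ℕ} [NeZero N] (j : ZMod N) {s : ℂ} (h0 : s ≠ 0) (h2 : s ≠ 2) :
    DifferentiableAt ℂ (zetaSum N j) s := by
  have hN : (N : ℂ) ≠ 0 := Nat.cast_ne_zero.2 (NeZero.ne N)
  have hs1 : DifferentiableAt ℂ (fun s : ℂ => s - 1) s := by fun_prop
  have hs2 : DifferentiableAt ℂ (fun s : ℂ => s + 1) s := by fun_prop
  refine DifferentiableAt.fun_mul (DifferentiableAt.const_cpow (by fun_prop) (Or.inl hN))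
    (DifferentiableAt.fun_sum fun b _ => DifferentiableAt.const_mul (DifferentiableAt.fun_add
      (DifferentiableAt.fun_mul ?_ ?_)
      (DifferentiableAt.const_mul (DifferentiableAt.fun_mul ?_ ?_) _)) _)
  · exact (HurwitzZeta.differentiable_hurwitzZetaOdd _ _).fun_comp' s hs1
  · exact (HurwitzZeta.differentiableAt_cosZeta _ (Or.inl (by simpa using h0))).fun_comp' s hs2
  · refine (HurwitzZeta.differentiableAt_hurwitzZetaEven _ ?_).fun_comp' s hs1
    intro h; apply h2; linear_combination h
  · exact (HurwitzZeta.differentiableAt_sinZeta _ _).fun_comp' s hs2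

/-- The map (x, y) ↦ (exp x, y) carries the plane without one point onto this set. -/
theorem isPreconnected_re_pos_diff :
    IsPreconnected {s : ℂ | 0 < s.re ∧ s ≠ 2} := by
  have h := (isConnected_compl_singleton_of_one_lt_rank (E := ℂ) (by simp)
    ((Real.log 2 : ℝ) : ℂ)).isPreconnected
  have h1 := h.image (fun z : ℂ => ((Real.exp z.re : ℝ) : ℂ) + z.im * I) (by fun_prop)
  have hre : ∀ x y : ℝ, ((x : ℂ) + y * I).re = x := by simp
  have him : ∀ x y : ℝ, ((x : ℂ) + y * I).im = y := by simp
  convert h1 using 1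
  ext s
  constructor
  · rintro ⟨hs, hs2⟩
    refine ⟨(Real.log s.re : ℝ) + s.im * I, fun h => hs2 ?_, ?_⟩
    · have h2 := congrArg Complex.re h
      have h3 := congrArg Complex.im h
      rw [hre, ofReal_re] at h2
      rw [him, ofReal_im] at h3
      have h4 : s.re = 2 := Real.log_injOn_pos hs (by norm_num : (0 : ℝ) < 2) h2
      exact Complex.ext (by simpa using h4) (by simpa using h3)
    · simp only [hre, him, Real.exp_log hs]
      exact Complex.re_add_im s
  · rintro ⟨z, hz, rfl⟩
    refine ⟨by simp only [hre]; exact Real.exp_pos _, fun h => hz ?_⟩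
    have h2 := congrArg Complex.re h
    have h3 := congrArg Complex.im h
    simp only [hre, him] at h2 h3
    refine Complex.ext ?_ (by rw [h3, ofReal_im]; simp)
    rw [ofReal_re, ← Real.log_exp z.re, h2]
    simp

/-- Identity theorem on the punctured half plane: the formula, known for Re s > 2 by absolute
convergence, reaches the neighbourhood of s = 0 in Re s > 0. -/
theorem eqOn_zetaSum {N : ℕ} [NeZero N] (j : ZMod N) {M : ℂ → ℂ}
    (hM : ∀ s : ℂ, 0 < s.re → DifferentiableAt ℂ M s)
    (h : ∀ s : ℂ, 2 < s.re → M s = Complex.Gamma s * zetaSum N j s) {s : ℂ} (hs : 0 < s.re)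
    (hs2 : s ≠ 2) : M s = Complex.Gamma s * zetaSum N j s := by
  have hopen : IsOpen {s : ℂ | 0 < s.re ∧ s ≠ 2} :=
    (isOpen_lt continuous_const continuous_re).inter isOpen_ne
  have h1 : AnalyticOnNhd ℂ M {s : ℂ | 0 < s.re ∧ s ≠ 2} :=
    DifferentiableOn.analyticOnNhd (fun s hs => (hM s hs.1).differentiableWithinAt) hopen
  have h2 : AnalyticOnNhd ℂ (fun s => Complex.Gamma s * zetaSum N j s)
      {s : ℂ | 0 < s.re ∧ s ≠ 2} := by
    refine DifferentiableOn.analyticOnNhd (fun s hs => ?_) hopen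
    refine (DifferentiableAt.fun_mul (Complex.differentiableAt_Gamma _ fun m hm => ?_)
      (differentiableAt_zetaSum j (fun h0 => ?_) hs.2)).differentiableWithinAt
    · have := hs.1
      rw [hm] at this
      simp at this
      linarith [(Nat.cast_nonneg m : (0 : ℝ) ≤ m)]
    · have := hs.1
      simp [h0] at this
  refine h1.eqOn_of_preconnected_of_eventuallyEq h2 isPreconnected_re_pos_diff (z₀ := 3)
    ⟨by simp, by norm_num⟩ ?_ ⟨hs, hs2⟩
  filter_upwards [(isOpen_lt continuous_const continuous_re).mem_nhds
    (show (2 : ℝ) < (3 : ℂ).re by norm_num)] with s hs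
  exact h s hs

theorem toAddCircle_eq_ratCast {N : ℕ} [NeZero N] (b : ZMod N) :
    ZMod.toAddCircle b = (((b.val / N : ℚ) : ℝ) : UnitAddCircle) := by
  rw [ZMod.toAddCircle_apply]; push_cast; rfl

/-- The value is -B₂(b/N)/2, a Bernoulli polynomial at a rational point. -/
theorem exists_hurwitzZetaEven_neg_one {N : ℕ} [NeZero N] (b : ZMod N) :
    ∃ q : ℚ, HurwitzZeta.hurwitzZetaEven (ZMod.toAddCircle b) (-1) = q := by
  have h1 := HurwitzZeta.hurwitzZetaEven_one_sub_two_mul_nat (k := 1)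
    (x := ((b.val / N : ℚ) : ℝ)) one_ne_zero ⟨by positivity, by
      push_cast
      exact (div_le_one (Nat.cast_pos.mpr (NeZero.pos _))).mpr
        (Nat.cast_le.mpr (ZMod.val_lt b).le)⟩
  rw [← toAddCircle_eq_ratCast] at h1
  refine ⟨-1 / (2 * (1 : ℕ)) * (Polynomial.bernoulli (2 * 1)).eval (b.val / N : ℚ), ?_⟩
  rw [show (-1 : ℂ) = 1 - 2 * ((1 : ℕ) : ℂ) by norm_num, h1]
  have h2 : (((b.val / N : ℚ) : ℝ) : ℂ) = algebraMap ℚ ℂ (b.val / N : ℚ) := by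
    simp
  rw [h2, Polynomial.eval_map_algebraMap, Polynomial.aeval_algebraMap_apply]
  simp

theorem isRationalPhase_even_sin {N : ℕ} [NeZero N] (j b : ZMod N) :
    IsRationalPhase (I * (HurwitzZeta.hurwitzZetaEven (ZMod.toAddCircle b) (-1)
      * HurwitzZeta.sinZeta (ZMod.toAddCircle (j * b)) 1)) := by
  obtain ⟨q, hq⟩ := exists_hurwitzZetaEven_neg_one b
  rw [hq, toAddCircle_eq_ratCast (j * b), mul_left_comm]
  exact (isRationalPhase_sinZeta _).ratCast_mul q

/-- The odd Hurwitz zeta function has a trivial zero at -1. It is compensated only if the cosine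
zeta function has a pole at 1, that is for y = 0, where it is the Riemann zeta function with residue
1; zero times pole then leaves the derivative. -/
theorem tendsto_odd_mul_cos {x y : UnitAddCircle} :
    Tendsto (fun s : ℝ => HurwitzZeta.hurwitzZetaOdd x (s - 1) * HurwitzZeta.cosZeta y (s + 1))
      (𝓝[>] 0) (𝓝 (if y = 0 then deriv (HurwitzZeta.hurwitzZetaOdd x) (-1) else 0)) := by
  have hO := HurwitzZeta.differentiable_hurwitzZetaOdd x
  have hO1 : HurwitzZeta.hurwitzZetaOdd x (-1) = 0 := by
    simpa using HurwitzZeta.hurwitzZetaOdd_neg_two_mul_nat_sub_one x 0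
  split_ifs with hy
  · rw [hy, HurwitzZeta.cosZeta_zero]
    have h1 : Tendsto (fun s : ℝ => (s : ℂ)) (𝓝[>] 0) (𝓝[≠] 0) := by
      refine tendsto_nhdsWithin_iff.2 ⟨(continuous_ofReal.tendsto' 0 0 rfl).mono_left
        nhdsWithin_le_nhds, ?_⟩
      filter_upwards [self_mem_nhdsWithin] with s hs
      exact ofReal_ne_zero.2 (ne_of_gt hs)
    have h2 : Tendsto (fun s : ℂ => s + 1) (𝓝[≠] 0) (𝓝[≠] 1) := by
      refine tendsto_nhdsWithin_iff.2 ⟨((continuous_id.add continuous_const).tendsto' 0 1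
        (by simp)).mono_left nhdsWithin_le_nhds, ?_⟩
      filter_upwards [self_mem_nhdsWithin] with s hs
      simpa using hs
    have h3 := (riemannZeta_residue_one.comp h2).comp h1
    have h4 := ((hO (-1)).hasDerivAt.tendsto_slope_zero).comp h1
    have h5 := h4.mul h3
    rw [mul_one] at h5
    refine h5.congr' ?_
    filter_upwards [self_mem_nhdsWithin] with s hs
    have hs0 : (s : ℂ) ≠ 0 := ofReal_ne_zero.2 (ne_of_gt hs)
    simp only [Function.comp, hO1, sub_zero, smul_eq_mul, add_sub_cancel_right]
    rw [neg_add_eq_sub]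
    field_simp
  · have h1 : Continuous fun s : ℝ => HurwitzZeta.hurwitzZetaOdd x (s - 1) := by
      have := hO.continuous
      fun_prop
    have h2 : Continuous fun s : ℝ => HurwitzZeta.cosZeta y (s + 1) := by
      have : Differentiable ℂ (HurwitzZeta.cosZeta y) := fun s =>
        HurwitzZeta.differentiableAt_cosZeta y (Or.inr hy)
      have := this.continuous
      fun_prop
    refine ((h1.mul h2).tendsto' 0 0 ?_).mono_left nhdsWithin_le_nhds
    simp [hO1]

/-- The even × sine products contribute the rational phase p, whose exact value is irrelevant
because it becomes a root of unity. The odd × cosine products contribute derivatives at the residues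
b with jb = 0. -/
theorem tendsto_zetaSum {N : ℕ} [NeZero N] (j : ZMod N) :
    ∃ p : ℂ, IsRationalPhase p ∧ Tendsto (fun s : ℝ => zetaSum N j s) (𝓝[>] 0)
      (𝓝 (p + N * ∑ b : ZMod N, if j * b = 0 then (psi b.val : ℂ) *
        deriv (HurwitzZeta.hurwitzZetaOdd (ZMod.toAddCircle b)) (-1) else 0)) := by
  have hN : (N : ℂ) ≠ 0 := Nat.cast_ne_zero.2 (NeZero.ne N)
  refine ⟨((N : ℚ) : ℂ) * ∑ b : ZMod N, ((psi b.val : ℚ) : ℂ) *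
    (I * (HurwitzZeta.hurwitzZetaEven (ZMod.toAddCircle b) (-1)
      * HurwitzZeta.sinZeta (ZMod.toAddCircle (j * b)) 1)),
    (IsRationalPhase.sum fun b _ => (isRationalPhase_even_sin j b).ratCast_mul _).ratCast_mul _, ?_⟩
  have h1 : Tendsto (fun s : ℝ => (N : ℂ) ^ (-((s : ℂ) - 1))) (𝓝[>] 0) (𝓝 N) := by
    have : Continuous fun s : ℝ => (N : ℂ) ^ (-((s : ℂ) - 1)) :=
      Continuous.const_cpow (by fun_prop) (Or.inl hN)
    exact (this.tendsto' 0 _ (by simp)).mono_left nhdsWithin_le_nhds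
  have h2 : ∀ b : ZMod N, Tendsto (fun s : ℝ =>
      HurwitzZeta.hurwitzZetaEven (ZMod.toAddCircle b) (s - 1)
        * HurwitzZeta.sinZeta (ZMod.toAddCircle (j * b)) (s + 1)) (𝓝[>] 0)
      (𝓝 (HurwitzZeta.hurwitzZetaEven (ZMod.toAddCircle b) (-1)
        * HurwitzZeta.sinZeta (ZMod.toAddCircle (j * b)) 1)) := by
    intro b
    have c1 : Tendsto (fun s : ℝ => (s : ℂ) - 1) (𝓝[>] 0) (𝓝 (-1)) :=
      (Continuous.tendsto' (by fun_prop) 0 _ (by simp)).mono_left nhdsWithin_le_nhds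
    have c2 : Tendsto (fun s : ℝ => (s : ℂ) + 1) (𝓝[>] 0) (𝓝 1) :=
      (Continuous.tendsto' (by fun_prop) 0 _ (by simp)).mono_left nhdsWithin_le_nhds
    exact ((HurwitzZeta.differentiableAt_hurwitzZetaEven _ (by norm_num)).continuousAt.tendsto.comp
      c1).mul ((HurwitzZeta.differentiableAt_sinZeta _ _).continuousAt.tendsto.comp c2)
  have h3 := h1.mul (tendsto_finsetSum Finset.univ fun b _ => ((tendsto_odd_mul_cos
    (x := ZMod.toAddCircle b) (y := ZMod.toAddCircle (j * b))).add
      ((h2 b).const_mul I)).const_mul (psi b.val : ℂ))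
  refine Tendsto.congr (fun s => rfl) (h3.trans_eq ?_)
  congr 1
  rw [Rat.cast_natCast, ← mul_add, ← Finset.sum_add_distrib]
  congr 1
  refine Finset.sum_congr rfl fun b _ => ?_
  rw [Rat.cast_intCast]
  simp only [ZMod.toAddCircle_eq_zero]
  split_ifs <;> ring

/-! ### The value of the limit at a cusp -/

theorem IsRootOfUnity.mul {z w : ℂ} (hz : IsRootOfUnity z) (hw : IsRootOfUnity w) :
    IsRootOfUnity (z * w) := by
  obtain ⟨m, hm, h1⟩ := hz
  obtain ⟨n, hn, h2⟩ := hw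
  refine ⟨m * n, Nat.mul_pos hm hn, ?_⟩
  rw [mul_pow, pow_mul, h1, one_pow, mul_comm m, pow_mul, h2, one_pow, one_mul]

theorem isRootOfUnity_neg_nome (q : ℚ) : IsRootOfUnity (-nome q) := by
  have h : IsRootOfUnity (cexp (2 * Real.pi * I * q)) := isRationalPhase_iff.1 ⟨q, rfl⟩
  have h1 : IsRootOfUnity (-1) := ⟨2, by norm_num, by norm_num⟩
  simpa [nome] using h1.mul h

theorem potential_isBigO_atTop (r : ℝ) :
    (fun t : ℝ => potential ((r : ℂ) + (t / (2 * Real.pi) : ℝ) * I))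
      =O[atTop] fun t : ℝ => Real.exp (-1 * t) := by
  obtain ⟨C, hC⟩ := polyGrowth_psiCoeff.div_lamExp.norm_le (g := 1)
    fun p hp => absurd hp (by have := lamExp_pos p; omega)
  have hn : ∀ t : ℝ, ‖nome ((r : ℂ) + (t / (2 * Real.pi) : ℝ) * I)‖ = Real.exp (-t) := fun t => by
    rw [nome_vertical, norm_mul, norm_nome_ofReal, one_mul, Complex.norm_real,
      Real.norm_of_nonneg (Real.exp_pos _).le]
  refine IsBigO.of_bound C ?_
  filter_upwards [Real.tendsto_exp_neg_atTop_nhds_zero.eventually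
    (ge_mem_nhds (show (0 : ℝ) < 1 / 2 by norm_num))] with t ht
  have := hC _ ((hn t).trans_le ht)
  rw [pow_one, hn] at this
  rw [Real.norm_of_nonneg (Real.exp_pos _).le, neg_one_mul]
  exact this

theorem continuousOn_potential_vertical (r : ℝ) :
    ContinuousOn (fun t : ℝ => potential ((r : ℂ) + (t / (2 * Real.pi) : ℝ) * I)) (Set.Ioi 0) := by
  intro t ht
  have ht' : 0 < t := ht
  have him : 0 < ((r : ℂ) + (t / (2 * Real.pi) : ℝ) * I).im := by
    rw [add_im, ofReal_im, mul_I_im, ofReal_re, zero_add]; positivity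
  refine ContinuousAt.continuousWithinAt (ContinuousAt.comp' (g := potential)
    (hasDerivAt_potential him).continuousAt ?_)
  fun_prop

/-- The limit of s times the Mellin transform of the potential is computed twice: it is the boundary
value V of the potential, and, since sΓ(s) → 1, also the limit of the zeta sum. The factor -q of
`quantum` tends to a root of unity. -/
theorem exists_tendsto_quantum {a : ℤ} {c m : ℕ} [NeZero (c * m)] (h6 : 6 ∣ c * m)
    (hac : IsCoprime a (c : ℤ)) (hc : ¬ (6 : ℤ) ∣ c) :
    ∃ ω : ℂ, IsRootOfUnity ω ∧
      Tendsto (fun y : ℝ => quantum ((a / c : ℝ) + y * I)) (𝓝[>] 0)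
        (𝓝 (ω * cexp (-((c * m : ℕ) * ∑ b : ZMod (c * m), if ((a * m : ℤ) : ZMod (c * m)) * b = 0
          then (psi b.val : ℂ) * deriv (HurwitzZeta.hurwitzZetaOdd (ZMod.toAddCircle b)) (-1)
          else 0)))) := by
  set j : ZMod (c * m) := ((a * m : ℤ) : ZMod (c * m)) with hj
  obtain ⟨V, hV⟩ := exists_potential_vertical hac hc
  rw [Int.cast_natCast] at hV
  obtain ⟨hM, hlim⟩ := tendsto_mul_mellin (continuousOn_potential_vertical (a / c))
    (potential_isBigO_atTop (a / c)) hV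
  obtain ⟨p, hp, hz⟩ := tendsto_zetaSum j
  set W : ℂ := (c * m : ℕ) * ∑ b : ZMod (c * m), if j * b = 0
          then (psi b.val : ℂ) * deriv (HurwitzZeta.hurwitzZetaOdd (ZMod.toAddCircle b)) (-1)
          else 0 with hW
  have heq : ∀ s : ℂ, 0 < s.re → s ≠ 2 →
      mellin (fun t : ℝ => potential ((a / c : ℝ) + (t / (2 * Real.pi) : ℝ) * I)) s
        = Complex.Gamma s * zetaSum (c * m) j s := fun s hs hs2 =>
    eqOn_zetaSum j hM (fun s hs => by
      rw [mellin_potential a c m h6 hs, LFunction_eq_zetaSum h6]) hs hs2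
  have hVW : V = p + W := by
    refine tendsto_nhds_unique hlim ?_
    have h1 := tendsto_ofReal_mul_Gamma.mul hz
    rw [one_mul] at h1
    refine h1.congr' ?_
    filter_upwards [Ioo_mem_nhdsGT (show (0 : ℝ) < 1 by norm_num)] with s hs
    rw [heq s (by simpa using hs.1) (fun h => by
      have : s = 2 := by exact_mod_cast h
      linarith [hs.2])]
    ring
  have hVt : Tendsto (fun t : ℝ => potential ((a / c : ℝ) + (t / (2 * Real.pi) : ℝ) * I)) (𝓝[>] 0)
      (𝓝 V) := by
    have h1 := hV.trans_tendsto (tendsto_id.mono_right nhdsWithin_le_nhds)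
    simpa using h1.add_const V
  have hscale : Tendsto (fun y : ℝ => 2 * Real.pi * y) (𝓝[>] 0) (𝓝[>] 0) := by
    refine tendsto_nhdsWithin_iff.2 ⟨(Continuous.tendsto' (by fun_prop) 0 _ (by simp)).mono_left
      nhdsWithin_le_nhds, ?_⟩
    filter_upwards [self_mem_nhdsWithin] with y hy
    have : 0 < y := hy
    show 0 < 2 * Real.pi * y
    positivity
  have hpot : Tendsto (fun y : ℝ => potential ((a / c : ℝ) + y * I)) (𝓝[>] 0) (𝓝 V) := by
    refine (hVt.comp hscale).congr fun y => ?_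
    have := Real.pi_ne_zero
    simp only [Function.comp]
    rw [mul_div_cancel_left₀ _ (by positivity)]
  have hnome : Tendsto (fun y : ℝ => nome ((a / c : ℝ) + y * I)) (𝓝[>] 0)
      (𝓝 (nome ((a / c : ℚ) : ℚ))) := by
    refine (Continuous.tendsto' (f := fun y : ℝ => nome ((a / c : ℝ) + y * I)) ?_ 0 _ ?_).mono_left
      nhdsWithin_le_nhds
    · unfold nome; fun_prop
    · simp
  refine ⟨-nome ((a / c : ℚ) : ℚ) * cexp (-p),
    (isRootOfUnity_neg_nome _).mul (isRationalPhase_iff.1 ?_), ?_⟩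
  · have := hp.ratCast_mul (-1)
    simpa using this
  · rw [mul_assoc, ← Complex.exp_add, ← neg_add, ← hVW]
    exact hnome.neg.mul hpot.neg.cexp

theorem intCast_mul_eq_zero_iff {a : ℤ} {c m : ℕ} [NeZero (c * m)] (hac : IsCoprime a (c : ℤ))
    (b : ZMod (c * m)) : ((a * m : ℤ) : ZMod (c * m)) * b = 0 ↔ c ∣ b.val := by
  have hm : (m : ℤ) ≠ 0 := by
    have := NeZero.ne (c * m); exact_mod_cast (mul_ne_zero_iff.1 this).2
  have e : ((a * m : ℤ) : ZMod (c * m)) * b = ((a * b.val * m : ℤ) : ZMod (c * m)) := by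
    push_cast
    rw [ZMod.natCast_zmod_val]
    ring
  rw [e, ZMod.intCast_zmod_eq_zero_iff_dvd, Nat.cast_mul, mul_dvd_mul_iff_right hm,
    ← Int.natCast_dvd_natCast]
  exact ⟨hac.symm.dvd_of_dvd_mul_left, fun h => h.mul_left _⟩

/-! ### Evaluation of the exponent -/

/-- The derivative at `-1` of the odd Hurwitz zeta function with parameter `1 / 3`. -/
noncomputable def oddDeriv : ℂ :=
  deriv (HurwitzZeta.hurwitzZetaOdd ((1 / 3 : ℝ) : UnitAddCircle)) (-1)

theorem deriv_hurwitzZetaOdd_neg (x : UnitAddCircle) (s : ℂ) :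
    deriv (HurwitzZeta.hurwitzZetaOdd (-x)) s = -deriv (HurwitzZeta.hurwitzZetaOdd x) s := by
  rw [show HurwitzZeta.hurwitzZetaOdd (-x) = fun s => -HurwitzZeta.hurwitzZetaOdd x s from
    funext fun s => HurwitzZeta.hurwitzZetaOdd_neg x s, deriv.fun_neg]

theorem coe_two_thirds : ((2 / 3 : ℝ) : UnitAddCircle) = -((1 / 3 : ℝ) : UnitAddCircle) := by
  rw [eq_neg_iff_add_eq_zero, ← AddCircle.coe_add]
  exact (AddCircle.coe_eq_zero_iff 1).2 ⟨1, by norm_num⟩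

theorem sum_dvd_three {c : ℕ} [NeZero (c * 3)] (f : ZMod (c * 3) → ℂ) (h0 : f 0 = 0) :
    ∑ b : ZMod (c * 3), (if c ∣ b.val then f b else 0)
      = f (c : ℕ) + f ((2 * c : ℕ)) := by
  have hc : 0 < c := by
    have := NeZero.ne (c * 3); omega
  have v1 : ((c : ℕ) : ZMod (c * 3)).val = c := ZMod.val_natCast_of_lt (by omega)
  have v2 : ((2 * c : ℕ) : ZMod (c * 3)).val = 2 * c := ZMod.val_natCast_of_lt (by omega)
  have hne : ((c : ℕ) : ZMod (c * 3)) ≠ ((2 * c : ℕ) : ZMod (c * 3)) := fun h => by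
    have := congrArg ZMod.val h
    omega
  rw [← Finset.sum_pair (f := f) hne]
  symm
  refine Finset.sum_subset_zero_on_sdiff (Finset.subset_univ _) (fun b hb => ?_) (fun b hb => ?_)
  · split_ifs with hd
    · obtain ⟨k, hk⟩ := hd
      have hlt := ZMod.val_lt b
      have hk3 : k < 3 := by
        rw [hk] at hlt
        exact Nat.lt_of_mul_lt_mul_left hlt
      have hb' : b = ((c * k : ℕ) : ZMod (c * 3)) := by rw [← hk, ZMod.natCast_zmod_val]
      have hb2 := (Finset.mem_sdiff.1 hb).2
      rw [Finset.mem_insert, Finset.mem_singleton, not_or] at hb2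
      interval_cases k
      · rw [hb', mul_zero, Nat.cast_zero, h0]
      · exact absurd (by rw [hb', mul_one]) hb2.1
      · exact absurd (by rw [hb', mul_comm c 2]) hb2.2
    · rfl
  · rcases Finset.mem_insert.1 hb with rfl | hb
    · rw [v1, if_pos dvd_rfl]
    · rw [Finset.mem_singleton.1 hb, v2, if_pos (Dvd.intro_left 2 rfl)]

/-- The multiples of c modulo 3c are 0, c and 2c. The residue 0 drops out because ψ(0) = 0, and the
parameters 1/3 and 2/3 = -1/3 have opposite derivatives. -/
theorem cusp_sum_of_even {a : ℤ} {c : ℕ} [NeZero (c * 3)] (hac : IsCoprime a (c : ℤ)) :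
    ∑ b : ZMod (c * 3), (if ((a * (3 : ℕ) : ℤ) : ZMod (c * 3)) * b = 0
      then (psi b.val : ℂ) * deriv (HurwitzZeta.hurwitzZetaOdd (ZMod.toAddCircle b)) (-1) else 0)
      = (psi c - psi (2 * c)) * oddDeriv := by
  have hc : 0 < c := by
    have := NeZero.ne (c * 3); omega
  have hc' : (c : ℝ) ≠ 0 := by exact_mod_cast hc.ne'
  simp only [intCast_mul_eq_zero_iff hac]
  rw [sum_dvd_three (fun b : ZMod (c * 3) => (psi b.val : ℂ)
    * deriv (HurwitzZeta.hurwitzZetaOdd (ZMod.toAddCircle b)) (-1)) (by simp [psi])]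
  have e1 : ZMod.toAddCircle ((c : ℕ) : ZMod (c * 3)) = ((1 / 3 : ℝ) : UnitAddCircle) := by
    rw [ZMod.toAddCircle_natCast]
    congr 1
    push_cast
    field_simp
  have e2 : ZMod.toAddCircle ((2 * c : ℕ) : ZMod (c * 3)) = ((2 / 3 : ℝ) : UnitAddCircle) := by
    rw [ZMod.toAddCircle_natCast]
    congr 1
    push_cast
    field_simp
  rw [e1, e2, coe_two_thirds, deriv_hurwitzZetaOdd_neg,
    ZMod.val_natCast_of_lt (by omega : c < c * 3), ZMod.val_natCast_of_lt (by omega : 2 * c < c * 3),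
    oddDeriv]
  ring

/-- All contributing residues are divisible by 3, where ψ vanishes. Hence only a root of unity
remains in case 6I. -/
theorem cusp_sum_of_three {a : ℤ} {c : ℕ} [NeZero (c * 2)] (hac : IsCoprime a (c : ℤ)) (h3 : 3 ∣ c) :
    ∑ b : ZMod (c * 2), (if ((a * (2 : ℕ) : ℤ) : ZMod (c * 2)) * b = 0
      then (psi b.val : ℂ) * deriv (HurwitzZeta.hurwitzZetaOdd (ZMod.toAddCircle b)) (-1) else 0)
      = 0 := by
  refine Finset.sum_eq_zero fun b _ => ?_
  split_ifs with h
  · rw [intCast_mul_eq_zero_iff hac] at h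
    have h3b := h3.trans h
    have : psi b.val = 0 := by
      unfold psi
      split_ifs <;> omega
    rw [this]; simp
  · rfl

/-- Here L(s, χ) = 3⁻ˢ · 2 O(s) with O the odd Hurwitz zeta function at 1/3; since O(-1) = 0, only
the derivative of O contributes, with the factor 3 · 2. -/
theorem deriv_LFunction_chi3 : deriv (DirichletCharacter.LFunction chi3) (-1) = 6 * oddDeriv := by
  have h1 : chi3 1 = 1 := map_one _
  have h2 : chi3 2 = -1 := by
    have : quadraticChar (ZMod 3) 2 = -1 := by decide
    rw [chi3, MulChar.ringHomComp_apply, this]; simp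
  have h0 : chi3 0 = 0 := MulChar.map_zero _
  have hodd : Function.Odd (fun b : ZMod 3 => chi3 b) := by
    intro b
    have h : b = 0 ∨ b = 1 ∨ b = 2 := by revert b; decide
    rcases h with rfl | rfl | rfl
    · simp [h0]
    · show chi3 (-1) = -chi3 1
      rw [show (-1 : ZMod 3) = 2 by decide, h1, h2]
    · show chi3 (-2) = -chi3 2
      rw [show (-2 : ZMod 3) = 1 by decide, h1, h2, neg_neg]
  have e1 : ZMod.toAddCircle (1 : ZMod 3) = ((1 / 3 : ℝ) : UnitAddCircle) := by
    have := ZMod.toAddCircle_natCast (N := 3) 1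
    simpa using this
  have e2 : ZMod.toAddCircle (2 : ZMod 3) = -((1 / 3 : ℝ) : UnitAddCircle) := by
    rw [← e1, ← map_neg]; rfl
  set O := HurwitzZeta.hurwitzZetaOdd ((1 / 3 : ℝ) : UnitAddCircle) with hO
  have hL : DirichletCharacter.LFunction chi3 = fun s => (3 : ℂ) ^ (-s) * (2 * O s) := by
    funext s
    rw [DirichletCharacter.LFunction, ZMod.LFunction_def_odd hodd]
    rw [show (Finset.univ : Finset (ZMod 3)) = {0, 1, 2} by decide]
    rw [Finset.sum_insert (by decide), Finset.sum_pair (by decide), h0, h1, h2, e1, e2,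
      HurwitzZeta.hurwitzZetaOdd_neg]
    push_cast
    ring
  have hO1 : O (-1) = 0 := by
    have := HurwitzZeta.hurwitzZetaOdd_neg_two_mul_nat_sub_one ((1 / 3 : ℝ) : UnitAddCircle) 0
    rwa [Nat.cast_zero, mul_zero, zero_sub] at this
  have hd1 : DifferentiableAt ℂ (fun s : ℂ => (3 : ℂ) ^ (-s)) (-1) :=
    DifferentiableAt.const_cpow (by fun_prop) (Or.inl (by norm_num))
  have hd2 : HasDerivAt O oddDeriv (-1) :=
    (HurwitzZeta.differentiable_hurwitzZetaOdd _ (-1)).hasDerivAt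
  rw [hL, (hd1.hasDerivAt.fun_mul (hd2.const_mul 2)).deriv, hO1, neg_neg, cpow_one]
  ring

/-- Differentiate the functional equation at s = 2. The factor sin(πs/2) vanishes there, so only its
derivative -π/2 matters, multiplied by 2/(2π)². -/
theorem oddDeriv_eq : oddDeriv = 1 / (4 * Real.pi) *
    HurwitzZeta.sinZeta ((1 / 3 : ℝ) : UnitAddCircle) 2 := by
  set x : UnitAddCircle := ((1 / 3 : ℝ) : UnitAddCircle) with hx
  have hpi : (Real.pi : ℂ) ≠ 0 := by exact_mod_cast Real.pi_ne_zero
  have hO : HasDerivAt (HurwitzZeta.hurwitzZetaOdd x) oddDeriv (1 - 2) := by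
    rw [show (1 - 2 : ℂ) = -1 by norm_num]
    exact (HurwitzZeta.differentiable_hurwitzZetaOdd _ (-1)).hasDerivAt
  have h1 : HasDerivAt (fun s : ℂ => HurwitzZeta.hurwitzZetaOdd x (1 - s)) (-oddDeriv) 2 := by
    have := HasDerivAt.comp (h₂ := HurwitzZeta.hurwitzZetaOdd x) (2 : ℂ) hO
      ((hasDerivAt_id (2 : ℂ)).const_sub 1)
    rwa [mul_neg_one] at this
  let A : ℂ → ℂ := fun s => 2 * (2 * Real.pi) ^ (-s) * Complex.Gamma s
  have hA : DifferentiableAt ℂ A 2 := by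
    refine DifferentiableAt.fun_mul (DifferentiableAt.const_mul (DifferentiableAt.const_cpow
      (by fun_prop) (Or.inl (by simp [hpi]))) _) (Complex.differentiableAt_Gamma _ fun m h => ?_)
    have h2 := congrArg Complex.re h
    simp at h2
    linarith [(Nat.cast_nonneg m : (0 : ℝ) ≤ m)]
  have hS := (HurwitzZeta.differentiableAt_sinZeta x (2 : ℂ)).hasDerivAt
  have hsin : HasDerivAt (fun s : ℂ => Complex.sin (Real.pi * s / 2)) (-(Real.pi / 2)) 2 := by
    have h3 := (((hasDerivAt_id (2 : ℂ)).const_mul (Real.pi : ℂ)).div_const 2).csin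
    refine h3.congr_deriv ?_
    simp only [id, mul_one]
    rw [mul_div_cancel_right₀ _ (two_ne_zero), Complex.cos_pi]
    ring
  have h2 := (hA.hasDerivAt.fun_mul hsin).fun_mul hS
  have heq : (fun s : ℂ => HurwitzZeta.hurwitzZetaOdd x (1 - s)) =ᶠ[𝓝 2]
      fun s => A s * Complex.sin (Real.pi * s / 2) * HurwitzZeta.sinZeta x s := by
    filter_upwards [(isOpen_lt continuous_const continuous_re).mem_nhds
      (show (0 : ℝ) < (2 : ℂ).re by norm_num)] with s hs
    refine HurwitzZeta.hurwitzZetaOdd_one_sub x fun n h => ?_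
    rw [h] at hs
    simp at hs
    linarith [(Nat.cast_nonneg n : (0 : ℝ) ≤ n)]
  have h3 := h1.unique (h2.congr_of_eventuallyEq heq)
  have hA2 : A 2 = 2 / (2 * Real.pi) ^ 2 := by
    simp only [A]
    rw [show Complex.Gamma 2 = 1 by simp, Complex.cpow_neg]
    norm_num
    ring
  rw [mul_div_cancel_right₀ _ (two_ne_zero), Complex.sin_pi, hA2] at h3
  have h4 : oddDeriv = -(-oddDeriv) := (neg_neg _).symm
  rw [h4, h3]
  field_simp
  ring

/-- Adding ζ(2) makes all terms nonnegative. Keeping only n = 1 leaves the inequality √3/2 + 1 >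
π²/6. -/
theorem re_sinZeta_pos : 0 < (HurwitzZeta.sinZeta ((1 / 3 : ℝ) : UnitAddCircle) 2).re := by
  have h1 := HurwitzZeta.hasSum_nat_sinZeta (1 / 3) (s := 2) (by norm_num)
  have h2 : HasSum (fun n : ℕ => Real.sin (2 * Real.pi * (1 / 3) * n) / (n : ℝ) ^ 2)
      (HurwitzZeta.sinZeta ((1 / 3 : ℝ) : UnitAddCircle) 2).re := by
    have h0 := Complex.hasSum_re h1
    have : (fun n : ℕ => Real.sin (2 * Real.pi * (1 / 3) * n) / (n : ℝ) ^ 2) = fun n : ℕ =>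
        (((Real.sin (2 * Real.pi * (1 / 3) * n) : ℝ) : ℂ) / (n : ℂ) ^ (2 : ℂ)).re := by
      funext n
      rw [← Complex.ofReal_re (Real.sin (2 * Real.pi * (1 / 3) * n) / (n : ℝ) ^ 2)]
      congr 1
      push_cast
      rw [Complex.cpow_ofNat]
    rw [this]
    exact h0
  have h3 := h2.add hasSum_zeta_two
  have h4 := h3.summable.sum_le_tsum {1} (fun n _ => ?_)
  · rw [h3.tsum_eq, Finset.sum_singleton] at h4
    have hs : Real.sin (2 * Real.pi * (1 / 3)) = √3 / 2 := by
      rw [show 2 * Real.pi * (1 / 3) = Real.pi - Real.pi / 3 by ring, Real.sin_pi_sub,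
        Real.sin_pi_div_three]
    norm_num at h4
    have h5 : Real.pi < 3.15 := Real.pi_lt_d2
    have h6 : (1.7 : ℝ) < √3 := by
      rw [Real.lt_sqrt (by norm_num)]; norm_num
    nlinarith [Real.pi_pos]
  · rw [← add_div]
    have := Real.neg_one_le_sin (2 * Real.pi * (1 / 3) * n)
    apply div_nonneg <;> [linarith; positivity]

theorem re_oddDeriv_pos : 0 < oddDeriv.re := by
  rw [oddDeriv_eq, show (1 / (4 * Real.pi) : ℂ) = ((1 / (4 * Real.pi) : ℝ) : ℂ) by push_cast; rfl,
    Complex.re_ofReal_mul]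
  have := re_sinZeta_pos
  positivity

/-- For positive c the residues c and 2c are 2 and 4 modulo 6, so ψ(c) - ψ(2c) = 2; with the modulus
3c the exponent is 6c times the derivative at 1/3, which is c L'(-1, χ). -/
theorem exists_tendsto_quantum_of_two {a c : ℤ} (hac : IsCoprime a c) (hc : c ≡ 2 [ZMOD 6]) :
    ∃ ω : ℂ, IsRootOfUnity ω ∧ Tendsto (fun y : ℝ => quantum ((a / c : ℝ) + y * I)) (𝓝[>] 0)
      (𝓝 (ω * cexp (-(c : ℂ) * deriv (DirichletCharacter.LFunction chi3) (-1)))) := by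
  rw [deriv_LFunction_chi3]
  have hc' : c % 6 = 2 := hc
  obtain ⟨n, rfl | rfl⟩ := c.eq_nat_or_neg
  · have : NeZero (n * 3) := ⟨by omega⟩
    obtain ⟨ω, hω, h⟩ := exists_tendsto_quantum (m := 3) (by omega) hac (by omega)
    have h1 : psi n = 1 := by unfold psi; split_ifs <;> omega
    have h2 : psi (2 * n) = -1 := by unfold psi; split_ifs <;> omega
    refine ⟨ω, hω, ?_⟩
    rw [cusp_sum_of_even hac, h1, h2] at h
    rw [Int.cast_natCast, Int.cast_natCast]
    refine h.trans_eq ?_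
    congr 3
    push_cast
    ring
  -- For c = -n the cusp is (-a)/n with n ≡ 4 mod 6. Now ψ(n) - ψ(2n) = -2, which restores the sign
  -- of c in the exponent.
  · have : NeZero (n * 3) := ⟨by omega⟩
    have hac' : IsCoprime (-a) (n : ℤ) := by simpa using hac.neg_neg
    obtain ⟨ω, hω, h⟩ := exists_tendsto_quantum (m := 3) (by omega) hac' (by omega)
    have h1 : psi n = -1 := by unfold psi; split_ifs <;> omega
    have h2 : psi (2 * n) = 1 := by unfold psi; split_ifs <;> omega
    refine ⟨ω, hω, ?_⟩
    rw [cusp_sum_of_even hac', h1, h2] at h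
    have e : (a : ℝ) / ((-(n : ℤ) : ℤ) : ℝ) = ((-a : ℤ) : ℝ) / n := by
      push_cast; rw [div_neg, neg_div]
    rw [e]
    refine h.trans_eq ?_
    congr 3
    push_cast
    ring

theorem exists_tendsto_quantum_of_three {a c : ℤ} (hac : IsCoprime a c) (hc : c ≡ 3 [ZMOD 6]) :
    ∃ ω : ℂ, IsRootOfUnity ω ∧
      Tendsto (fun y : ℝ => quantum ((a / c : ℝ) + y * I)) (𝓝[>] 0) (𝓝 ω) := by
  have hc' : c % 6 = 3 := hc
  have key : ∀ (a : ℤ) (n : ℕ), IsCoprime a (n : ℤ) → n % 6 = 3 → ∃ ω : ℂ, IsRootOfUnity ω ∧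
      Tendsto (fun y : ℝ => quantum ((a / n : ℝ) + y * I)) (𝓝[>] 0) (𝓝 ω) := by
    intro a n hac hn
    have : NeZero (n * 2) := ⟨by omega⟩
    obtain ⟨ω, hω, h⟩ := exists_tendsto_quantum (m := 2) (by omega) hac (by omega)
    refine ⟨ω, hω, ?_⟩
    rwa [cusp_sum_of_three hac (by omega), mul_zero, neg_zero, Complex.exp_zero, mul_one] at h
  obtain ⟨n, rfl | rfl⟩ := c.eq_nat_or_neg
  · simpa using key a n hac (by omega)
  · obtain ⟨ω, hω, h⟩ := key (-a) n (by simpa using hac.neg_neg) (by omega)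
    refine ⟨ω, hω, ?_⟩
    have e : (a : ℝ) / ((-(n : ℤ) : ℤ) : ℝ) = ((-a : ℤ) : ℝ) / n := by
      push_cast; rw [div_neg, neg_div]
    rwa [e]

theorem isLimitAtCusp_of_tendsto (d : Smoothing) {a c : ℤ} (hac : IsCoprime a c)
    (hc : ¬ (6 : ℤ) ∣ c) {L : ℂ}
    (h : Tendsto (fun y : ℝ => quantum ((a / c : ℝ) + y * I)) (𝓝[>] 0) (𝓝 L)) :
    IsLimitAtCusp d (a / c) L := by
  obtain ⟨L', h1, h2⟩ := exists_cusp_limit hac hc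
  rw [tendsto_nhds_unique h h1]
  exact isLimitAtCusp_of_quantum d h2

/-! ### The representatives of the transition points -/

/-- Clear the denominator k: the image of the column (1, k) is primitive, and its second entry is
congruent to k because the lower row of the matrix is (0, 1) modulo 6. -/
theorem exists_of_mem_orbit {k : ℤ} (hk : k ≠ 0) {A : Matrix.SpecialLinearGroup (Fin 2) ℤ}
    (hA : A ∈ CongruenceSubgroup.Gamma1 6) :
    ∃ a c : ℤ, IsCoprime a c ∧ c ≡ k [ZMOD 6] ∧
      ((A 0 0 : ℚ) * (1 / k) + (A 0 1 : ℚ)) / ((A 1 0 : ℚ) * (1 / k) + (A 1 1 : ℚ)) = a / c := by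
  obtain ⟨-, h11, h10⟩ := (CongruenceSubgroup.Gamma1_mem 6 A).1 hA
  have hdet := Matrix.SpecialLinearGroup.det_coe A
  rw [Matrix.det_fin_two] at hdet
  refine ⟨A 0 0 + k * A 0 1, A 1 0 + k * A 1 1, ⟨A 1 1, -A 0 1, by linear_combination hdet⟩, ?_, ?_⟩
  · have : ((A 1 0 + k * A 1 1 : ℤ) : ZMod 6) = (k : ℤ) := by
      push_cast; rw [h11, h10]; ring
    exact (ZMod.intCast_eq_intCast_iff _ _ 6).1 this
  · have hk' : (k : ℚ) ≠ 0 := by exact_mod_cast hk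
    push_cast
    rw [← mul_div_mul_left _ _ hk']
    congr 1 <;> field_simp

/-- A matrix sending the column (1, 2) to (a, c) has the form (a - 2y, y; c - 2x, x), with
determinant ax - cy. It suffices to find x ≡ 1 mod 6 inverse to a modulo c; the congruences for the
other entries follow from c ≡ 2. -/
theorem mem_transitionPoint_sixII {a c : ℤ} (hac : IsCoprime a c) (hc : c ≡ 2 [ZMOD 6]) :
    (a : ℚ) / c ∈ transitionPoint .sixII := by
  have hc' : c % 6 = 2 := hc
  have h3 : IsCoprime c 3 := by
    rcases (by omega : c % 3 = 2) with h
    exact ⟨-1, (c + 1) / 3, by omega⟩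
  obtain ⟨u, v, huv⟩ := hac
  obtain ⟨s, t, hst⟩ := h3
  obtain ⟨x, hx1, hx2⟩ : ∃ x : ℤ, c ∣ a * x - 1 ∧ x % 6 = 1 := by
    -- Start with an inverse u of a modulo c. It is odd because c is even. As cs ≡ 1 mod 3, adding
    -- cs(1 - u) makes it 1 modulo 3 without changing its parity.
    refine ⟨u + c * (s * (1 - u)), ⟨a * (s * (1 - u)) - v, by linear_combination huv⟩, ?_⟩
    have e : u + c * (s * (1 - u)) = 1 + 3 * (-(t * (1 - u))) := by
      linear_combination (1 - u) * hst
    have hodd : u % 2 = 1 := by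
      by_contra hu
      obtain ⟨k, hk⟩ : (2 : ℤ) ∣ u := by omega
      obtain ⟨l, hl⟩ : (2 : ℤ) ∣ c := by omega
      rw [hk, hl] at huv
      have : 2 * (k * a + v * l) = 1 := by linear_combination huv
      omega
    have h2 : (u + c * (s * (1 - u))) % 2 = 1 := by
      obtain ⟨l, hl⟩ : (2 : ℤ) ∣ c := by omega
      rw [hl, mul_assoc]
      omega
    omega
  obtain ⟨y, hy⟩ := hx1
  let A : Matrix.SpecialLinearGroup (Fin 2) ℤ :=
    ⟨!![a - 2 * y, y; c - 2 * x, x], by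
      rw [Matrix.det_fin_two_of]; linear_combination hy⟩
  have e00 : A 0 0 = a - 2 * y := rfl
  have e01 : A 0 1 = y := rfl
  have e10 : A 1 0 = c - 2 * x := rfl
  have e11 : A 1 1 = x := rfl
  have hcQ : (c : ℚ) ≠ 0 := by
    have : c ≠ 0 := by omega
    exact_mod_cast this
  have z1 : ∀ n : ℤ, n % 6 = 1 → (n : ZMod 6) = 1 := fun n hn => by
    have := (ZMod.intCast_eq_intCast_iff n 1 6).2 hn
    simpa using this
  refine ⟨A, (CongruenceSubgroup.Gamma1_mem 6 A).2 ⟨?_, ?_, ?_⟩, ?_, ?_⟩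
  · rw [e00]
    refine z1 _ ?_
    obtain ⟨k, hk⟩ : ∃ k, x = 6 * k + 1 := ⟨x / 6, by omega⟩
    obtain ⟨l, hl⟩ : ∃ l, c = 6 * l + 2 := ⟨c / 6, by omega⟩
    have : a - 2 * y = 1 + 6 * (y * l - k * a) := by
      rw [hk, hl] at hy
      linear_combination hy
    omega
  · rw [e11]; exact z1 _ hx2
  · rw [e10]
    have := (ZMod.intCast_eq_intCast_iff (c - 2 * x) 0 6).2 (by unfold Int.ModEq; omega)
    simpa using this
  · rw [e10, e11, baseCusp]
    push_cast
    intro h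
    apply hcQ
    linear_combination 2 * h
  · rw [e00, e01, e10, e11, baseCusp]
    push_cast
    symm
    rw [← mul_div_mul_left _ _ (two_ne_zero (α := ℚ))]
    congr 1 <;> ring

theorem not_isRootOfUnity_of_norm_ne_one {z : ℂ} (h : ‖z‖ ≠ 1) : ¬ IsRootOfUnity z := by
  rintro ⟨n, hn, hz⟩
  exact h (norm_eq_one_of_pow_eq_one hz hn.ne')

/-- The absolute value is exp(-6c Re(`oddDeriv`)), which differs from 1 as the real part is positive
and c ≠ 0. -/
theorem not_isRootOfUnity_limit {ω : ℂ} (hω : IsRootOfUnity ω) {c : ℤ} (hc : c ≠ 0) :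
    ¬ IsRootOfUnity (ω * cexp (-(c : ℂ) * deriv (DirichletCharacter.LFunction chi3) (-1))) := by
  obtain ⟨n, hn, h⟩ := hω
  refine not_isRootOfUnity_of_norm_ne_one ?_
  rw [norm_mul, norm_eq_one_of_pow_eq_one h hn.ne', one_mul, Complex.norm_exp, deriv_LFunction_chi3,
    show -(c : ℂ) * (6 * oddDeriv) = ((-(c : ℝ) * 6 : ℝ) : ℂ) * oddDeriv by push_cast; ring,
    Complex.re_ofReal_mul, Ne, Real.exp_eq_one_iff]
  have h1 : (c : ℝ) ≠ 0 := by exact_mod_cast hc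
  exact mul_ne_zero (mul_ne_zero (neg_ne_zero.2 h1) (by norm_num)) re_oddDeriv_pos.ne'

end DelPezzo

theorem theorem1p4 :
    (∀ r ∈ DelPezzo.transitionPoint .sixI,
      ∃ ω : ℂ, DelPezzo.IsRootOfUnity ω ∧ DelPezzo.IsLimitAtCusp .sixI r ω) ∧
    (∀ r ∈ DelPezzo.transitionPoint .sixII,
      ∃ a c : ℤ, IsCoprime a c ∧ c ≡ 2 [ZMOD 6] ∧ r = (a : ℚ) / (c : ℚ)) ∧
    (∀ a c : ℤ, IsCoprime a c → c ≡ 2 [ZMOD 6] →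
      (a : ℚ) / (c : ℚ) ∈ DelPezzo.transitionPoint .sixII ∧
      ∃ ω : ℂ, DelPezzo.IsRootOfUnity ω ∧
        DelPezzo.IsLimitAtCusp .sixII ((a : ℚ) / (c : ℚ))
          (ω * Complex.exp (-(c : ℂ) * deriv (DirichletCharacter.LFunction DelPezzo.chi3) (-1))) ∧
        ¬ DelPezzo.IsRootOfUnity
          (ω * Complex.exp
            (-(c : ℂ) * deriv (DirichletCharacter.LFunction DelPezzo.chi3) (-1)))) := by
  refine ⟨?_, ?_, ?_⟩
  · rintro r ⟨A, hA, -, rfl⟩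
    obtain ⟨a, c, hac, hc, h⟩ := DelPezzo.exists_of_mem_orbit (k := 3) (by norm_num) hA
    have hc' : c % 6 = 3 := hc
    obtain ⟨ω, hω, hlim⟩ := DelPezzo.exists_tendsto_quantum_of_three hac hc
    refine ⟨ω, hω, ?_⟩
    have h1 := DelPezzo.isLimitAtCusp_of_tendsto .sixI hac (by omega) hlim
    rwa [← h] at h1
  · rintro r ⟨A, hA, -, rfl⟩
    obtain ⟨a, c, hac, hc, h⟩ := DelPezzo.exists_of_mem_orbit (k := 2) (by norm_num) hA
    exact ⟨a, c, hac, hc, by rw [← h]; norm_num [DelPezzo.baseCusp]⟩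
  · intro a c hac hc
    have hc' : c % 6 = 2 := hc
    obtain ⟨ω, hω, hlim⟩ := DelPezzo.exists_tendsto_quantum_of_two hac hc
    exact ⟨DelPezzo.mem_transitionPoint_sixII hac hc, ω, hω,
      DelPezzo.isLimitAtCusp_of_tendsto .sixII hac (by omega) hlim,
      DelPezzo.not_isRootOfUnity_limit hω (by omega)⟩
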